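/- Let $\mathfrak g$ be a seven-dimensional real Lie algebra with a six-dimensional Abelian ideal $\mathfrak u$, and let $f_7\in\mathfrak g\setminus\mathfrak u$. For $\epsilon\in\{-1,1\}$ put $$\varphi_\epsilon=-\epsilon\,(e^{127}+e^{347})+e^{567}+e^{135}-e^{146}-e^{236}-e^{245}\in\Lambda^3(\mathbb R^7)^*,\qquad g_\epsilon=-\epsilon\sum_{i=1}^4(e^i)^2+\sum_{i=5}^7(e^i)^2 .$$ A three-form $\varphi\in\Lambda^3\mathfrak g^*$ is called a $G_2$-structure (for $\epsilon=-1$), respectively a $G_2^*$-structure (for $\epsilon=1$), if $\varphi=F^*\varphi_\epsilon$ for some linear isomorphism $F:\mathfrak g\to\mathbb R^7$; its induced (pseudo-)Euclidean metric is $g_\varphi=F^*g_\epsilon$, which does not depend on the choice of $F$. Let $\nabla:\mathfrak g\times\mathfrak g\to\mathfrak g$ be the Levi-Civita connection of the left-invariant metric defined by $g_\varphi$. The structure $\varphi$ is called parallel if $\nabla\varphi=0$, and flat if the curvature of $\nabla$ vanishes. A subspace has signature $(p,q)$ if $g_\varphi$ restricted to it has $p$ positive and $q$ negative directions and no null radical.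 Set $M_{a,b}=\begin{pmatrix}a&b\\-b&a\end{pmatrix}$. Then: (a) $\mathfrak g$ admits a parallel $G_2$-structure if and only if there are $a,b\in\mathbb R$ and a basis of $\mathfrak u$ with respect to which $\operatorname{ad}(f_7)|_{\mathfrak u}=\operatorname{diag}(M_{0,a},M_{0,b},M_{0,-a-b})$. (b) $\mathfrak g$ admits a parallel $G_2^*$-structure such that $\mathfrak u$ has signature $(2,4)$ if and only if there is a basis of $\mathfrak u$ with respect to which $\operatorname{ad}(f_7)|_{\mathfrak u}$ is one of the matrices $$\begin{pmatrix}M_{a,b}&&\\&M_{-a,b}&\\&&M_{0,-2b}\end{pmatrix},\quad\begin{pmatrix}M_{0,c}&&\\&M_{0,d}&\\&&M_{0,-(c+d)}\end{pmatrix},\quad\begin{pmatrix}M_{0,e}&I_2&\\&M_{0,e}&\\&&M_{0,-2e}\end{pmatrix},\quad\begin{pmatrix}0&I_2&\\&0&I_2\\&&0\end{pmatrix}$$ with $a\in\mathbb R\setminus\{0\}$ and $b,c,d,e\in\mathbb R$. (c) $\mathfrak g$ admits a parallel $G_2^*$-structure such that $\mathfrak u$ has signature $(3,3)$ if and only if the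 complex Jordan normal form of $\operatorname{ad}(f_7)|_{\mathfrak u}$ is, up to a permutation of the Jordan blocks, of the form $\operatorname{diag}(J_1,J_2)$, where $J_1\in\mathbb C^{3\times3}$ is a complex Jordan normal form of some real $3\times3$ matrix, $\operatorname{tr}(J_1)=0$, and $J_2$ is obtained from $J_1$ by multiplying its diagonal entries by $-1$. (d) Every parallel $G_2$-structure on $\mathfrak g$ is flat, and every parallel $G_2^*$-structure on $\mathfrak g$ for which $g_\varphi|_{\mathfrak u}$ is non-degenerate is flat. -/

import Mathlib

namespace ParallelG2

/-! ### Model tensors on `ℝ⁷` -/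

/-- The three-form `eⁱ ∧ eʲ ∧ eᵏ` on `ℝ⁷`, with indices counted from `0`. -/
noncomputable def coordForm (i j k : Fin 7) : (Fin 7 → ℝ) [⋀^Fin 3]→ₗ[ℝ] ℝ :=
  (Matrix.detRowAlternating (R := ℝ) (n := Fin 3)).compLinearMap
    (LinearMap.funLeft ℝ ℝ ![i, j, k])

/-- The model three-form
`φ_ε = -ε (e¹²⁷ + e³⁴⁷) + e⁵⁶⁷ + e¹³⁵ - e¹⁴⁶ - e²³⁶ - e²⁴⁵`, `ε ∈ {1, -1}`. -/
noncomputable def modelForm (ε : ℤˣ) : (Fin 7 → ℝ) [⋀^Fin 3]→ₗ[ℝ] ℝ :=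
  (-((ε : ℤ) : ℝ)) • (coordForm 0 1 6 + coordForm 2 3 6) + coordForm 4 5 6
    + coordForm 0 2 4 - coordForm 0 3 5 - coordForm 1 2 5 - coordForm 1 3 4

/-- The diagonal of the model metric: `-ε` four times and `1` three times. -/
def modelDiag (ε : ℤˣ) : Fin 7 → ℤ :=
  ![-(ε : ℤ), -(ε : ℤ), -(ε : ℤ), -(ε : ℤ), 1, 1, 1]

/-- The model (pseudo-)Euclidean metric on `ℝ⁷`: the Euclidean one for `ε = -1`, and
`-(e¹)² - (e²)² - (e³)² - (e⁴)² + (e⁵)² + (e⁶)² + (e⁷)²` for `ε = 1`. -/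
noncomputable def modelMetric (ε : ℤˣ) : LinearMap.BilinForm ℝ (Fin 7 → ℝ) :=
  Matrix.toBilin' (Matrix.diagonal fun i => (modelDiag ε i : ℝ))

section Structures

variable {V : Type*} [AddCommGroup V] [Module ℝ V]

/-- `f : V ≃ ℝ⁷` identifies `φ` with the model three-form, i.e. `f⁻¹ e₁, …, f⁻¹ e₇` is an
adapted basis. -/
def IsAdapted (ε : ℤˣ) (φ : V [⋀^Fin 3]→ₗ[ℝ] ℝ) (f : V ≃ₗ[ℝ] (Fin 7 → ℝ)) : Prop :=
  φ = (modelForm ε).compLinearMap (f : V →ₗ[ℝ] (Fin 7 → ℝ))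

/-- `φ` is a `G₂`-structure (`ε = -1`) or a `G₂*`-structure (`ε = 1`) on `V`. -/
def IsG2Structure (ε : ℤˣ) (φ : V [⋀^Fin 3]→ₗ[ℝ] ℝ) : Prop :=
  ∃ f : V ≃ₗ[ℝ] (Fin 7 → ℝ), IsAdapted ε φ f

open Classical in
/-- The (pseudo-)Euclidean metric `g_φ` induced by a `G₂`- or `G₂*`-structure `φ`: the model
metric in an adapted basis. By `inducedMetric_apply` below it is the same in every adapted basis.
It is `0` if `φ` is not such a structure. -/
noncomputable def inducedMetric (ε : ℤˣ) (φ : V [⋀^Fin 3]→ₗ[ℝ] ℝ) : LinearMap.BilinForm ℝ V :=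
  if h : IsG2Structure ε φ then
    (modelMetric ε).comp (h.choose : V →ₗ[ℝ] (Fin 7 → ℝ)) (h.choose : V →ₗ[ℝ] (Fin 7 → ℝ))
  else 0

end Structures

/-! ### Every adapted basis induces the same metric -/

section WellDefined

/-- Integer table lookup. -/
def tab (N : ℕ) (i j k : Fin 7) : ℤ :=
  ((N / 4 ^ (49 * i.val + 7 * j.val + k.val)) % 4 : ℕ) - 1

/-- The components of the model three-form. -/
def comps (ε : ℤˣ) : Fin 7 → Fin 7 → Fin 7 → ℤ :=
  if ε = 1 then
    tab 0x1555515595555955155559551595555515555565565545545515595555555565554545556555155545545555955565565555955545556155555565554555551565565545545555559555559565554545556551555555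
  else
    tab 0x1555515595555155955551559595555515555565565545545515595555555565554545556555955545545555155565565555155545556955555565554555559565565545545555551555551565554545556559555555

def sg (a b : Fin 7) : ℤ := if a.val < b.val then 1 else if b.val < a.val then -1 else 0

def mz (a b : ℤ) : ℤ := if a = 0 then 0 else a * b

def su (f : Fin 7 → ℤ) : ℤ := f 0 + f 1 + f 2 + f 3 + f 4 + f 5 + f 6

/-- The component `(i, j)` of `v ⌟ φ ∧ w ⌟ φ ∧ φ`, up to a constant factor. -/
def cubic (c : Fin 7 → Fin 7 → Fin 7 → ℤ) (i j : Fin 7) : ℤ :=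
  su fun a => su fun b => mz (c i a b * sg a b) <| su fun p => mz (sg a p * sg b p) <| su fun q =>
    mz (c j p q * sg a q * sg b q * sg p q) <| su fun e =>
      mz (sg a e * sg b e * sg p e * sg q e) <| su fun f =>
        mz (sg a f * sg b f * sg p f * sg q f * sg e f) <| su fun g =>
          sg a g * sg b g * sg p g * sg q g * sg e g * sg f g * c e f g

set_option maxRecDepth 100000 in
theorem cubic_comps (ε : ℤˣ) (i j : Fin 7) :
    cubic (comps ε) i j = if i = j then 144 * modelDiag ε i else 0 := by
  revert i j
  rcases Int.units_eq_one_or ε with rfl | rfl <;> decide +kernel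

theorem su_eq (f : Fin 7 → ℤ) : su f = ∑ i, f i := by
  simp [su, Fin.sum_univ_succ]; ring

theorem mz_eq (a b : ℤ) : mz a b = a * b := by
  unfold mz; split_ifs with h <;> simp [h]

/-- The Levi-Civita symbol. -/
def lc (x : Fin 7 → Fin 7) : ℤ := ∏ j, ∏ i ∈ Finset.Iio j, sg (x i) (x j)

theorem sign_eq_lc (σ : Equiv.Perm (Fin 7)) : ((σ.sign : ℤˣ) : ℤ) = lc σ := by
  rw [σ.sign_eq_prod_prod_Iio, lc]
  push_cast
  refine Finset.prod_congr rfl fun j _ => Finset.prod_congr rfl fun i hi => ?_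
  have hne : σ i ≠ σ j := fun h => (Finset.mem_Iio.1 hi).ne (σ.injective h)
  have : (σ i).val ≠ (σ j).val := fun h => hne (Fin.ext h)
  simp only [sg, Fin.lt_def]
  split_ifs <;> first | rfl | omega

theorem lc_eq_zero (x : Fin 7 → Fin 7) (h : ¬ Function.Injective x) : lc x = 0 := by
  simp only [Function.Injective, not_forall] at h
  obtain ⟨i, j, hij, hne⟩ := h
  wlog hlt : i < j generalizing i j
  · exact this j i hij.symm (Ne.symm hne) (lt_of_le_of_ne (not_lt.1 hlt) (Ne.symm hne))
  exact Finset.prod_eq_zero (Finset.mem_univ j)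
    (Finset.prod_eq_zero (Finset.mem_Iio.2 hlt) (by simp [sg, hij]))

theorem perm_sum (F : (Fin 7 → Fin 7) → ℤ) :
    ∑ σ : Equiv.Perm (Fin 7), ((σ.sign : ℤˣ) : ℤ) * F σ = ∑ x : Fin 7 → Fin 7, lc x * F x := by
  symm
  rw [← Finset.sum_subset (Finset.subset_univ
    (Finset.univ.filter fun x : Fin 7 → Fin 7 => Function.Injective x))]
  · symm
    refine Finset.sum_bij (fun σ _ => (σ : Fin 7 → Fin 7)) ?_ ?_ ?_ ?_
    · intro σ _; simpa using σ.injective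
    · intro σ _ τ _ h; exact DFunLike.coe_injective h
    · intro x hx
      have hx' : Function.Injective x := by simpa using hx
      exact ⟨Equiv.ofBijective x (Finite.injective_iff_bijective.1 hx'), Finset.mem_univ _, rfl⟩
    · intro σ _; rw [sign_eq_lc]
  · intro x _ hx
    rw [lc_eq_zero x (by simpa using hx), zero_mul]

theorem fun_sum_succ {n : ℕ} (G : (Fin (n + 1) → Fin 7) → ℤ) :
    ∑ x, G x = ∑ a, ∑ y : Fin n → Fin 7, G (Matrix.vecCons a y) := by
  rw [← Fintype.sum_prod_type', ← (Fin.consEquiv fun _ => Fin 7).sum_comp]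
  rfl

theorem cubic_eq_perm_sum (c : Fin 7 → Fin 7 → Fin 7 → ℤ) (i j : Fin 7) :
    ∑ σ : Equiv.Perm (Fin 7), ((σ.sign : ℤˣ) : ℤ) *
      (c i (σ 0) (σ 1) * c j (σ 2) (σ 3) * c (σ 4) (σ 5) (σ 6)) = cubic c i j := by
  rw [perm_sum fun x => c i (x 0) (x 1) * c j (x 2) (x 3) * c (x 4) (x 5) (x 6)]
  simp only [cubic, su_eq, mz_eq, fun_sum_succ, Finset.mul_sum, Finset.univ_unique,
    Finset.sum_singleton]
  refine Finset.sum_congr rfl fun a _ => Finset.sum_congr rfl fun b _ =>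
    Finset.sum_congr rfl fun p _ => Finset.sum_congr rfl fun q _ =>
    Finset.sum_congr rfl fun e _ => Finset.sum_congr rfl fun f _ =>
    Finset.sum_congr rfl fun g _ => ?_
  have hl : lc ![a, b, p, q, e, f, g] = sg a b * (sg a p * sg b p) * (sg a q * sg b q * sg p q)
      * (sg a e * sg b e * sg p e * sg q e) * (sg a f * sg b f * sg p f * sg q f * sg e f)
      * (sg a g * sg b g * sg p g * sg q g * sg e g * sg f g) := by
    have h0 : Finset.Iio (0 : Fin 7) = ∅ := by decide
    have h1 : Finset.Iio (1 : Fin 7) = {0} := by decide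
    have h2 : Finset.Iio (2 : Fin 7) = {0, 1} := by decide
    have h3 : Finset.Iio (3 : Fin 7) = {0, 1, 2} := by decide
    have h4 : Finset.Iio (4 : Fin 7) = {0, 1, 2, 3} := by decide
    have h5 : Finset.Iio (5 : Fin 7) = {0, 1, 2, 3, 4} := by decide
    have h6 : Finset.Iio (6 : Fin 7) = {0, 1, 2, 3, 4, 5} := by decide
    rw [lc, Fin.prod_univ_seven, h0, h1, h2, h3, h4, h5, h6]
    simp [Finset.prod_insert]
    ring
  have hv : ∀ y : Fin 0 → Fin 7, (Matrix.vecCons a (Matrix.vecCons b (Matrix.vecCons p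
      (Matrix.vecCons q (Matrix.vecCons e (Matrix.vecCons f (Matrix.vecCons g y))))))) =
      ![a, b, p, q, e, f, g] := fun y => by rw [Subsingleton.elim y ![]]
  rw [hv, hl]
  simp
  ring

def dl (a b : Fin 7) : ℤ := if b = a then 1 else 0

/-- The components of `eᵃ ∧ eᵇ ∧ eᶜ`. -/
def coordComps (a b c i j k : Fin 7) : ℤ :=
  dl i a * dl j b * dl k c - dl i a * dl j c * dl k b - dl i b * dl j a * dl k c
    + dl i b * dl j c * dl k a + dl i c * dl j a * dl k b - dl i c * dl j b * dl k a

theorem coordForm_single (a b c i j k : Fin 7) :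
    coordForm a b c ![Pi.single i 1, Pi.single j 1, Pi.single k 1] =
      (coordComps a b c i j k : ℝ) := by
  have h : coordForm a b c ![Pi.single i 1, Pi.single j 1, Pi.single k 1] =
      Matrix.det (Matrix.of ![![(dl i a : ℝ), dl i b, dl i c], ![(dl j a : ℝ), dl j b, dl j c],
        ![(dl k a : ℝ), dl k b, dl k c]]) := by
    simp only [coordForm, AlternatingMap.compLinearMap_apply]
    change Matrix.det _ = _
    congr 1
    ext x y
    fin_cases x <;> fin_cases y <;> simp [LinearMap.funLeft_apply, dl, Pi.single_apply]
  rw [h, Matrix.det_fin_three]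
  simp [coordComps]

theorem comps_eq (ε : ℤˣ) (i j k : Fin 7) : comps ε i j k =
    -(ε : ℤ) * (coordComps 0 1 6 i j k + coordComps 2 3 6 i j k) + coordComps 4 5 6 i j k
    + coordComps 0 2 4 i j k - coordComps 0 3 5 i j k - coordComps 1 2 5 i j k
    - coordComps 1 3 4 i j k := by
  revert i j k
  rcases Int.units_eq_one_or ε with rfl | rfl <;> decide +kernel

theorem modelForm_single (ε : ℤˣ) (i j k : Fin 7) :
    modelForm ε ![Pi.single i 1, Pi.single j 1, Pi.single k 1] = (comps ε i j k : ℝ) := by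
  rw [comps_eq]
  simp only [modelForm, AlternatingMap.add_apply, AlternatingMap.sub_apply,
    AlternatingMap.smul_apply, coordForm_single, smul_eq_mul]
  push_cast
  ring

theorem update_zero {α : Type*} (a b c x : α) : Function.update ![a, b, c] 0 x = ![x, b, c] := by
  ext i; fin_cases i <;> rfl

theorem update_one {α : Type*} (a b c x : α) : Function.update ![a, b, c] 1 x = ![a, x, c] := by
  ext i; fin_cases i <;> rfl

theorem update_two {α : Type*} (a b c x : α) : Function.update ![a, b, c] 2 x = ![a, b, x] := by
  ext i; fin_cases i <;> rfl

theorem form_add {V : Type*} [AddCommGroup V] [Module ℝ V] (φ : V [⋀^Fin 3]→ₗ[ℝ] ℝ)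
    (a b c x y : V) :
    φ ![x + y, b, c] = φ ![x, b, c] + φ ![y, b, c] ∧
    φ ![a, x + y, c] = φ ![a, x, c] + φ ![a, y, c] ∧
    φ ![a, b, x + y] = φ ![a, b, x] + φ ![a, b, y] := by
  have h0 := φ.map_update_add ![a, b, c] 0 x y
  have h1 := φ.map_update_add ![a, b, c] 1 x y
  have h2 := φ.map_update_add ![a, b, c] 2 x y
  simp only [update_zero, update_one, update_two] at h0 h1 h2
  exact ⟨h0, h1, h2⟩

theorem form_smul {V : Type*} [AddCommGroup V] [Module ℝ V] (φ : V [⋀^Fin 3]→ₗ[ℝ] ℝ)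
    (a b c x : V) (t : ℝ) :
    φ ![t • x, b, c] = t * φ ![x, b, c] ∧ φ ![a, t • x, c] = t * φ ![a, x, c] ∧
    φ ![a, b, t • x] = t * φ ![a, b, x] := by
  have h0 := φ.map_update_smul ![a, b, c] 0 t x
  have h1 := φ.map_update_smul ![a, b, c] 1 t x
  have h2 := φ.map_update_smul ![a, b, c] 2 t x
  simp only [update_zero, update_one, update_two] at h0 h1 h2
  exact ⟨h0, h1, h2⟩

/-- The seven-linear map whose antisymmetrization is a multiple of `v ⌟ φ ∧ w ⌟ φ ∧ φ`. -/
noncomputable def septic (ε : ℤˣ) (v w : Fin 7 → ℝ) :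
    MultilinearMap ℝ (fun _ : Fin 7 => Fin 7 → ℝ) ℝ :=
  MultilinearMap.mk'
    (fun x => modelForm ε ![v, x 0, x 1] * modelForm ε ![w, x 2, x 3]
      * modelForm ε ![x 4, x 5, x 6])
    (by
      intro m i x y
      have h := fun a b c => form_add (modelForm ε) a b c x y
      fin_cases i <;>
        simp [Function.update, (h 0 _ _).1, (h _ 0 _).2.1, (h _ _ 0).2.2] <;> ring)
    (by
      intro m i t x
      have h := fun a b c => form_smul (modelForm ε) a b c x t
      fin_cases i <;>
        simp [Function.update, (h 0 _ _).1, (h _ 0 _).2.1, (h _ _ 0).2.2] <;> ring)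

theorem septic_apply (ε : ℤˣ) (v w : Fin 7 → ℝ) (x : Fin 7 → Fin 7 → ℝ) :
    septic ε v w x = modelForm ε ![v, x 0, x 1] * modelForm ε ![w, x 2, x 3]
      * modelForm ε ![x 4, x 5, x 6] := rfl

theorem modelForm_expand (ε : ℤˣ) (v x y : Fin 7 → ℝ) :
    modelForm ε ![v, x, y] = ∑ i, v i * modelForm ε ![Pi.single i 1, x, y] := by
  have h := ((modelForm ε).toMultilinearMap.toLinearMap ![0, x, y] 0).pi_apply_eq_sum_univ v
  simp only [MultilinearMap.toLinearMap_apply, update_zero, smul_eq_mul] at h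
  refine h.trans (Finset.sum_congr rfl fun i _ => ?_)
  have hs : (fun j => if i = j then (1 : ℝ) else 0) = Pi.single i 1 := by
    ext j; simp [Pi.single_apply, eq_comm]
  rw [hs]
  rfl

theorem modelMetric_apply (ε : ℤˣ) (v w : Fin 7 → ℝ) :
    modelMetric ε v w = ∑ i, (modelDiag ε i : ℝ) * v i * w i := by
  simp only [modelMetric, Matrix.toBilin'_apply, Matrix.diagonal_apply]
  refine Finset.sum_congr rfl fun i _ => ?_
  rw [Finset.sum_eq_single i] <;> simp +contextual [eq_comm, mul_comm, mul_left_comm]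

theorem septic_alternatization (ε : ℤˣ) (v w : Fin 7 → ℝ) :
    (septic ε v w).alternatization (fun i => Pi.single i 1) = 144 * modelMetric ε v w := by
  have key : ∀ i j : Fin 7, ∑ σ : Equiv.Perm (Fin 7), (((σ.sign : ℤˣ) : ℤ) : ℝ) *
      ((comps ε i (σ 0) (σ 1) : ℝ) * comps ε j (σ 2) (σ 3) * comps ε (σ 4) (σ 5) (σ 6)) =
      if i = j then 144 * (modelDiag ε i : ℝ) else 0 := by
    intro i j
    have h := (cubic_eq_perm_sum (comps ε) i j).trans (cubic_comps ε i j)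
    have h' := congrArg (Int.cast : ℤ → ℝ) h
    push_cast at h'
    exact h'
  rw [MultilinearMap.alternatization_apply]
  have h1 : ∀ σ : Equiv.Perm (Fin 7),
      Equiv.Perm.sign σ • (septic ε v w).domDomCongr σ (fun i => Pi.single i 1) =
      ∑ i, ∑ j, v i * w j * ((((σ.sign : ℤˣ) : ℤ) : ℝ) *
      ((comps ε i (σ 0) (σ 1) : ℝ) * comps ε j (σ 2) (σ 3) * comps ε (σ 4) (σ 5) (σ 6))) := by
    intro σ
    rw [MultilinearMap.domDomCongr_apply, septic_apply, modelForm_expand ε v, modelForm_expand ε w]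
    simp only [modelForm_single, Units.smul_def, zsmul_eq_mul, Finset.sum_mul, Finset.mul_sum]
    rw [Finset.sum_comm]
    refine Finset.sum_congr rfl fun i _ => Finset.sum_congr rfl fun j _ => ?_
    ring
  rw [Finset.sum_congr rfl fun σ _ => h1 σ, Finset.sum_comm]
  rw [modelMetric_apply, Finset.mul_sum]
  refine Finset.sum_congr rfl fun i _ => ?_
  rw [Finset.sum_comm]
  simp only [← Finset.mul_sum, key]
  simp
  ring

/-- A linear automorphism of `ℝ⁷` that preserves the model three-form preserves the model
metric. -/
theorem modelMetric_of_stabilizer (ε : ℤˣ) (f : (Fin 7 → ℝ) ≃ₗ[ℝ] (Fin 7 → ℝ))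
    (hf : IsAdapted ε (modelForm ε) f) (v w : Fin 7 → ℝ) :
    modelMetric ε (f v) (f w) = modelMetric ε v w := by
  have hφ : ∀ x y z, modelForm ε ![f x, f y, f z] = modelForm ε ![x, y, z] := by
    intro x y z
    conv_rhs => rw [show modelForm ε = _ from hf]
    rw [AlternatingMap.compLinearMap_apply]
    congr 1
    ext i
    fin_cases i <;> rfl
  have hs : ∀ v w, LinearMap.det (f : (Fin 7 → ℝ) →ₗ[ℝ] (Fin 7 → ℝ)) *
      modelMetric ε (f v) (f w) = modelMetric ε v w := by
    intro v w
    have h1 : (septic ε (f v) (f w)).alternatization (fun i => f (Pi.single i 1)) =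
        (septic ε v w).alternatization (fun i => Pi.single i 1) := by
      simp only [MultilinearMap.alternatization_apply, MultilinearMap.domDomCongr_apply,
        septic_apply, hφ]
    have h2 := congrArg (fun A : (Fin 7 → ℝ) [⋀^Fin 7]→ₗ[ℝ] ℝ => A fun i => f (Pi.single i 1))
      (((septic ε (f v) (f w)).alternatization).eq_smul_basis_det (Pi.basisFun ℝ (Fin 7)))
    have h3 : (Pi.basisFun ℝ (Fin 7)).det (fun i => f (Pi.single i 1)) =
        LinearMap.det (f : (Fin 7 → ℝ) →ₗ[ℝ] (Fin 7 → ℝ)) := by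
      have := (Pi.basisFun ℝ (Fin 7)).det_comp (f : (Fin 7 → ℝ) →ₗ[ℝ] (Fin 7 → ℝ))
        (Pi.basisFun ℝ (Fin 7))
      rw [Module.Basis.det_self, mul_one] at this
      rw [← this]
      congr 1
      ext i
      simp
    have h4 : ((Pi.basisFun ℝ (Fin 7)) : Fin 7 → Fin 7 → ℝ) = fun i => Pi.single i 1 := by
      ext i; simp
    simp only [AlternatingMap.smul_apply, h4, septic_alternatization, h3, h1, smul_eq_mul] at h2
    linarith
  set d := LinearMap.det (f : (Fin 7 → ℝ) →ₗ[ℝ] (Fin 7 → ℝ)) with hd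
  have hd1 : d = 1 := by
    have hM : d • ((LinearMap.toMatrix' (f : (Fin 7 → ℝ) →ₗ[ℝ] (Fin 7 → ℝ))).transpose *
        (Matrix.diagonal fun i => (modelDiag ε i : ℝ)) *
        LinearMap.toMatrix' (f : (Fin 7 → ℝ) →ₗ[ℝ] (Fin 7 → ℝ))) =
        Matrix.diagonal fun i => (modelDiag ε i : ℝ) := by
      have hc : Matrix.toBilin' ((LinearMap.toMatrix' (f : (Fin 7 → ℝ) →ₗ[ℝ] _)).transpose *
          (Matrix.diagonal fun i => (modelDiag ε i : ℝ)) *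
          LinearMap.toMatrix' (f : (Fin 7 → ℝ) →ₗ[ℝ] (Fin 7 → ℝ))) =
          (modelMetric ε).comp (f : (Fin 7 → ℝ) →ₗ[ℝ] _) (f : (Fin 7 → ℝ) →ₗ[ℝ] _) := by
        rw [modelMetric, ← Matrix.toBilin'_comp, Matrix.toLin'_toMatrix']
      apply Matrix.toBilin'.injective
      rw [map_smul, hc]
      exact LinearMap.ext fun v => LinearMap.ext fun w => hs v w
    have hdet := congrArg Matrix.det hM
    rw [Matrix.det_smul, Matrix.det_mul, Matrix.det_mul, Matrix.det_transpose,
      LinearMap.det_toMatrix', ← hd, Matrix.det_diagonal] at hdet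
    have hne : (∏ i, (modelDiag ε i : ℝ)) ≠ 0 := by
      rcases Int.units_eq_one_or ε with rfl | rfl <;>
        simp [modelDiag, Fin.prod_univ_succ]
    have h9 : d ^ 9 = 1 := by
      apply mul_right_cancel₀ hne
      rw [Fintype.card_fin] at hdet
      linarith
    have hodd : Odd 9 := by decide
    exact hodd.strictMono_pow.injective (by simpa using h9)
  have := hs v w
  rwa [hd1, one_mul] at this

/-- In every adapted basis the induced metric is the model metric. -/
theorem inducedMetric_apply {V : Type*} [AddCommGroup V] [Module ℝ V] {ε : ℤˣ}
    {φ : V [⋀^Fin 3]→ₗ[ℝ] ℝ} {f : V ≃ₗ[ℝ] (Fin 7 → ℝ)} (hf : IsAdapted ε φ f) (v w : V) :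
    inducedMetric ε φ v w = modelMetric ε (f v) (f w) := by
  have h : IsG2Structure ε φ := ⟨f, hf⟩
  have hc := h.choose_spec
  rw [inducedMetric, dif_pos h]
  have hst : IsAdapted ε (modelForm ε) (f.symm.trans h.choose) := by
    unfold IsAdapted at hf hc ⊢
    ext x
    have h1 := congrArg (fun ψ : V [⋀^Fin 3]→ₗ[ℝ] ℝ => ψ fun i => f.symm (x i)) (hf.symm.trans hc)
    simpa [AlternatingMap.compLinearMap_apply, Function.comp_def] using h1
  have := modelMetric_of_stabilizer ε _ hst (f v) (f w)
  simpa using this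

/-- The metric induced by a `G₂`- or `G₂*`-structure is symmetric and non-degenerate. -/
theorem inducedMetric_symm_nondegenerate {V : Type*} [AddCommGroup V] [Module ℝ V] {ε : ℤˣ}
    {φ : V [⋀^Fin 3]→ₗ[ℝ] ℝ} (h : IsG2Structure ε φ) :
    (∀ v w, inducedMetric ε φ v w = inducedMetric ε φ w v) ∧ (inducedMetric ε φ).Nondegenerate := by
  obtain ⟨f, hf⟩ := h
  have hs : ∀ v w, inducedMetric ε φ v w = inducedMetric ε φ w v := fun v w => by
    simp only [inducedMetric_apply hf, modelMetric_apply]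
    exact Finset.sum_congr rfl fun i _ => by ring
  have hne : ∀ i, (modelDiag ε i : ℝ) ≠ 0 := by
    intro i
    rcases Int.units_eq_one_or ε with rfl | rfl <;> fin_cases i <;> simp [modelDiag]
  have hz : ∀ v, (∀ w, inducedMetric ε φ v w = 0) → v = 0 := by
    intro v hv
    apply f.injective
    ext i
    have := hv (f.symm (Pi.single i 1))
    simp only [inducedMetric_apply hf, modelMetric_apply, LinearEquiv.apply_symm_apply] at this
    simpa [Pi.single_apply, hne i] using this
  exact ⟨hs, hz, fun v hv => hz v fun w => (hs v w).trans (hv w)⟩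

end WellDefined

/-! ### Left-invariant Levi-Civita connection, curvature and parallel forms -/

section Connection

variable {𝔤 : Type*} [LieRing 𝔤] [LieAlgebra ℝ 𝔤]

/-- The right-hand side of the Koszul formula for left-invariant vector fields:
`Z ↦ ½ (g([X, Y], Z) - g([Y, Z], X) + g([Z, X], Y))`. -/
noncomputable def koszul (g : LinearMap.BilinForm ℝ 𝔤) : 𝔤 →ₗ[ℝ] 𝔤 →ₗ[ℝ] Module.Dual ℝ 𝔤 :=
  LinearMap.mk₂ ℝ
    (fun X Y => (1 / 2 : ℝ) • (g ⁅X, Y⁆ - g.flip X ∘ₗ (LieAlgebra.ad ℝ 𝔤 Y : 𝔤 →ₗ[ℝ] 𝔤)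
      - g.flip Y ∘ₗ (LieAlgebra.ad ℝ 𝔤 X : 𝔤 →ₗ[ℝ] 𝔤)))
    (by intros; ext; simp; ring)
    (by intros; ext; simp; ring)
    (by intros; ext; simp; ring)
    (by intros; ext; simp; ring)

theorem koszul_apply (g : LinearMap.BilinForm ℝ 𝔤) (X Y Z : 𝔤) :
    koszul g X Y Z = 1 / 2 * (g ⁅X, Y⁆ Z - g ⁅Y, Z⁆ X + g ⁅Z, X⁆ Y) := by
  rw [← lie_skew Z X, map_neg, LinearMap.neg_apply]
  simp [koszul]
  ring

variable [FiniteDimensional ℝ 𝔤]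

open Classical in
/-- The Levi-Civita connection `∇ : 𝔤 × 𝔤 → 𝔤` of a non-degenerate symmetric bilinear form on a Lie
algebra, i.e. of the corresponding left-invariant metric; `0` if the form is degenerate. -/
noncomputable def leviCivita (g : LinearMap.BilinForm ℝ 𝔤) : 𝔤 →ₗ[ℝ] 𝔤 →ₗ[ℝ] 𝔤 :=
  if h : g.Nondegenerate then (koszul g).compr₂ (g.toDual h).symm.toLinearMap else 0

theorem apply_leviCivita {g : LinearMap.BilinForm ℝ 𝔤} (hg : g.Nondegenerate) (X Y Z : 𝔤) :
    g (leviCivita g X Y) Z = 1 / 2 * (g ⁅X, Y⁆ Z - g ⁅Y, Z⁆ X + g ⁅Z, X⁆ Y) := by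
  rw [← koszul_apply, leviCivita, dif_pos hg]
  simp

/-- The Levi-Civita connection is the unique torsion-free metric connection. -/
theorem eq_leviCivita_iff {g : LinearMap.BilinForm ℝ 𝔤} (hg : g.Nondegenerate)
    (hs : ∀ X Y, g X Y = g Y X) (D : 𝔤 →ₗ[ℝ] 𝔤 →ₗ[ℝ] 𝔤) :
    D = leviCivita g ↔
      (∀ X Y, D X Y - D Y X = ⁅X, Y⁆) ∧ ∀ X Y Z, g (D X Y) Z + g Y (D X Z) = 0 := by
  have hinj : ∀ {u v : 𝔤}, (∀ Z, g u Z = g v Z) → u = v := fun h =>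
    (g.toDual hg).injective (LinearMap.ext h)
  have hl : ∀ X Y Z, g ⁅X, Y⁆ Z = -g ⁅Y, X⁆ Z := fun X Y Z => by
    rw [← lie_skew X Y, map_neg, LinearMap.neg_apply]
  constructor
  · rintro rfl
    refine ⟨fun X Y => hinj fun Z => ?_, fun X Y Z => ?_⟩
    · rw [map_sub, LinearMap.sub_apply, apply_leviCivita hg, apply_leviCivita hg,
        hl Y X, hl X Z, hl Z Y]
      ring
    · rw [hs Y, apply_leviCivita hg, apply_leviCivita hg, hl Y X, hl X Z, hl Z Y]
      ring
  · rintro ⟨ht, hm⟩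
    refine LinearMap.ext fun X => LinearMap.ext fun Y => hinj fun Z => ?_
    rw [apply_leviCivita hg, ← ht X Y, ← ht Y Z, ← ht Z X]
    have h1 := hm X Y Z
    have h2 := hm Y X Z
    have h3 := hm Z X Y
    have s1 := hs Y (D X Z)
    have s2 := hs X (D Y Z)
    have s3 := hs X (D Z Y)
    simp only [map_sub, LinearMap.sub_apply]
    linarith

/-- The covariant derivative `(∇_X φ)(Y₁, Y₂, Y₃)` of a left-invariant three-form. -/
def covDeriv (D : 𝔤 →ₗ[ℝ] 𝔤 →ₗ[ℝ] 𝔤) (φ : 𝔤 [⋀^Fin 3]→ₗ[ℝ] ℝ) (X : 𝔤) (Y : Fin 3 → 𝔤) : ℝ :=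
  -∑ i, φ (Function.update Y i (D X (Y i)))

/-- The curvature `R(X, Y)Z = ∇_X ∇_Y Z - ∇_Y ∇_X Z - ∇_[X, Y] Z`. -/
def curvature (D : 𝔤 →ₗ[ℝ] 𝔤 →ₗ[ℝ] 𝔤) (X Y Z : 𝔤) : 𝔤 :=
  D X (D Y Z) - D Y (D X Z) - D ⁅X, Y⁆ Z

/-- The left-invariant metric defined by `g` is flat. -/
def IsFlat (g : LinearMap.BilinForm ℝ 𝔤) : Prop :=
  ∀ X Y Z, curvature (leviCivita g) X Y Z = 0

/-- `φ` is a parallel `G₂`-structure (`ε = -1`) or a parallel `G₂*`-structure (`ε = 1`) on the Lie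
algebra: `φ` is such a structure and `∇φ = 0` for the Levi-Civita connection of `g_φ`. -/
def IsParallelG2Structure (ε : ℤˣ) (φ : 𝔤 [⋀^Fin 3]→ₗ[ℝ] ℝ) : Prop :=
  IsG2Structure ε φ ∧ ∀ X Y, covDeriv (leviCivita (inducedMetric ε φ)) φ X Y = 0

end Connection

/-- The restriction of the symmetric bilinear form `g` to `W` has signature `(p, q)`: `p` positive
and `q` negative directions (maximal dimensions of positive and negative definite subspaces). -/
def HasSignatureOn {V : Type*} [AddCommGroup V] [Module ℝ V] (g : LinearMap.BilinForm ℝ V)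
    (W : Submodule ℝ V) (p q : ℕ) : Prop :=
  sigPos (g.restrict W).toQuadraticMap = p ∧ sigNeg (g.restrict W).toQuadraticMap = q

/-! ### Matrices -/

/-- The matrix `M_{a,b}`. -/
def M (a b : ℝ) : Matrix (Fin 2) (Fin 2) ℝ := !![a, b; -b, a]

/-- The `6 × 6` matrix with given `2 × 2` blocks. -/
def ofBlocks (X : Matrix (Fin 3) (Fin 3) (Matrix (Fin 2) (Fin 2) ℝ)) :
    Matrix (Fin 6) (Fin 6) ℝ :=
  Matrix.of fun i j =>
    let e : Fin 6 ≃ Fin 3 × Fin 2 := (finProdFinEquiv (m := 3) (n := 2)).symm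
    X (e i).1 (e j).1 (e i).2 (e j).2

/-- `J` is in complex Jordan normal form, i.e. block diagonal with Jordan blocks (`λ` on the
diagonal, `1` directly above it), in any order. -/
def IsJordan {n : ℕ} (J : Matrix (Fin n) (Fin n) ℂ) : Prop :=
  (∀ i j : Fin n, j ≠ i → (j : ℕ) ≠ i + 1 → J i j = 0) ∧
  ∀ i j : Fin n, (j : ℕ) = i + 1 → J i j = 0 ∨ (J i j = 1 ∧ J i i = J j j)

/-- `J` is a complex Jordan normal form of the real matrix `A`. -/
def IsJordanFormOf {n : ℕ} (J : Matrix (Fin n) (Fin n) ℂ) (A : Matrix (Fin n) (Fin n) ℝ) : Prop :=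
  IsJordan J ∧ ∃ P : Matrix (Fin n) (Fin n) ℂ, IsUnit P ∧
    A.map (fun x : ℝ => (x : ℂ)) * P = P * J

/-- `J` with its diagonal multiplied by `-1`. -/
def negDiag {n : ℕ} (J : Matrix (Fin n) (Fin n) ℂ) : Matrix (Fin n) (Fin n) ℂ :=
  Matrix.of fun i j => if i = j then -J i j else J i j

/-- The `6 × 6` block diagonal matrix `diag(J₁, J₂)`. -/
def diagPair (J₁ J₂ : Matrix (Fin 3) (Fin 3) ℂ) : Matrix (Fin 6) (Fin 6) ℂ :=
  Matrix.reindex finSumFinEquiv finSumFinEquiv (Matrix.fromBlocks J₁ 0 0 J₂)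

end ParallelG2

open ParallelG2

/-! Let × be the cross product with g(x × y, z) = φ(x, y, z). Two facts about it carry the proof.
First, x × (x × y) = -g(x,x) y + g(x,y) x (`modelCross_modelCross`). Second, a g-skew endomorphism
annihilating φ is trace-orthogonal to every operator x × · (`trace_comp_modelCross`), as in the
splitting of the skew endomorphisms into the stabilizer algebra of φ and a copy of ℝ⁷.

Suppose φ is parallel and 𝔲 is non-degenerate, and let n be a normal vector, congruent to f₇ modulo
𝔲. For u in 𝔲 the Koszul formula forces ∇_u to have rank at most two, built from n and w = ∇_u n.
Trace orthogonality gives n × w = 0, and the double cross product formula then gives w = 0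
(`leviCivita_eq_zero_of_mem`). So ∇ vanishes along 𝔲 and ∇_n = ad n. Since [𝔤, 𝔤] lies in 𝔲, the
metric is flat.

What remains is linear algebra on 𝔲. The operator A = ad f₇ on 𝔲 is skew, commutes with the skew
operator J = n × ·, and satisfies tr A = tr AJ = 0, while J² = -g(n,n)
(`IsParallelG2Structure.exists_operator`). If g(n,n) > 0, then J rescales to a complex structure and
A is a trace-free skew-Hermitian map of a complex 3-space. Its spectrum is invariant under λ ↦ -conj
λ and sums to zero; with the 3 × 3 Jordan form this leaves the listed matrices, and a definite form
leaves only the diagonalizable imaginary ones. If g(n,n) < 0, the eigenspaces of J are dual null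
3-spaces, so A is diag(B, -Bᵀ) with tr B = 0. A G₂*-metric has signature (3,4), so the signature of
𝔲 decides the sign of g(n,n).

Conversely, if in suitable coordinates ad f₇ preserves the model metric and three-form and f₇ is
normal to 𝔲, then X ↦ (f₇-coefficient of X) · ad f₇ is the Levi-Civita connection and φ is parallel
(`exists_parallel`). Explicit frames realize every normal form; in signature (3,3) one first passes
from similarity over ℂ to similarity over ℝ. -/

namespace ParallelG2

/-! ### The cross product on ℝ⁷. -/

section Model

theorem coordForm_apply (i j k : Fin 7) (x y z : Fin 7 → ℝ) :
    coordForm i j k ![x, y, z] = x i * (y j * z k - y k * z j) - x j * (y i * z k - y k * z i)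
      + x k * (y i * z j - y j * z i) := by
  have h : coordForm i j k ![x, y, z] =
      Matrix.det (Matrix.of ![![x i, x j, x k], ![y i, y j, y k], ![z i, z j, z k]]) := by
    simp only [coordForm, AlternatingMap.compLinearMap_apply]
    change Matrix.det _ = _
    congr 1
    ext a b
    fin_cases a <;> fin_cases b <;> simp [LinearMap.funLeft_apply]
  rw [h, Matrix.det_fin_three]
  simp
  ring

theorem modelForm_apply (ε : ℤˣ) (x y z : Fin 7 → ℝ) :
    modelForm ε ![x, y, z] =
      -((ε : ℤ) : ℝ) * (coordForm 0 1 6 ![x, y, z] + coordForm 2 3 6 ![x, y, z])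
      + coordForm 4 5 6 ![x, y, z] + coordForm 0 2 4 ![x, y, z] - coordForm 0 3 5 ![x, y, z]
      - coordForm 1 2 5 ![x, y, z] - coordForm 1 3 4 ![x, y, z] := by
  simp only [modelForm, AlternatingMap.add_apply, AlternatingMap.sub_apply,
    AlternatingMap.smul_apply, smul_eq_mul]

theorem modelMetric_apply_seven (ε : ℤˣ) (v w : Fin 7 → ℝ) :
    modelMetric ε v w = -((ε : ℤ) : ℝ) * (v 0 * w 0 + v 1 * w 1 + v 2 * w 2 + v 3 * w 3)
      + v 4 * w 4 + v 5 * w 5 + v 6 * w 6 := by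
  rw [modelMetric_apply, Fin.sum_univ_seven]
  simp [modelDiag]
  ring

/-- The cross product of `ℝ⁷` defined by the model three-form and the model metric. -/
noncomputable def modelCross (ε : ℤˣ) :
    (Fin 7 → ℝ) →ₗ[ℝ] (Fin 7 → ℝ) →ₗ[ℝ] (Fin 7 → ℝ) :=
  -- The diagonal entries of the metric are ±1, hence their own inverses, so multiplying by
  -- `modelDiag ε k` raises the index.
  LinearMap.mk₂ ℝ (fun x y k => (modelDiag ε k : ℝ) * modelForm ε ![x, y, Pi.single k 1])
    (fun a b y => by ext k; simp [(form_add (modelForm ε) a y _ a b).1, mul_add])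
    (fun t a y => by ext k; simp [(form_smul (modelForm ε) a y _ a t).1]; ring)
    (fun x a b => by ext k; simp [(form_add (modelForm ε) x a _ a b).2.1, mul_add])
    (fun t x a => by ext k; simp [(form_smul (modelForm ε) x a _ a t).2.1]; ring)

theorem modelCross_apply (ε : ℤˣ) (x y : Fin 7 → ℝ) (k : Fin 7) :
    modelCross ε x y k = (modelDiag ε k : ℝ) * modelForm ε ![x, y, Pi.single k 1] := rfl

theorem modelCross_components (ε : ℤˣ) (x y : Fin 7 → ℝ) :
    modelCross ε x y 0 = x 1 * y 6 - x 6 * y 1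
      - ((ε : ℤ) : ℝ) * (x 2 * y 4 - x 4 * y 2 - x 3 * y 5 + x 5 * y 3) ∧
    modelCross ε x y 1 = x 6 * y 0 - x 0 * y 6
      + ((ε : ℤ) : ℝ) * (x 2 * y 5 - x 5 * y 2 + x 3 * y 4 - x 4 * y 3) ∧
    modelCross ε x y 2 = x 3 * y 6 - x 6 * y 3
      - ((ε : ℤ) : ℝ) * (x 4 * y 0 - x 0 * y 4 + x 1 * y 5 - x 5 * y 1) ∧
    modelCross ε x y 3 = x 6 * y 2 - x 2 * y 6
      + ((ε : ℤ) : ℝ) * (x 5 * y 0 - x 0 * y 5 + x 4 * y 1 - x 1 * y 4) ∧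
    modelCross ε x y 4 = x 5 * y 6 - x 6 * y 5 + x 0 * y 2 - x 2 * y 0 - x 1 * y 3 + x 3 * y 1 ∧
    modelCross ε x y 5 = x 6 * y 4 - x 4 * y 6 - x 0 * y 3 + x 3 * y 0 - x 1 * y 2 + x 2 * y 1 ∧
    modelCross ε x y 6 = -((ε : ℤ) : ℝ) * (x 0 * y 1 - x 1 * y 0 + x 2 * y 3 - x 3 * y 2)
      + x 4 * y 5 - x 5 * y 4 := by
  rcases Int.units_eq_one_or ε with rfl | rfl <;> refine ⟨?_, ?_, ?_, ?_, ?_, ?_, ?_⟩ <;>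
    simp [modelCross_apply, modelForm_apply, coordForm_apply, modelDiag] <;> ring

theorem modelMetric_modelCross (ε : ℤˣ) (x y z : Fin 7 → ℝ) :
    modelMetric ε (modelCross ε x y) z = modelForm ε ![x, y, z] := by
  obtain ⟨h0, h1, h2, h3, h4, h5, h6⟩ := modelCross_components ε x y
  rw [modelMetric_apply_seven, h0, h1, h2, h3, h4, h5, h6, modelForm_apply]
  simp only [coordForm_apply]
  rcases Int.units_eq_one_or ε with rfl | rfl <;> simp <;> ring

/-- For non-null x this makes x × · a multiple of a complex or paracomplex structure on the
orthogonal complement of x; in particular it is injective there. -/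
theorem modelCross_modelCross (ε : ℤˣ) (x y : Fin 7 → ℝ) :
    modelCross ε x (modelCross ε x y) = -modelMetric ε x x • y + modelMetric ε x y • x := by
  obtain ⟨h0, h1, h2, h3, h4, h5, h6⟩ := modelCross_components ε x y
  obtain ⟨k0, k1, k2, k3, k4, k5, k6⟩ := modelCross_components ε x (modelCross ε x y)
  simp only [h0, h1, h2, h3, h4, h5, h6] at k0 k1 k2 k3 k4 k5 k6
  ext i
  simp only [modelMetric_apply_seven, Pi.add_apply, Pi.smul_apply, smul_eq_mul]
  fin_cases i
  · refine k0.trans ?_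
    rcases Int.units_eq_one_or ε with rfl | rfl <;> simp <;> ring
  · refine k1.trans ?_
    rcases Int.units_eq_one_or ε with rfl | rfl <;> simp <;> ring
  · refine k2.trans ?_
    rcases Int.units_eq_one_or ε with rfl | rfl <;> simp <;> ring
  · refine k3.trans ?_
    rcases Int.units_eq_one_or ε with rfl | rfl <;> simp <;> ring
  · refine k4.trans ?_
    rcases Int.units_eq_one_or ε with rfl | rfl <;> simp <;> ring
  · refine k5.trans ?_
    rcases Int.units_eq_one_or ε with rfl | rfl <;> simp <;> ring
  · refine k6.trans ?_
    rcases Int.units_eq_one_or ε with rfl | rfl <;> simp <;> ring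

end Model
-- Trace orthogonality of the stabilizer algebra and the cross products.
section Trace

theorem trace_comp_modelCross_single {ε : ℤˣ} {D : (Fin 7 → ℝ) →ₗ[ℝ] (Fin 7 → ℝ)}
    (hs : ∀ x y, modelMetric ε (D x) y + modelMetric ε x (D y) = 0)
    (hD : ∀ x y z, modelForm ε ![D x, y, z] + modelForm ε ![x, D y, z]
      + modelForm ε ![x, y, D z] = 0) (i : Fin 7) :
    LinearMap.trace ℝ _ (D ∘ₗ modelCross ε (Pi.single i 1)) = 0 := by
  have hsg : ∀ i : Fin 7, (fun j => if i = j then (1 : ℝ) else 0) = Pi.single i 1 := by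
    intro i; ext j; simp [Pi.single_apply, eq_comm]
  have hd : ∀ y k, D y k = ∑ j, y j * D (Pi.single j 1) k := by
    intro y k
    rw [LinearMap.pi_apply_eq_sum_univ D y]
    simp [hsg]
  have hm : ∀ j k : Fin 7, D (Pi.single j 1) k * (modelDiag ε k : ℝ)
      + D (Pi.single k 1) j * (modelDiag ε j : ℝ) = 0 := by
    intro j k
    have := hs (Pi.single j 1) (Pi.single k 1)
    simpa [modelMetric_apply, Pi.single_apply, mul_comm] using this
  have hb : LinearMap.trace ℝ _ (D ∘ₗ modelCross ε (Pi.single i 1)) =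
      ∑ j, ∑ k, modelCross ε (Pi.single i 1) (Pi.single k 1) j * D (Pi.single j 1) k := by
    rw [LinearMap.trace_eq_matrix_trace ℝ (Pi.basisFun ℝ (Fin 7)), Matrix.trace, Finset.sum_comm]
    refine Finset.sum_congr rfl fun k _ => ?_
    simp only [Matrix.diag_apply, LinearMap.toMatrix_apply, LinearMap.comp_apply,
      Pi.basisFun_apply, Pi.basisFun_repr]
    rw [hd]
  have ht := fun a b c : Fin 7 => hD (Pi.single a 1) (Pi.single b 1) (Pi.single c 1)
  generalize hdd : (fun j k => D (Pi.single j 1) k) = d at *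
  replace hdd : ∀ j k, D (Pi.single j 1) k = d j k := fun j k => congrFun (congrFun hdd j) k
  simp only [hdd] at hm hb
  rw [hb]
  simp only [Fin.sum_univ_seven, (modelCross_components ε _ _).1, (modelCross_components ε _ _).2.1,
    (modelCross_components ε _ _).2.2.1, (modelCross_components ε _ _).2.2.2.1,
    (modelCross_components ε _ _).2.2.2.2.1, (modelCross_components ε _ _).2.2.2.2.2.1,
    (modelCross_components ε _ _).2.2.2.2.2.2]
  simp only [modelForm_apply, coordForm_apply, hdd] at ht
  clear hs hD hd hb hsg
  fin_cases i
  -- Crossing with the i-th basis vector matches the other six indices in three pairs, so the trace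
  -- involves only the entries of D within these pairs. The four triples chosen take one index from
  -- each pair and have vanishing φ-component; in the annihilation identity of such a triple exactly
  -- one entry per pair survives. Skewness relates the two entries of a pair. The other values of i
  -- are treated alike.
  · have t1 := ht 1 4 5; have t2 := ht 1 2 3
    have t3 := ht 3 4 6; have t4 := ht 2 5 6
    have m1 := hm 1 6; have m2 := hm 2 4; have m3 := hm 3 5
    clear hm ht hdd D
    rcases Int.units_eq_one_or ε with rfl | rfl <;>
    · simp [modelDiag] at m1 m2 m3
      simp at t1 t2 t3 t4
      simp
      linarith
  · have t1 := ht 0 4 5; have t2 := ht 0 2 3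
    have t3 := ht 3 5 6; have t4 := ht 2 4 6
    have m1 := hm 0 6; have m2 := hm 2 5; have m3 := hm 3 4
    clear hm ht hdd D
    rcases Int.units_eq_one_or ε with rfl | rfl <;>
    · simp [modelDiag] at m1 m2 m3
      simp at t1 t2 t3 t4
      simp
      linarith
  · have t1 := ht 3 4 5; have t2 := ht 0 1 3
    have t3 := ht 1 4 6; have t4 := ht 0 5 6
    have m1 := hm 3 6; have m2 := hm 0 4; have m3 := hm 1 5
    clear hm ht hdd D
    rcases Int.units_eq_one_or ε with rfl | rfl <;>
    · simp [modelDiag] at m1 m2 m3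
      simp at t1 t2 t3 t4
      simp
      linarith
  · have t1 := ht 2 4 5; have t2 := ht 0 1 2
    have t3 := ht 1 5 6; have t4 := ht 0 4 6
    have m1 := hm 2 6; have m2 := hm 0 5; have m3 := hm 1 4
    clear hm ht hdd D
    rcases Int.units_eq_one_or ε with rfl | rfl <;>
    · simp [modelDiag] at m1 m2 m3
      simp at t1 t2 t3 t4
      simp
      linarith
  · have t1 := ht 2 3 5; have t2 := ht 0 1 5
    have t3 := ht 1 2 6; have t4 := ht 0 3 6
    have m1 := hm 5 6; have m2 := hm 0 2; have m3 := hm 1 3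
    clear hm ht hdd D
    rcases Int.units_eq_one_or ε with rfl | rfl <;>
    · simp [modelDiag] at m1 m2 m3
      simp at t1 t2 t3 t4
      simp
      linarith
  · have t1 := ht 2 3 4; have t2 := ht 0 1 4
    have t3 := ht 1 3 6; have t4 := ht 0 2 6
    have m1 := hm 4 6; have m2 := hm 0 3; have m3 := hm 1 2
    clear hm ht hdd D
    rcases Int.units_eq_one_or ε with rfl | rfl <;>
    · simp [modelDiag] at m1 m2 m3
      simp at t1 t2 t3 t4
      simp
      linarith
  · have t1 := ht 1 3 5; have t2 := ht 1 2 4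
    have t3 := ht 0 3 4; have t4 := ht 0 2 5
    have m1 := hm 0 1; have m2 := hm 2 3; have m3 := hm 4 5
    clear hm ht hdd D
    rcases Int.units_eq_one_or ε with rfl | rfl <;>
    · simp [modelDiag] at m1 m2 m3
      simp at t1 t2 t3 t4
      simp
      linarith

/-- A skew-symmetric infinitesimal automorphism of the model three-form is trace-orthogonal to all
cross product operators. -/
theorem trace_comp_modelCross {ε : ℤˣ} {D : (Fin 7 → ℝ) →ₗ[ℝ] (Fin 7 → ℝ)}
    (hs : ∀ x y, modelMetric ε (D x) y + modelMetric ε x (D y) = 0)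
    (hD : ∀ x y z, modelForm ε ![D x, y, z] + modelForm ε ![x, D y, z]
      + modelForm ε ![x, y, D z] = 0) (x : Fin 7 → ℝ) :
    LinearMap.trace ℝ _ (D ∘ₗ modelCross ε x) = 0 := by
  have h : LinearMap.trace ℝ _ ∘ₗ D.compRight ℝ ∘ₗ modelCross ε = 0 :=
    (Pi.basisFun ℝ (Fin 7)).ext fun i => by
      simpa using trace_comp_modelCross_single hs hD i
  simpa using LinearMap.congr_fun h x

end Trace
-- Transport of the cross product to an abstract space.
section Structure

variable {V : Type*} [AddCommGroup V] [Module ℝ V]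

/-- The cross product defined by an adapted basis. -/
noncomputable def adaptedCross (ε : ℤˣ) (f : V ≃ₗ[ℝ] (Fin 7 → ℝ)) : V →ₗ[ℝ] V →ₗ[ℝ] V :=
  ((modelCross ε).compl₁₂ f.toLinearMap f.toLinearMap).compr₂ f.symm.toLinearMap

theorem apply_adaptedCross (ε : ℤˣ) (f : V ≃ₗ[ℝ] (Fin 7 → ℝ)) (X Y : V) :
    f (adaptedCross ε f X Y) = modelCross ε (f X) (f Y) := by
  simp [adaptedCross]

theorem IsAdapted.apply {ε : ℤˣ} {φ : V [⋀^Fin 3]→ₗ[ℝ] ℝ} {f : V ≃ₗ[ℝ] (Fin 7 → ℝ)}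
    (hf : IsAdapted ε φ f) (X Y Z : V) : φ ![X, Y, Z] = modelForm ε ![f X, f Y, f Z] := by
  rw [show φ = _ from hf, AlternatingMap.compLinearMap_apply]
  congr 1
  ext i
  fin_cases i <;> rfl

theorem form_swap (φ : V [⋀^Fin 3]→ₗ[ℝ] ℝ) (x y z : V) :
    φ ![x, z, y] = -φ ![x, y, z] ∧ φ ![y, x, z] = -φ ![x, y, z] := by
  have h1 := φ.map_swap ![x, y, z] (i := 1) (j := 2) (by decide)
  have h2 := φ.map_swap ![x, y, z] (i := 0) (j := 1) (by decide)
  refine ⟨h1 ▸ ?_, h2 ▸ ?_⟩ <;> congr 1 <;> ext i <;> fin_cases i <;> rfl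

/-- The form `φ` is annihilated by the derivation extending the endomorphism `D`. -/
def Annihilates (D : V →ₗ[ℝ] V) (φ : V [⋀^Fin 3]→ₗ[ℝ] ℝ) : Prop :=
  ∀ X Y Z, φ ![D X, Y, Z] + φ ![X, D Y, Z] + φ ![X, Y, D Z] = 0

variable {ε : ℤˣ} {φ : V [⋀^Fin 3]→ₗ[ℝ] ℝ} {f : V ≃ₗ[ℝ] (Fin 7 → ℝ)}

theorem inducedMetric_adaptedCross (hf : IsAdapted ε φ f) (X Y Z : V) :
    inducedMetric ε φ (adaptedCross ε f X Y) Z = φ ![X, Y, Z] := by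
  rw [inducedMetric_apply hf, apply_adaptedCross, modelMetric_modelCross, hf.apply]

theorem adaptedCross_adaptedCross (hf : IsAdapted ε φ f) (X Y : V) :
    adaptedCross ε f X (adaptedCross ε f X Y) =
      -inducedMetric ε φ X X • Y + inducedMetric ε φ X Y • X := by
  apply f.injective
  rw [apply_adaptedCross, apply_adaptedCross, modelCross_modelCross, inducedMetric_apply hf,
    inducedMetric_apply hf]
  simp

theorem trace_comp_adaptedCross (hf : IsAdapted ε φ f) {D : V →ₗ[ℝ] V}
    (hs : ∀ X Y, inducedMetric ε φ (D X) Y + inducedMetric ε φ X (D Y) = 0)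
    (hD : Annihilates D φ) (X : V) :
    LinearMap.trace ℝ V (D ∘ₗ adaptedCross ε f X) = 0 := by
  have h := trace_comp_modelCross (ε := ε) (D := f.conj D)
    (fun x y => by
      have := hs (f.symm x) (f.symm y)
      simpa [inducedMetric_apply hf, LinearEquiv.conj_apply] using this)
    (fun x y z => by
      have := hD (f.symm x) (f.symm y) (f.symm z)
      simpa [hf.apply, LinearEquiv.conj_apply] using this) (f X)
  rw [← LinearMap.trace_conj' _ f, ← h]
  congr 1
  refine LinearMap.ext fun y => ?_
  simp [LinearEquiv.conj_apply, adaptedCross]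

/-- The metric conjugates D to minus its transpose, so tr D = -tr D. -/
theorem trace_eq_zero_of_skew [FiniteDimensional ℝ V] {g : LinearMap.BilinForm ℝ V}
    (hg : g.Nondegenerate) {D : V →ₗ[ℝ] V} (hs : ∀ X Y, g (D X) Y + g X (D Y) = 0) :
    LinearMap.trace ℝ V D = 0 := by
  have h : (g.toDual hg).conj D = -Module.Dual.transpose (R := ℝ) D := by
    refine LinearMap.ext fun α => LinearMap.ext fun Y => ?_
    obtain ⟨X, rfl⟩ := (g.toDual hg).surjective α
    have := hs X Y
    simp only [LinearEquiv.conj_apply, LinearMap.comp_apply, LinearEquiv.coe_coe,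
      LinearEquiv.symm_apply_apply, LinearMap.neg_apply, Module.Dual.transpose_apply,
      LinearMap.BilinForm.toDual_def]
    linarith
  have h1 := congrArg (LinearMap.trace ℝ _) h
  have h2 := LinearMap.trace_transpose' D
  rw [LinearMap.trace_conj', ← neg_one_smul ℝ (Module.Dual.transpose (R := ℝ) D),
    LinearMap.map_smul] at h1
  simp only [smul_eq_mul] at h1
  linarith

end Structure
-- Vanishing of ∇ along the ideal, flatness, and the operators on 𝔲.
section Forward

variable {𝔤 : Type*} [LieRing 𝔤] [LieAlgebra ℝ 𝔤]

theorem lie_eq_zero_of_mem {𝔲 : LieIdeal ℝ 𝔤} (hab : IsLieAbelian 𝔲) {x y : 𝔤} (hx : x ∈ 𝔲)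
    (hy : y ∈ 𝔲) : ⁅x, y⁆ = 0 :=
  congrArg Subtype.val (hab.trivial (⟨x, hx⟩ : 𝔲) ⟨y, hy⟩)

theorem annihilates_of_covDeriv {D : 𝔤 →ₗ[ℝ] 𝔤 →ₗ[ℝ] 𝔤} {φ : 𝔤 [⋀^Fin 3]→ₗ[ℝ] ℝ} {X : 𝔤}
    (h : ∀ Y, covDeriv D φ X Y = 0) : Annihilates (D X) φ := by
  intro a b c
  have := h ![a, b, c]
  simp only [covDeriv, Fin.sum_univ_three, update_zero, update_one, update_two,
    neg_eq_zero] at this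
  exact this

variable [FiniteDimensional ℝ 𝔤]

theorem exists_sub_smul_mem (hdim : Module.finrank ℝ 𝔤 = 7) {𝔲 : LieIdeal ℝ 𝔤}
    (hu : Module.finrank ℝ 𝔲 = 6) {n : 𝔤} (hn : n ∉ 𝔲) (X : 𝔤) : ∃ c : ℝ, X - c • n ∈ 𝔲 := by
  have h1 : Module.finrank ℝ (𝔤 ⧸ 𝔲.toSubmodule) = 1 := by
    have := Submodule.finrank_quotient_add_finrank 𝔲.toSubmodule
    have h : Module.finrank ℝ 𝔲.toSubmodule = 6 := hu
    omega
  have h2 : (Submodule.Quotient.mk n : 𝔤 ⧸ 𝔲.toSubmodule) ≠ 0 := by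
    rwa [ne_eq, Submodule.Quotient.mk_eq_zero]
  obtain ⟨c, hc⟩ := (finrank_eq_one_iff_of_nonzero' _ h2).1 h1 (Submodule.Quotient.mk X)
  refine ⟨c, ?_⟩
  rw [← Submodule.Quotient.mk_smul] at hc
  exact (Submodule.Quotient.eq _).1 hc.symm

/-- A vector transversal to `𝔲` and orthogonal to it is not null. -/
theorem exists_normal (hdim : Module.finrank ℝ 𝔤 = 7) {𝔲 : LieIdeal ℝ 𝔤}
    (hu : Module.finrank ℝ 𝔲 = 6) {f₇ : 𝔤} (hf₇ : f₇ ∉ 𝔲) {g : LinearMap.BilinForm ℝ 𝔤}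
    (hg : g.Nondegenerate)
    (hgu : (g.restrict 𝔲.toSubmodule).Nondegenerate) :
    ∃ n, f₇ - n ∈ 𝔲 ∧ n ∉ 𝔲 ∧ (∀ u ∈ 𝔲, g n u = 0) ∧ g n n ≠ 0 := by
  -- u₀ is the orthogonal projection of f₇ to 𝔲.
  obtain ⟨u₀, hu₀⟩ := ((g.restrict 𝔲.toSubmodule).toDual hgu).surjective
    (g f₇ ∘ₗ 𝔲.toSubmodule.subtype)
  have hu₀' : ∀ u ∈ 𝔲, g u₀ u = g f₇ u := fun u hu => LinearMap.congr_fun hu₀ ⟨u, hu⟩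
  have hn : f₇ - u₀ ∉ 𝔲 := fun h => hf₇ (by simpa using add_mem h u₀.2)
  have ho : ∀ u ∈ 𝔲, g (f₇ - u₀) u = 0 := fun u hu => by
    rw [map_sub, LinearMap.sub_apply, hu₀' u hu, sub_self]
  refine ⟨f₇ - u₀, by simp, hn, ho, fun h0 => hn ?_⟩
  -- A null normal vector would be orthogonal to 𝔲 and to itself, hence to everything.
  have : f₇ - (u₀ : 𝔤) = 0 := hg.1 _ fun X => by
    obtain ⟨c, hc⟩ := exists_sub_smul_mem hdim hu hn X
    have := ho _ hc
    rw [map_sub, map_smul, h0] at this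
    simpa using this
  rw [this]
  exact zero_mem _

variable {ε : ℤˣ} {φ : 𝔤 [⋀^Fin 3]→ₗ[ℝ] ℝ} {𝔲 : LieIdeal ℝ 𝔤} {n : 𝔤}

/-- The Levi-Civita connection of a parallel structure vanishes in the directions of `𝔲`. -/
theorem leviCivita_eq_zero_of_mem (hdim : Module.finrank ℝ 𝔤 = 7) (hab : IsLieAbelian 𝔲)
    (hu : Module.finrank ℝ 𝔲 = 6) (hφ : IsParallelG2Structure ε φ) (hn : n ∉ 𝔲)
    (ho : ∀ u ∈ 𝔲, inducedMetric ε φ n u = 0) (hnn : inducedMetric ε φ n n ≠ 0)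
    {u : 𝔤} (huu : u ∈ 𝔲) : leviCivita (inducedMetric ε φ) u = 0 := by
  obtain ⟨hG, hP⟩ := hφ
  obtain ⟨hs, hg⟩ := inducedMetric_symm_nondegenerate hG
  obtain ⟨f, hf⟩ := hG
  set g := inducedMetric ε φ
  obtain ⟨-, hm⟩ := (eq_leviCivita_iff hg hs _).1 rfl
  set w := leviCivita g u n with hw
  have hwn : g w n = 0 := by
    have := hm u n n
    rw [hs n] at this
    linarith
  -- All brackets in the Koszul formula are zero because 𝔲 is Abelian.
  have huv : ∀ v ∈ 𝔲, ∀ z ∈ 𝔲, g (leviCivita g u v) z = 0 := fun v hv z hz => by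
    rw [apply_leviCivita hg, lie_eq_zero_of_mem hab huu hv, lie_eq_zero_of_mem hab hv hz,
      lie_eq_zero_of_mem hab hz huu]
    simp
  -- A skew map whose 𝔲-𝔲 component vanishes is determined by its value w on n.
  have hD : leviCivita g u = (g n n)⁻¹ • ((g n).smulRight w - (g w).smulRight n) := by
    have hgD : ∀ X Z, g n n * g (leviCivita g u X) Z = g n X * g w Z - g w X * g n Z := by
      intro X Z
      obtain ⟨a, ha⟩ := exists_sub_smul_mem hdim hu hn X
      obtain ⟨b, hb⟩ := exists_sub_smul_mem hdim hu hn Z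
      obtain ⟨x, rfl⟩ : ∃ x, X = a • n + x := ⟨X - a • n, by abel⟩
      obtain ⟨z, rfl⟩ : ∃ z, Z = b • n + z := ⟨Z - b • n, by abel⟩
      rw [add_sub_cancel_left] at ha hb
      have h1 := huv x ha z hb
      have h2 := hm u x n
      rw [← hw, hs x w] at h2
      have h3 := ho x ha
      have h4 := ho z hb
      simp only [map_add, map_smul, LinearMap.add_apply, LinearMap.smul_apply, smul_eq_mul, ← hw,
        hwn, h1, h3, h4]
      linear_combination g n n * b * h2
    refine LinearMap.ext fun X => (g.toDual hg).injective (LinearMap.ext fun Z => ?_)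
    simp only [LinearMap.BilinForm.toDual_def, LinearMap.smul_apply, LinearMap.sub_apply,
      LinearMap.smulRight_apply, map_smul, map_sub, smul_eq_mul]
    rw [← hgD X Z]
    field_simp
  -- The trace of (α ⊗ y) ∘ (x × ·) is α(x × y). For the rank-two expression `hD`, trace
  -- orthogonality therefore reads g(n, x × w) = g(w, x × n), and both sides are φ-values of
  -- opposite sign.
  have hφw : ∀ x, φ ![x, n, w] = 0 := by
    intro x
    have ht := trace_comp_adaptedCross hf (hm u · ·) (annihilates_of_covDeriv (hP u)) x
    rw [hD, LinearMap.smul_comp, map_smul, smul_eq_zero_iff_right (inv_ne_zero hnn),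
      LinearMap.sub_comp, map_sub] at ht
    have hc : ∀ (α : Module.Dual ℝ 𝔤) (y : 𝔤), LinearMap.trace ℝ 𝔤
        (α.smulRight y ∘ₗ adaptedCross ε f x) = α (adaptedCross ε f x y) := fun α y =>
      LinearMap.trace_smulRight (α ∘ₗ adaptedCross ε f x) y
    rw [hc, hc, hs n, hs w, inducedMetric_adaptedCross hf, inducedMetric_adaptedCross hf] at ht
    have hsw := (form_swap φ x n w).1
    linarith
  have hcross : adaptedCross ε f n w = 0 := hg.1 _ fun x => by
    rw [inducedMetric_adaptedCross hf]
    have h1 := (form_swap φ n w x).1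
    have h2 := (form_swap φ x n w).2
    rw [hφw] at h2
    linarith
  -- With n × w = 0 and w orthogonal to n, the double cross product formula reduces to g(n,n) w = 0.
  have hcc := adaptedCross_adaptedCross hf n w
  rw [hcross, map_zero, hs n w, hwn, zero_smul, add_zero, eq_comm, smul_eq_zero] at hcc
  have hw0 : w = 0 := hcc.resolve_left (neg_ne_zero.2 hnn)
  rw [hD, hw0]
  simp

/-- On 𝔲 this is torsion-freeness together with ∇_u n = 0. Moreover ∇_n n = 0: it is orthogonal to n
by metricity, and to 𝔲 by the Koszul formula, since [n, 𝔲] lies in 𝔲 and is orthogonal to n. -/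
theorem leviCivita_normal (hdim : Module.finrank ℝ 𝔤 = 7)
    (hu : Module.finrank ℝ 𝔲 = 6) (hn : n ∉ 𝔲) {g : LinearMap.BilinForm ℝ 𝔤}
    (hs : ∀ X Y, g X Y = g Y X) (hg : g.Nondegenerate)
    (ho : ∀ u ∈ 𝔲, g n u = 0) (h0 : ∀ u ∈ 𝔲, leviCivita g u = 0) :
    leviCivita g n = LieAlgebra.ad ℝ 𝔤 n := by
  obtain ⟨ht, hm⟩ := (eq_leviCivita_iff hg hs _).1 rfl
  have hnn : leviCivita g n n = 0 := hg.1 _ fun Z => by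
    obtain ⟨c, hc⟩ := exists_sub_smul_mem hdim hu hn Z
    have h1 : g (leviCivita g n n) (Z - c • n) = 0 := by
      have h2 : ⁅Z - c • n, n⁆ ∈ 𝔲 := lie_mem_left ℝ 𝔤 𝔲 _ _ hc
      have h3 : ⁅n, Z - c • n⁆ ∈ 𝔲 := lie_mem_right ℝ 𝔤 𝔲 _ _ hc
      rw [apply_leviCivita hg, hs _ n, ho _ h3, hs _ n, ho _ h2]
      simp
    have h2 := hm n n n
    rw [hs n] at h2
    rw [map_sub, map_smul, smul_eq_mul] at h1
    linear_combination h1 + c / 2 * h2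
  refine LinearMap.ext fun X => ?_
  obtain ⟨c, hc⟩ := exists_sub_smul_mem hdim hu hn X
  obtain ⟨x, rfl⟩ : ∃ x, X = c • n + x := ⟨X - c • n, by abel⟩
  rw [add_sub_cancel_left] at hc
  have := ht n x
  rw [h0 x hc] at this
  simpa [hnn] using this

/-- The operators ∇_X are all multiples of ∇_n, hence commute, and [X, Y] lies in 𝔲 because 𝔤/𝔲 is
one-dimensional. -/
theorem isFlat_of_leviCivita (hdim : Module.finrank ℝ 𝔤 = 7)
    (hu : Module.finrank ℝ 𝔲 = 6) (hn : n ∉ 𝔲) {g : LinearMap.BilinForm ℝ 𝔤}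
    (h0 : ∀ u ∈ 𝔲, leviCivita g u = 0) : IsFlat g := by
  intro X Y Z
  obtain ⟨a, ha⟩ := exists_sub_smul_mem hdim hu hn X
  obtain ⟨b, hb⟩ := exists_sub_smul_mem hdim hu hn Y
  obtain ⟨x, rfl⟩ : ∃ x, X = a • n + x := ⟨X - a • n, by abel⟩
  obtain ⟨y, rfl⟩ : ∃ y, Y = b • n + y := ⟨Y - b • n, by abel⟩
  rw [add_sub_cancel_left] at ha hb
  have h1 : ⁅a • n + x, b • n + y⁆ ∈ 𝔲 := by
    have : ⁅a • n + x, b • n + y⁆ = ⁅x, b • n + y⁆ + ⁅a • n, y⁆ := by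
      simp only [lie_add, add_lie, smul_lie, lie_smul, lie_self, smul_zero, zero_add]
      abel
    rw [this]
    exact add_mem (lie_mem_left ℝ 𝔤 𝔲 _ _ ha) (lie_mem_right ℝ 𝔤 𝔲 _ _ hb)
  rw [curvature, h0 _ h1]
  simp only [map_add, map_smul, h0 x ha, h0 y hb, LinearMap.add_apply, LinearMap.smul_apply]
  simp [smul_comm a b]

/-- A parallel structure with non-degenerate `𝔲` is flat. -/
theorem IsParallelG2Structure.isFlat (hdim : Module.finrank ℝ 𝔤 = 7) (hab : IsLieAbelian 𝔲)
    (hu : Module.finrank ℝ 𝔲 = 6) {f₇ : 𝔤} (hf₇ : f₇ ∉ 𝔲) (hφ : IsParallelG2Structure ε φ)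
    (hgu : ((inducedMetric ε φ).restrict 𝔲.toSubmodule).Nondegenerate) :
    IsFlat (inducedMetric ε φ) := by
  obtain ⟨hs, hg⟩ := inducedMetric_symm_nondegenerate hφ.1
  obtain ⟨n, -, hn, ho, hnn⟩ := exists_normal hdim hu hf₇ hg hgu
  exact isFlat_of_leviCivita hdim hu hn fun u huu =>
    leviCivita_eq_zero_of_mem hdim hab hu hφ hn ho hnn huu

/-- The adjoint action of a transversal vector on `𝔲` and the operator `J` induced by the cross
product with a normal vector of square `κ`. -/
theorem IsParallelG2Structure.exists_operator (hdim : Module.finrank ℝ 𝔤 = 7)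
    (hab : IsLieAbelian 𝔲) (hu : Module.finrank ℝ 𝔲 = 6) {f₇ : 𝔤}
    (hφ : IsParallelG2Structure ε φ) (hfn : f₇ - n ∈ 𝔲) (hn : n ∉ 𝔲)
    (ho : ∀ u ∈ 𝔲, inducedMetric ε φ n u = 0) (hnn : inducedMetric ε φ n n ≠ 0) :
    ∃ J : 𝔲 →ₗ[ℝ] 𝔲, J * J = -inducedMetric ε φ n n • (1 : Module.End ℝ 𝔲) ∧
      (∀ u v : 𝔲, inducedMetric ε φ (J u) v + inducedMetric ε φ u (J v) = 0) ∧
      (∀ u v : 𝔲, inducedMetric ε φ (LieModule.toEnd ℝ 𝔤 𝔲 f₇ u) v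
        + inducedMetric ε φ u (LieModule.toEnd ℝ 𝔤 𝔲 f₇ v) = 0) ∧
      LieModule.toEnd ℝ 𝔤 𝔲 f₇ * J = J * LieModule.toEnd ℝ 𝔤 𝔲 f₇ ∧
      LinearMap.trace ℝ 𝔲 (LieModule.toEnd ℝ 𝔤 𝔲 f₇ * J) = 0 ∧
      LinearMap.trace ℝ 𝔲 (LieModule.toEnd ℝ 𝔤 𝔲 f₇) = 0 := by
  have h0 : ∀ u ∈ 𝔲, leviCivita (inducedMetric ε φ) u = 0 := fun u huu =>
    leviCivita_eq_zero_of_mem hdim hab hu hφ hn ho hnn huu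
  obtain ⟨hG, hP⟩ := hφ
  obtain ⟨hs, hg⟩ := inducedMetric_symm_nondegenerate hG
  obtain ⟨f, hf⟩ := hG
  set g := inducedMetric ε φ
  have had := leviCivita_normal hdim hu hn hs hg ho h0
  obtain ⟨-, hm⟩ := (eq_leviCivita_iff hg hs _).1 rfl
  have hsk : ∀ X Y, g ⁅n, X⁆ Y + g X ⁅n, Y⁆ = 0 := fun X Y => by
    simpa [had] using hm n X Y
  have hA : Annihilates (LieAlgebra.ad ℝ 𝔤 n) φ := had ▸ annihilates_of_covDeriv (hP n)
  -- f₇ and n differ by an element of 𝔲, which acts trivially on the Abelian ideal.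
  have hB : ∀ u : 𝔲, ((LieModule.toEnd ℝ 𝔤 𝔲 f₇ u : 𝔲) : 𝔤) = ⁅n, (u : 𝔤)⁆ := fun u => by
    have h1 := lie_eq_zero_of_mem hab hfn u.2
    rw [sub_lie, sub_eq_zero] at h1
    simpa using h1
  -- n × X is orthogonal to n, so its n-component vanishes.
  have hmem : ∀ X, adaptedCross ε f n X ∈ 𝔲 := by
    intro X
    obtain ⟨c, hc⟩ := exists_sub_smul_mem hdim hu hn (adaptedCross ε f n X)
    have h1 : g n (adaptedCross ε f n X - c • n) = 0 := ho _ hc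
    have h2 : g (adaptedCross ε f n X) n = 0 := by
      rw [inducedMetric_adaptedCross hf]
      exact φ.map_eq_zero_of_eq _ (i := 0) (j := 2) rfl (by decide)
    rw [map_sub, hs n, h2, map_smul, smul_eq_mul, zero_sub, neg_eq_zero, mul_eq_zero] at h1
    rw [h1.resolve_right hnn, zero_smul, sub_zero] at hc
    exact hc
  -- The derivation ad n is skew, annihilates φ and kills n, so it commutes with n × · .
  have hcomm : ∀ X, ⁅n, adaptedCross ε f n X⁆ = adaptedCross ε f n ⁅n, X⁆ := by
    intro X
    refine sub_eq_zero.1 (hg.1 _ fun Y => ?_)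
    have h1 := hA n X Y
    have h2 := hsk (adaptedCross ε f n X) Y
    simp only [LieAlgebra.ad_apply, lie_self] at h1
    have h3 : φ ![0, X, Y] = 0 := φ.map_coord_zero (i := 0) rfl
    rw [map_sub, LinearMap.sub_apply, inducedMetric_adaptedCross hf]
    rw [inducedMetric_adaptedCross hf] at h2
    linarith
  refine ⟨(adaptedCross ε f n).restrict (p := 𝔲.toSubmodule) fun X _ => hmem X, ?_, ?_, ?_, ?_, ?_, ?_⟩
  · refine LinearMap.ext fun u => Subtype.ext ?_
    have := adaptedCross_adaptedCross hf n (u : 𝔤)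
    rw [ho u u.2, zero_smul, add_zero] at this
    exact this
  · intro u v
    change g (adaptedCross ε f n u) v + g u (adaptedCross ε f n v) = 0
    rw [hs u, inducedMetric_adaptedCross hf, inducedMetric_adaptedCross hf]
    rw [(form_swap φ n _ _).1, neg_add_cancel]
  · intro u v
    rw [hB, hB, hsk]
  · refine LinearMap.ext fun u => Subtype.ext ?_
    simp only [Module.End.mul_apply, hB]
    exact (hcomm u).trans (congrArg (adaptedCross ε f n) (hB u).symm)
  -- Since n × · maps into 𝔲, the trace of ad n ∘ (n × ·) can be computed on 𝔲.
  · rw [← trace_comp_adaptedCross hf (hsk · ·) hA n]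
    rw [← LinearMap.trace_restrict_eq_of_forall_mem 𝔲.toSubmodule
      (LieAlgebra.ad ℝ 𝔤 n ∘ₗ adaptedCross ε f n) fun X => lie_mem_right ℝ 𝔤 𝔲 _ _ (hmem X)]
    congr 1
    refine LinearMap.ext fun u => Subtype.ext ?_
    simp only [Module.End.mul_apply, hB]
    rfl
  · rw [← trace_eq_zero_of_skew hg (D := LieAlgebra.ad ℝ 𝔤 n) (hsk · ·)]
    rw [← LinearMap.trace_restrict_eq_of_forall_mem 𝔲.toSubmodule
      (LieAlgebra.ad ℝ 𝔤 n) fun X => ?_]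
    · congr 1
      refine LinearMap.ext fun u => Subtype.ext ?_
      rw [hB]
      rfl
    · obtain ⟨c, hc⟩ := exists_sub_smul_mem hdim hu hn X
      have := lie_mem_right ℝ 𝔤 𝔲 n _ hc
      simpa using this

end Forward
-- Jordan normal form in dimension three.
section Jordan

open Module

variable {K V : Type*} [Field K] [AddCommGroup V] [Module K V]

theorem linearIndependent_triangular {a b c : V} (h : LinearIndependent K ![a, b, c])
    {r s : K} (hr : r ≠ 0) (hs : s ≠ 0) (l m n : K) :
    LinearIndependent K ![r • a, s • b + l • a, c + m • b + n • a] := by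
  rw [Fintype.linearIndependent_iff] at h ⊢
  intro g hg
  have h' := h ![r * g 0 + l * g 1 + n * g 2, s * g 1 + m * g 2, g 2] (by
    rw [← hg]
    simp only [Fin.sum_univ_three, Matrix.cons_val]
    module)
  have h2 : g 2 = 0 := h' 2
  have h1 : s * g 1 + m * g 2 = 0 := h' 1
  have h0 : r * g 0 + l * g 1 + n * g 2 = 0 := h' 0
  rw [h2, mul_zero, add_zero, mul_eq_zero] at h1
  rw [h2, h1.resolve_left hs, mul_zero, mul_zero, add_zero, add_zero, mul_eq_zero] at h0
  intro i
  fin_cases i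
  exacts [h0.resolve_left hr, h1.resolve_left hs, h2]

theorem exists_basis_of_linearIndependent (hV : finrank K V = 3) {a b c : V}
    (h : LinearIndependent K ![a, b, c]) :
    ∃ β : Basis (Fin 3) K V, β 0 = a ∧ β 1 = b ∧ β 2 = c := by
  have := FiniteDimensional.of_finrank_pos (K := K) (V := V) (by omega)
  refine ⟨basisOfLinearIndependentOfCardEqFinrank h (by simp [hV]), ?_, ?_, ?_⟩ <;>
    rw [coe_basisOfLinearIndependentOfCardEqFinrank] <;> rfl

theorem exists_basis_eigenvectors (hV : finrank K V = 3) {T : End K V}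
    (h : ⨆ μ, T.eigenspace μ = ⊤) :
    ∃ β : Basis (Fin 3) K V, ∃ x : Fin 3 → K, ∀ i, T (β i) = x i • β i := by
  have := FiniteDimensional.of_finrank_pos (K := K) (V := V) (by omega)
  have hs : ⊤ ≤ Submodule.span K {v : V | ∃ μ : K, T v = μ • v} := by
    rw [← h]
    exact iSup_le fun μ v hv => Submodule.subset_span ⟨μ, End.mem_eigenspace_iff.1 hv⟩
  let β := Basis.ofSpan hs
  have hβ : ∀ i, ∃ μ : K, T (β i) = μ • β i := fun i =>
    Basis.ofSpan_subset hs ⟨i, rfl⟩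
  have : Fintype _ := FiniteDimensional.fintypeBasisIndex β
  let e := Fintype.equivFinOfCardEq ((finrank_eq_card_basis β).symm.trans hV)
  choose x hx using hβ
  exact ⟨β.reindex e, x ∘ e.symm, fun i => by simp [hx]⟩

/-- Without Jordan chains of length two, (T - μ)w being an eigenvector or zero forces it to be zero;
by induction generalized eigenspaces are eigenspaces, and these span. -/
theorem exists_nilpotent_pair [IsAlgClosed K] [FiniteDimensional K V] {T : End K V}
    (h : ⨆ μ, T.eigenspace μ ≠ ⊤) :
    ∃ (x : K) (v w : V), v ≠ 0 ∧ T v = x • v ∧ T w = x • w + v := by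
  by_contra! hc
  refine h ((End.iSup_maxGenEigenspace_eq_top T).symm ▸ ?_)
  refine congrArg iSup (funext fun μ => ?_)
  refine le_antisymm End.eigenspace_le_maxGenEigenspace fun w hw => ?_
  obtain ⟨k, hk⟩ := (End.mem_maxGenEigenspace T μ w).1 hw
  rw [End.mem_eigenspace_iff]
  induction k generalizing w with
  | zero => simp_all
  | succ k ih =>
    rw [pow_succ, End.mul_apply] at hk
    have h1 := ih _ ((End.mem_maxGenEigenspace T μ _).2 ⟨k, hk⟩) hk
    by_contra hne
    exact hc μ _ w (fun h0 => hne (sub_eq_zero.1 (by simpa using h0))) h1 (by simp)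

/-- The Jordan normal form of an endomorphism of a three-dimensional space. -/
theorem exists_jordan_basis [IsAlgClosed K] (hV : finrank K V = 3) (T : End K V) :
    ∃ (β : Basis (Fin 3) K V) (x y z : K),
      (T (β 0) = x • β 0 ∧ T (β 1) = y • β 1 ∧ T (β 2) = z • β 2) ∨
      (T (β 0) = x • β 0 ∧ T (β 1) = x • β 1 + β 0 ∧ T (β 2) = z • β 2) ∨
      (T (β 0) = x • β 0 ∧ T (β 1) = x • β 1 + β 0 ∧ T (β 2) = x • β 2 + β 1) := by
  have := FiniteDimensional.of_finrank_pos (K := K) (V := V) (by omega)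
  by_cases hd : ⨆ μ, T.eigenspace μ = ⊤
  · obtain ⟨β, x, hx⟩ := exists_basis_eigenvectors hV hd
    exact ⟨β, x 0, x 1, x 2, Or.inl ⟨hx 0, hx 1, hx 2⟩⟩
  obtain ⟨x, v, w, hv, hTv, hTw⟩ := exists_nilpotent_pair hd
  obtain ⟨u, hu⟩ : ∃ u, u ∉ Submodule.span K {v, w} := by
    classical
    by_contra! hc
    have h1 : Submodule.span K ({v, w} : Set V) = ⊤ := eq_top_iff.2 fun u _ => hc u
    have h2 := finrank_span_le_card (R := K) ({v, w} : Set V)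
    rw [h1, finrank_top, hV] at h2
    have h3 : ({v, w} : Set V).toFinset.card ≤ 2 := by
      rw [Set.toFinset_insert, Set.toFinset_singleton]
      exact Finset.card_le_two
    omega
  have hli : LinearIndependent K ![v, w, u] := by
    rw [Fintype.linearIndependent_iff]
    intro g hg
    simp only [Fin.sum_univ_three, Matrix.cons_val] at hg
    have h2 : g 2 = 0 := by
      by_contra h2
      refine hu (Submodule.mem_span_pair.2 ⟨-(g 2)⁻¹ * g 0, -(g 2)⁻¹ * g 1, ?_⟩)
      calc _ = (-(g 2)⁻¹) • (g 0 • v + g 1 • w + g 2 • u) + ((g 2)⁻¹ * g 2) • u := by module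
        _ = u := by rw [hg, smul_zero, zero_add, inv_mul_cancel₀ h2, one_smul]
    rw [h2, zero_smul, add_zero] at hg
    have h1 : g 1 = 0 := by
      have := congrArg (fun y => T y - x • y) hg
      simp only [map_add, map_smul, hTv, hTw, map_zero, smul_zero, sub_zero] at this
      have h : g 1 • v = 0 := by rw [← this]; module
      exact (smul_eq_zero.1 h).resolve_right hv
    rw [h1, zero_smul, add_zero] at hg
    have h0 := (smul_eq_zero.1 hg).resolve_right hv
    intro i
    fin_cases i
    exacts [h0, h1, h2]
  obtain ⟨r, s, z, hTu⟩ : ∃ r s z : K, T u = r • v + s • w + z • u := by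
    obtain ⟨β, h0, h1, h2⟩ := exists_basis_of_linearIndependent hV hli
    refine ⟨β.repr (T u) 0, β.repr (T u) 1, β.repr (T u) 2, ?_⟩
    conv_lhs => rw [← β.sum_repr (T u), Fin.sum_univ_three, h0, h1, h2]
  -- The third vector u of the basis is corrected. If z = x and s = 0, then u - r w is an
  -- eigenvector; if z = x and s ≠ 0, then u tops a chain of length three, whose lower members are
  -- (T - x)u and (T - x)²u; if z ≠ x, then u can be corrected to an eigenvector for z.
  by_cases hz : z = x
  · subst hz
    by_cases hs : s = 0
    · subst hs
      have h := linearIndependent_triangular hli one_ne_zero one_ne_zero 0 (-r) 0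
      obtain ⟨β, h0, h1, h2⟩ := exists_basis_of_linearIndependent hV h
      refine ⟨β, z, z, z, Or.inr (Or.inl ?_)⟩
      rw [h0, h1, h2]
      simp only [map_add, map_smul, hTv, hTw, hTu]
      refine ⟨?_, ?_, ?_⟩ <;> module
    · have h := linearIndependent_triangular hli hs hs r 0 0
      obtain ⟨β, h0, h1, h2⟩ := exists_basis_of_linearIndependent hV h
      refine ⟨β, z, z, z, Or.inr (Or.inr ?_)⟩
      rw [h0, h1, h2]
      simp only [map_add, map_smul, hTv, hTw, hTu]
      refine ⟨?_, ?_, ?_⟩ <;> module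
  · have hz' : z - x ≠ 0 := sub_ne_zero.2 hz
    -- These are the coefficient equations for u + p w + q v to have eigenvalue z.
    obtain ⟨p, hp⟩ : ∃ p, s + p * x = z * p := ⟨s / (z - x), by field_simp; ring⟩
    obtain ⟨q, hq⟩ : ∃ q, r + p + q * x = z * q := ⟨(r + p) / (z - x), by field_simp; ring⟩
    have h := linearIndependent_triangular hli one_ne_zero one_ne_zero 0 p q
    obtain ⟨β, h0, h1, h2⟩ := exists_basis_of_linearIndependent hV h
    refine ⟨β, x, x, z, Or.inr (Or.inl ?_)⟩
    rw [h0, h1, h2]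
    simp only [map_add, map_smul, hTv, hTw, hTu, smul_add, smul_smul, ← hp, ← hq]
    refine ⟨?_, ?_, ?_⟩ <;> module

end Jordan
-- Normal forms of skew maps commuting with a complex structure.
section ComplexStructure

open Module

variable {U : Type*} [AddCommGroup U] [Module ℝ U]

/-- `β` is a real basis that comes from a complex basis with respect to the complex structure `J`,
in which the `J`-linear map `A` is upper bidiagonal with entries `p k - q k * J` on the diagonal
and `s`, `t` above it. -/
structure IsJordanFrame (J A : End ℝ U) (β : Basis (Fin 3 × Fin 2) ℝ U) (p q : Fin 3 → ℝ)
    (s t : ℝ) : Prop where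
  frame : ∀ k, β (k, 1) = J (β (k, 0))
  zero : A (β (0, 0)) = p 0 • β (0, 0) - q 0 • β (0, 1)
  one : A (β (1, 0)) = p 1 • β (1, 0) - q 1 • β (1, 1) + s • β (0, 0)
  two : A (β (2, 0)) = p 2 • β (2, 0) - q 2 • β (2, 1) + t • β (1, 0)

/-- Compare coefficients at the last non-zero coordinate of the eigenvector. -/
theorem eigenvalue_mem_of_bidiagonal {K V : Type*} [Field K] [AddCommGroup V] [Module K V]
    {T : End K V} {β : Basis (Fin 3) K V} {x y z s t μ : K} (h0 : T (β 0) = x • β 0)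
    (h1 : T (β 1) = y • β 1 + s • β 0) (h2 : T (β 2) = z • β 2 + t • β 1) {w : V} (hw : w ≠ 0)
    (hT : T w = μ • w) : μ = x ∨ μ = y ∨ μ = z := by
  have hsum := β.sum_repr w
  rw [Fin.sum_univ_three] at hsum
  set c := β.repr w
  have h := congrArg β.repr hT
  rw [← hsum] at h
  simp only [map_add, map_smul, h0, h1, h2, Basis.repr_self] at h
  have e0 := DFunLike.congr_fun h 0
  have e1 := DFunLike.congr_fun h 1
  have e2 := DFunLike.congr_fun h 2
  simp at e0 e1 e2
  by_cases c2 : c 2 = 0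
  · by_cases c1 : c 1 = 0
    · by_cases c0 : c 0 = 0
      · exact (hw (by rw [← hsum, c0, c1, c2]; simp)).elim
      · simp only [c1] at e0
        exact Or.inl (mul_left_cancel₀ c0 (by linear_combination -e0))
    · simp only [c2] at e1
      exact Or.inr (Or.inl (mul_left_cancel₀ c1 (by linear_combination -e1)))
  · exact Or.inr (Or.inr (mul_left_cancel₀ c2 (by linear_combination -e2)))

/-- J turns U into a complex 3-space on which A is complex linear, so the complex Jordan form
applies. An eigenvalue is recorded as p - iq, matching the sign convention of `M p q`. The last
clause serves to match eigenvalues found by symmetry arguments with diagonal entries. -/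
theorem exists_jordanFrame (hU : finrank ℝ U = 6) {J A : End ℝ U} (hJ : J * J = -1)
    (hA : A * J = J * A) :
    ∃ (β : Basis (Fin 3 × Fin 2) ℝ U) (p q : Fin 3 → ℝ) (s t : ℝ), IsJordanFrame J A β p q s t ∧
      ((s = 0 ∧ t = 0) ∨ (s = 1 ∧ t = 0 ∧ p 0 = p 1 ∧ q 0 = q 1) ∨
        (s = 1 ∧ t = 1 ∧ (p 0 = p 1 ∧ q 0 = q 1) ∧ p 0 = p 2 ∧ q 0 = q 2)) ∧
      ∀ (w : U) (a b : ℝ), w ≠ 0 → A w = a • w - b • J w → ∃ k, a = p k ∧ b = q k := by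
  let F : ℂ →ₐ[ℝ] End ℝ U := Complex.lift ⟨J, hJ⟩
  let _ : Module ℂ U := Module.compHom U F.toRingHom
  have hz : ∀ (z : ℂ) (u : U), z • u = z.re • u + z.im • J u := fun z u => by
    change F z u = _
    simp [F, Complex.lift_apply, Complex.liftAux_apply]
  have : IsScalarTower ℝ ℂ U := ⟨fun r z u => by simp [hz, smul_smul]⟩
  have hJA : ∀ u, A (J u) = J (A u) := fun u => LinearMap.congr_fun hA u
  let T : U →ₗ[ℂ] U := { A with map_smul' := fun z u => by simp [hz, hJA] }
  have hT : ∀ u, T u = A u := fun _ => rfl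
  have h3 : finrank ℂ U = 3 := by
    have := Module.finrank_mul_finrank ℝ ℂ U
    rw [Complex.finrank_real_complex, hU] at this
    omega
  have key : ∀ (b : Basis (Fin 3) ℂ U) (x : Fin 3 → ℂ) (s t : ℝ), T (b 0) = x 0 • b 0 →
      T (b 1) = x 1 • b 1 + s • b 0 → T (b 2) = x 2 • b 2 + t • b 1 →
      IsJordanFrame J A ((Complex.basisOneI.smulTower b).reindex (Equiv.prodComm _ _))
        (fun k => (x k).re) (fun k => -(x k).im) s t ∧
      ∀ (w : U) (a b : ℝ), w ≠ 0 → A w = a • w - b • J w →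
        ∃ k, a = (x k).re ∧ b = -(x k).im := by
    intro b x s t h0 h1 h2
    refine ⟨⟨fun k => ?_, ?_, ?_, ?_⟩, fun w c d hw hAw => ?_⟩
    · simp [hz]
    · simpa [hz, hT] using h0
    · simpa [hz, hT] using h1
    · simpa [hz, hT] using h2
    · have hs : ∀ (r : ℝ) (u : U), r • u = (r : ℂ) • u := fun r u => by simp [hz]
      rw [hs] at h1 h2
      have := eigenvalue_mem_of_bidiagonal (μ := ⟨c, -d⟩) h0 h1 h2 hw (by
        rw [hT, hAw, hz, sub_eq_add_neg, neg_smul])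
      rcases this with h | h | h
      · exact ⟨0, by simp [← h]⟩
      · exact ⟨1, by simp [← h]⟩
      · exact ⟨2, by simp [← h]⟩
  obtain ⟨b, x, y, z, h⟩ := exists_jordan_basis h3 T
  rcases h with ⟨h0, h1, h2⟩ | ⟨h0, h1, h2⟩ | ⟨h0, h1, h2⟩
  · obtain ⟨k1, k2⟩ := key b ![x, y, z] 0 0 h0 (by simpa using h1) (by simpa using h2)
    exact ⟨_, _, _, _, _, k1, by simp, k2⟩
  · obtain ⟨k1, k2⟩ := key b ![x, x, z] 1 0 h0 (by simpa using h1) (by simpa using h2)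
    exact ⟨_, _, _, _, _, k1, by simp, k2⟩
  · obtain ⟨k1, k2⟩ := key b ![x, x, x] 1 1 h0 (by simpa using h1) (by simpa using h2)
    exact ⟨_, _, _, _, _, k1, by simp, k2⟩

theorem toMatrix_eq_ofBlocks {β : Basis (Fin 3 × Fin 2) ℝ U} {A : End ℝ U}
    {X : Matrix (Fin 3) (Fin 3) (Matrix (Fin 2) (Fin 2) ℝ)}
    (h : ∀ j l, A (β (j, l)) = ∑ i, ∑ k, X i j k l • β (i, k)) :
    LinearMap.toMatrix (β.reindex finProdFinEquiv) (β.reindex finProdFinEquiv) A =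
      ofBlocks X := by
  ext i j
  obtain ⟨⟨i, k⟩, rfl⟩ := finProdFinEquiv.surjective i
  obtain ⟨⟨j, l⟩, rfl⟩ := finProdFinEquiv.surjective j
  have h' : A (β (j, l)) = ∑ x : Fin 3 × Fin 2, X x.1 j x.2 l • β x := by
    rw [h, Fintype.sum_prod_type]
  rw [LinearMap.toMatrix_apply, Basis.reindex_apply, Equiv.symm_apply_apply, h',
    Basis.repr_reindex_apply, Equiv.symm_apply_apply, Basis.repr_sum_self]
  simp [ofBlocks]

namespace IsJordanFrame

variable {J A : End ℝ U} {β : Basis (Fin 3 × Fin 2) ℝ U} {p q : Fin 3 → ℝ} {s t : ℝ}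

theorem apply_one (h : IsJordanFrame J A β p q s t) (hJ : J * J = -1) (hA : A * J = J * A) :
    (∀ k, J (β (k, 1)) = -β (k, 0)) ∧
    A (β (0, 1)) = q 0 • β (0, 0) + p 0 • β (0, 1) ∧
    A (β (1, 1)) = q 1 • β (1, 0) + p 1 • β (1, 1) + s • β (0, 1) ∧
    A (β (2, 1)) = q 2 • β (2, 0) + p 2 • β (2, 1) + t • β (1, 1) := by
  have hJA : ∀ u, A (J u) = J (A u) := fun u => LinearMap.congr_fun hA u
  have hJJ : ∀ k, J (β (k, 1)) = -β (k, 0) := fun k => by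
    rw [h.frame]
    exact LinearMap.congr_fun hJ _
  refine ⟨hJJ, ?_, ?_, ?_⟩
  · rw [h.frame, hJA, h.zero, map_sub, map_smul, map_smul, hJJ, ← h.frame]
    module
  · rw [h.frame, hJA, h.one, map_add, map_sub, map_smul, map_smul, map_smul, hJJ, ← h.frame,
      ← h.frame]
    module
  · rw [h.frame, hJA, h.two, map_add, map_sub, map_smul, map_smul, map_smul, hJJ, ← h.frame,
      ← h.frame]
    module

theorem toMatrix (h : IsJordanFrame J A β p q s t) (hJ : J * J = -1) (hA : A * J = J * A) :
    LinearMap.toMatrix (β.reindex finProdFinEquiv) (β.reindex finProdFinEquiv) A =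
      ofBlocks !![M (p 0) (q 0), s • 1, 0; 0, M (p 1) (q 1), t • 1; 0, 0, M (p 2) (q 2)] := by
  obtain ⟨-, h0, h1, h2⟩ := h.apply_one hJ hA
  refine toMatrix_eq_ofBlocks ?_
  have hM : ∀ a b : ℝ, M a b 0 0 = a ∧ M a b 0 1 = b ∧ M a b 1 0 = -b ∧ M a b 1 1 = a :=
    fun a b => ⟨rfl, rfl, rfl, rfl⟩
  generalize hX : !![M (p 0) (q 0), s • 1, 0; 0, M (p 1) (q 1), t • 1; 0, 0, M (p 2) (q 2)] = X
  have x0 : X 0 0 = M (p 0) (q 0) ∧ X 1 0 = 0 ∧ X 2 0 = 0 := by subst hX; exact ⟨rfl, rfl, rfl⟩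
  have x1 : X 0 1 = s • 1 ∧ X 1 1 = M (p 1) (q 1) ∧ X 2 1 = 0 := by
    subst hX; exact ⟨rfl, rfl, rfl⟩
  have x2 : X 0 2 = 0 ∧ X 1 2 = t • 1 ∧ X 2 2 = M (p 2) (q 2) := by
    subst hX; exact ⟨rfl, rfl, rfl⟩
  intro j l
  fin_cases j <;> fin_cases l <;>
    simp [Fin.sum_univ_three, x0, x1, x2, hM, h.zero, h.one, h.two, h0, h1, h2] <;> module

/-- A real trace is twice the real part of the complex one. Vanishing of tr A and tr AJ thus means
that the complex trace of A is zero. -/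
theorem trace_eq (h : IsJordanFrame J A β p q s t) (hJ : J * J = -1) (hA : A * J = J * A) :
    LinearMap.trace ℝ U A = 2 * (p 0 + p 1 + p 2) ∧
    LinearMap.trace ℝ U (A * J) = 2 * (q 0 + q 1 + q 2) := by
  obtain ⟨hJJ, h0, h1, h2⟩ := h.apply_one hJ hA
  constructor <;> rw [LinearMap.trace_eq_matrix_trace ℝ β, Matrix.trace] <;>
    simp [Fintype.sum_prod_type, Fin.sum_univ_three, LinearMap.toMatrix_apply, ← h.frame, hJJ,
      h.zero, h.one, h.two, h0, h1, h2] <;> ring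

theorem reindex (h : IsJordanFrame J A β p q 0 0) (σ : Equiv.Perm (Fin 3)) :
    IsJordanFrame J A (β.reindex (σ.symm.prodCongr (Equiv.refl _))) (p ∘ σ) (q ∘ σ) 0 0 := by
  have : ∀ k, A (β (k, 0)) = p k • β (k, 0) - q k • β (k, 1) := fun k => by
    have h1 := h.one
    have h2 := h.two
    rw [zero_smul, add_zero] at h1 h2
    fin_cases k
    exacts [h.zero, h1, h2]
  constructor <;> simp [this, h.frame]

end IsJordanFrame

variable {g : LinearMap.BilinForm ℝ U} {J A : End ℝ U}

/-- A is skew-Hermitian, so with λ = a - ib also -conj λ = -a - ib is an eigenvalue. Otherwise A + a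
+ bJ would be invertible; but by skewness of A and J its range is orthogonal to w. -/
theorem exists_opposite_eigenvector [FiniteDimensional ℝ U] (hg : g.Nondegenerate)
    (hgJ : ∀ u v, g (J u) v + g u (J v) = 0) (hgA : ∀ u v, g (A u) v + g u (A v) = 0) {w : U}
    (hw : w ≠ 0) {a b : ℝ} (hAw : A w = a • w - b • J w) :
    ∃ w', w' ≠ 0 ∧ A w' = (-a) • w' - b • J w' := by
  by_contra! hc
  have hinj : Function.Injective (A + a • (1 : End ℝ U) + b • J) := by
    refine (injective_iff_map_eq_zero _).2 fun y hy => ?_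
    by_contra hy0
    refine hc y hy0 (sub_eq_zero.1 ?_)
    rw [← hy]
    simp only [LinearMap.add_apply, LinearMap.smul_apply, Module.End.one_apply]
    module
  have hsurj := LinearMap.injective_iff_surjective.1 hinj
  refine hw (hg.1 _ fun z => ?_)
  obtain ⟨y, rfl⟩ := hsurj z
  have h1 := hgA w y
  have h2 := hgJ w y
  rw [hAw] at h1
  simp only [LinearMap.add_apply, LinearMap.smul_apply, Module.End.one_apply, map_add, map_smul,
    map_sub, LinearMap.sub_apply, smul_eq_mul] at h1 ⊢
  linear_combination h1 + b * h2

/-- Real normal forms of the infinitesimal special unitary maps of a Hermitian form on a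
three-dimensional complex space. -/
theorem exists_normalForm_of_skew (hU : finrank ℝ U = 6) (hJ : J * J = -1)
    (hA : A * J = J * A) (htA : LinearMap.trace ℝ U A = 0) (htAJ : LinearMap.trace ℝ U (A * J) = 0)
    (hg : g.Nondegenerate)
    (hgJ : ∀ u v, g (J u) v + g u (J v) = 0) (hgA : ∀ u v, g (A u) v + g u (A v) = 0) :
    ∃ v : Basis (Fin 6) ℝ U,
      (∃ a b : ℝ, a ≠ 0 ∧ LinearMap.toMatrix v v A =
          ofBlocks !![M a b, 0, 0; 0, M (-a) b, 0; 0, 0, M 0 (-2 * b)]) ∨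
        (∃ c d : ℝ, LinearMap.toMatrix v v A =
          ofBlocks !![M 0 c, 0, 0; 0, M 0 d, 0; 0, 0, M 0 (-(c + d))]) ∨
        (∃ e : ℝ, LinearMap.toMatrix v v A =
          ofBlocks !![M 0 e, 1, 0; 0, M 0 e, 0; 0, 0, M 0 (-2 * e)]) ∨
        LinearMap.toMatrix v v A = ofBlocks !![0, 1, 0; 0, 0, 1; 0, 0, 0] := by
  have := FiniteDimensional.of_finrank_pos (K := ℝ) (V := U) (by omega)
  obtain ⟨β, p, q, s, t, h, hst, hev⟩ := exists_jordanFrame hU hJ hA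
  obtain ⟨t1, t2⟩ := h.trace_eq hJ hA
  rw [htA] at t1
  rw [htAJ] at t2
  have hp : p 0 + p 1 + p 2 = 0 := by linarith
  have hq : q 0 + q 1 + q 2 = 0 := by linarith
  have hev0 : ∃ k, -p 0 = p k ∧ q 0 = q k := by
    obtain ⟨w, hw, hAw⟩ := exists_opposite_eigenvector hg hgJ hgA (β.ne_zero (0, 0))
      (h.zero.trans (by rw [h.frame]))
    exact hev w _ _ hw hAw
  have hM : M 0 0 = 0 := by ext i j; fin_cases i <;> fin_cases j <;> simp [M]
  rcases hst with ⟨rfl, rfl⟩ | ⟨rfl, rfl, hp1, hq1⟩ | ⟨rfl, rfl, ⟨hp1, hq1⟩, hp2, hq2⟩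
  · by_cases hp0 : ∃ k, p k ≠ 0
    · obtain ⟨k, hk⟩ := hp0
      obtain ⟨σ, hσ⟩ : ∃ σ : Equiv.Perm (Fin 3), σ 0 = k :=
        ⟨Equiv.swap 0 k, by simp⟩
      obtain ⟨w, hw, hAw⟩ := exists_opposite_eigenvector hg hgJ hgA
        ((β.reindex (σ.symm.prodCongr (Equiv.refl _))).ne_zero (0, 0))
        ((h.reindex σ).zero.trans (by rw [(h.reindex σ).frame]))
      obtain ⟨k', hk1, hk2⟩ := hev w _ _ hw hAw
      simp only [Function.comp_apply, hσ] at hk1 hk2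
      -- A non-imaginary eigenvalue differs from its partner under λ ↦ -conj λ; the third eigenvalue
      -- is then fixed by the trace.
      have hne : k ≠ k' := by
        rintro rfl
        exact hk (by linarith)
      have hperm : ∀ k k' : Fin 3, k ≠ k' → ∃ τ : Equiv.Perm (Fin 3), τ 0 = k ∧ τ 1 = k' := by
        decide
      obtain ⟨τ, rfl, rfl⟩ := hperm k k' hne
      have hm := (h.reindex τ).toMatrix hJ hA
      have s1 := Equiv.sum_comp τ p
      have s2 := Equiv.sum_comp τ q
      rw [Fin.sum_univ_three, Fin.sum_univ_three] at s1 s2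
      simp only [Function.comp_apply] at hm
      refine ⟨_, Or.inl ⟨p (τ 0), q (τ 0), hk, hm.trans ?_⟩⟩
      rw [← hk1, ← hk2, show p (τ 2) = 0 by linarith, show q (τ 2) = -2 * q (τ 0) by linarith]
      simp
    · push Not at hp0
      have hm := h.toMatrix hJ hA
      refine ⟨_, Or.inr (Or.inl ⟨q 0, q 1, hm.trans ?_⟩)⟩
      rw [hp0, hp0, hp0, show q 2 = -(q 0 + q 1) by linarith]
      simp
  -- The real parts are p₀, p₀, -2p₀, and -p₀ occurs among them.
  · have hp0 : p 0 = 0 := by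
      obtain ⟨k, hk, -⟩ := hev0
      fin_cases k <;> simp at hk <;> linarith
    have hm := h.toMatrix hJ hA
    refine ⟨_, Or.inr (Or.inr (Or.inl ⟨q 0, hm.trans ?_⟩))⟩
    rw [← hp1, ← hq1, show p 2 = 0 by linarith, hp0, show q 2 = -2 * q 0 by linarith]
    simp
  -- For a single block the zero trace makes the eigenvalue zero.
  · have hm := h.toMatrix hJ hA
    refine ⟨_, Or.inr (Or.inr (Or.inr (hm.trans ?_)))⟩
    rw [← hp1, ← hq1, ← hp2, ← hq2, show p 0 = 0 by linarith, show q 0 = 0 by linarith, hM]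
    simp

/-- Real normal form of an infinitesimal special unitary map of a definite Hermitian form. -/
theorem exists_normalForm_of_skew_of_posDef (hU : finrank ℝ U = 6) (hJ : J * J = -1)
    (hA : A * J = J * A) (htAJ : LinearMap.trace ℝ U (A * J) = 0)
    (hg : ∀ u, u ≠ 0 → 0 < g u u) (hs : ∀ u v, g u v = g v u)
    (hgJ : ∀ u v, g (J u) v + g u (J v) = 0) (hgA : ∀ u v, g (A u) v + g u (A v) = 0) :
    ∃ (a b : ℝ) (v : Basis (Fin 6) ℝ U), LinearMap.toMatrix v v A =
          ofBlocks !![M 0 a, 0, 0; 0, M 0 b, 0; 0, 0, M 0 (-a - b)] := by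
  obtain ⟨β, p, q, s, t, h, hst, -⟩ := exists_jordanFrame hU hJ hA
  have hq : q 0 + q 1 + q 2 = 0 := by linarith [(h.trace_eq hJ hA).2]
  have hJ0 : ∀ u, g u (J u) = 0 := fun u => by linarith [hgJ u u, hs (J u) u]
  have hA0 : ∀ u, g u (A u) = 0 := fun u => by linarith [hgA u u, hs (A u) u]
  -- Both Aw and Jw are orthogonal to w, so a g(w,w) = 0.
  have hre : ∀ (w : U) (a b : ℝ), w ≠ 0 → A w = a • w - b • J w → a = 0 := fun w a b hw hAw => by
    have := hA0 w
    rw [hAw, map_sub, map_smul, map_smul, hJ0, smul_zero, sub_zero, smul_eq_mul] at this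
    exact (mul_eq_zero.1 this).resolve_right (hg w hw).ne'
  have hp0 : p 0 = 0 := hre _ _ _ (β.ne_zero (0, 0)) (h.zero.trans (by rw [h.frame]))
  have hs0 : s = 0 ∧ t = 0 := by
    by_contra hst'
    have hs1 : s = 1 ∧ p 1 = p 0 ∧ q 1 = q 0 := by
      rcases hst with hh | hh | hh
      exacts [(hst' hh).elim, ⟨hh.1, hh.2.2.1.symm, hh.2.2.2.symm⟩,
        ⟨hh.1, hh.2.2.1.1.symm, hh.2.2.1.2.symm⟩]
    obtain ⟨rfl, hp1, hq1⟩ := hs1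
    have h0 := h.zero
    have h1 := h.one
    rw [hp0, zero_smul, zero_sub, h.frame] at h0
    rw [hp1, hp0, zero_smul, zero_sub, h.frame, one_smul, hq1] at h1
    -- A Jordan chain would have a null bottom vector: the eigenvalue terms in the skewness of A
    -- cancel by that of J.
    have e1 := hgA (β (0, 0)) (β (1, 0))
    have e2 := hgJ (β (0, 0)) (β (1, 0))
    rw [h0, h1] at e1
    simp only [map_add, map_neg, map_smul, LinearMap.neg_apply, LinearMap.smul_apply,
      smul_eq_mul] at e1
    exact (hg _ (β.ne_zero (0, 0))).ne' (by linear_combination e1 + q 0 * e2)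
  obtain ⟨rfl, rfl⟩ := hs0
  have h1 := h.one
  have h2 := h.two
  rw [zero_smul, add_zero, h.frame] at h1 h2
  have hp1 := hre _ _ _ (β.ne_zero (1, 0)) h1
  have hp2 := hre _ _ _ (β.ne_zero (2, 0)) h2
  refine ⟨q 0, q 1, _, (h.toMatrix hJ hA).trans ?_⟩
  rw [hp0, hp1, hp2, show q 2 = -q 0 - q 1 by linarith]
  simp

end ComplexStructure
-- Skew maps commuting with a paracomplex structure.
section ParacomplexStructure

open Module

variable {U : Type*} [AddCommGroup U] [Module ℝ U]

theorem toMatrix_eq_of_forall {R M ι : Type*} [CommRing R] [AddCommGroup M] [Module R M]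
    [Fintype ι] [DecidableEq ι] {v : Basis ι R M} {T : End R M} {X : Matrix ι ι R}
    (h : ∀ j, T (v j) = ∑ i, X i j • v i) : LinearMap.toMatrix v v T = X := by
  ext i j
  rw [LinearMap.toMatrix_apply, h, Basis.repr_sum_self]

variable {g : LinearMap.BilinForm ℝ U} {J A : End ℝ U}

/-- An infinitesimal isometry that commutes with a skew involution `J` acts on the eigenspaces of
`J` by a matrix and its negative transpose. -/
theorem exists_dual_frame (hU : finrank ℝ U = 6) (hJ : J * J = 1) (hA : A * J = J * A)
    (htAJ : LinearMap.trace ℝ U (A * J) = 0) (hg : g.Nondegenerate)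
    (hs : ∀ u v, g u v = g v u) (hgJ : ∀ u v, g (J u) v + g u (J v) = 0)
    (hgA : ∀ u v, g (A u) v + g u (A v) = 0) :
    ∃ (v : Basis (Fin 3 ⊕ Fin 3) ℝ U) (B : Matrix (Fin 3) (Fin 3) ℝ), B.trace = 0 ∧
      LinearMap.toMatrix v v A = Matrix.fromBlocks B 0 0 (-B.transpose) := by
  have := FiniteDimensional.of_finrank_pos (K := ℝ) (V := U) (by omega)
  have hJJ : ∀ u, J (J u) = u := fun u => LinearMap.congr_fun hJ u
  have hAJ : ∀ u, A (J u) = J (A u) := fun u => LinearMap.congr_fun hA u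
  let L := End.eigenspace J (1 : ℝ)
  let L' := End.eigenspace J (-1 : ℝ)
  have hL : ∀ u, u ∈ L ↔ J u = u := fun u => by
    rw [End.mem_eigenspace_iff, one_smul]
  have hL' : ∀ u, u ∈ L' ↔ J u = -u := fun u => by
    rw [End.mem_eigenspace_iff, neg_one_smul]
  have hAL : ∀ u ∈ L, A u ∈ L := fun u hu => by
    rw [hL] at hu ⊢
    rw [← hAJ, hu]
  have hAL' : ∀ u ∈ L', A u ∈ L' := fun u hu => by
    rw [hL'] at hu ⊢
    rw [← hAJ, hu, map_neg]
  have hiso : ∀ u ∈ L, ∀ v ∈ L, g u v = 0 := fun u hu v hv => by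
    have := hgJ u v
    rw [(hL u).1 hu, (hL v).1 hv] at this
    linarith
  have hiso' : ∀ u ∈ L', ∀ v ∈ L', g u v = 0 := fun u hu v hv => by
    have := hgJ u v
    rw [(hL' u).1 hu, (hL' v).1 hv, map_neg, map_neg, LinearMap.neg_apply] at this
    linarith
  have hsplit : ∀ u, ∃ x ∈ L, ∃ y ∈ L', u = x + y := fun u => by
    refine ⟨(1 / 2 : ℝ) • (u + J u), ?_, (1 / 2 : ℝ) • (u - J u), ?_, by module⟩
    · rw [hL, map_smul, map_add, hJJ, add_comm]
    · rw [hL', map_smul, map_sub, hJJ]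
      module
  have hcompl : IsCompl L L' := by
    refine ⟨Submodule.disjoint_def.2 fun u hu hu' => ?_, codisjoint_iff.2 (eq_top_iff.2
      fun u _ => ?_)⟩
    · have h := ((hL u).1 hu).symm.trans ((hL' u).1 hu')
      have h2 : (2 : ℝ) • u = 0 := by rw [two_smul, add_eq_zero_iff_eq_neg, ← h]
      exact (smul_eq_zero.1 h2).resolve_left two_ne_zero
    · obtain ⟨x, hx, y, hy, rfl⟩ := hsplit u
      exact Submodule.add_mem_sup hx hy
  have hz : ∀ u ∈ L, (∀ y ∈ L', g u y = 0) → u = 0 := fun u hu h => hg.1 _ fun w => by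
    obtain ⟨x, hx, y, hy, rfl⟩ := hsplit w
    rw [map_add, hiso u hu x hx, h y hy, add_zero]
  have hz' : ∀ u ∈ L', (∀ y ∈ L, g y u = 0) → u = 0 := fun u hu h => hg.1 _ fun w => by
    obtain ⟨x, hx, y, hy, rfl⟩ := hsplit w
    rw [map_add, hs u x, h x hx, hiso' u hu y hy, add_zero]
  let pair : L →ₗ[ℝ] Dual ℝ L' := g.domRestrict₁₂ L L'
  let pair' : L' →ₗ[ℝ] Dual ℝ L := (g.domRestrict₁₂ L L').flip
  have hinj : Function.Injective pair := (injective_iff_map_eq_zero _).2 fun u hu =>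
    Subtype.ext (hz u u.2 fun y hy => LinearMap.congr_fun hu ⟨y, hy⟩)
  have hinj' : Function.Injective pair' := (injective_iff_map_eq_zero _).2 fun u hu =>
    Subtype.ext (hz' u u.2 fun y hy => LinearMap.congr_fun hu ⟨y, hy⟩)
  have hd1 := LinearMap.finrank_le_finrank_of_injective hinj
  have hd2 := LinearMap.finrank_le_finrank_of_injective hinj'
  rw [Subspace.dual_finrank_eq] at hd1 hd2
  have hd3 := Submodule.finrank_add_eq_of_isCompl hcompl
  have hdL : finrank ℝ L = 3 := by omega
  have hdL' : finrank ℝ L' = finrank ℝ (Dual ℝ L) := by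
    rw [Subspace.dual_finrank_eq]
    omega
  let e : L' ≃ₗ[ℝ] Dual ℝ L := LinearEquiv.ofInjectiveOfFinrankEq pair' hinj' hdL'
  -- Both eigenspaces are null, so g pairs them perfectly and they have dimension three. Q is the
  -- basis of L' that is g-dual to P.
  let P : Basis (Fin 3) ℝ L := finBasisOfFinrankEq ℝ L hdL
  let Q : Basis (Fin 3) ℝ L' := P.dualBasis.map e.symm
  have hPQ : ∀ i j, g (P i) (Q j) = if i = j then 1 else 0 := fun i j => by
    have h1 : e (Q j) = P.dualBasis j := by simp [Q]
    have h2 : e (Q j) (P i) = g (P i) (Q j) := rfl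
    rw [← h2, h1, Basis.dualBasis_apply_self]
  let v : Basis (Fin 3 ⊕ Fin 3) ℝ U := (P.prod Q).map (Submodule.prodEquivOfIsCompl L L' hcompl)
  have hvP : ∀ i, v (Sum.inl i) = P i := fun i => by simp [v]
  have hvQ : ∀ i, v (Sum.inr i) = Q i := fun i => by simp [v]
  let B : Matrix (Fin 3) (Fin 3) ℝ := fun i j => P.repr (A.restrict hAL (P j)) i
  have hBP : ∀ j, A (P j) = ∑ i, B i j • (P i : U) := fun j => by
    have h := congrArg Subtype.val (P.sum_repr (A.restrict hAL (P j)))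
    rw [Submodule.coe_sum] at h
    exact h.symm
  -- Skewness of A determines A on L' by its pairing with L; in dual bases this is the negative
  -- transpose.
  have hBQ : ∀ j, A (Q j) = ∑ i, (-B.transpose) i j • (Q i : U) := fun j => by
    refine sub_eq_zero.1 (hz' _ (sub_mem (hAL' _ (Q j).2)
      (sum_mem fun i _ => L'.smul_mem _ (Q i).2)) ?_)
    intro y hy
    have hy' : y = ∑ k, P.repr ⟨y, hy⟩ k • (P k : U) := by
      have h := congrArg Subtype.val (P.sum_repr ⟨y, hy⟩)
      rw [Submodule.coe_sum] at h
      exact h.symm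
    rw [hy', map_sum, LinearMap.sum_apply]
    refine Finset.sum_eq_zero fun k _ => ?_
    have h := hgA (P k) (Q j)
    rw [hBP, map_sum, LinearMap.sum_apply] at h
    simp only [map_smul, LinearMap.smul_apply, hPQ, smul_eq_mul] at h
    simp only [map_smul, LinearMap.smul_apply, map_sub, map_sum, hPQ, smul_eq_mul,
      Matrix.neg_apply, Matrix.transpose_apply]
    simp at h ⊢
    linear_combination P.repr ⟨y, hy⟩ k * h
  have hmA : LinearMap.toMatrix v v A = Matrix.fromBlocks B 0 0 (-B.transpose) := by
    refine toMatrix_eq_of_forall ?_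
    rintro (j | j)
    · simp [hvP, hvQ, hBP, Fintype.sum_sum_type]
    · simp [hvP, hvQ, hBQ, Fintype.sum_sum_type]
  have hmJ : LinearMap.toMatrix v v J = Matrix.fromBlocks 1 0 0 (-1) := by
    refine toMatrix_eq_of_forall ?_
    rintro (j | j)
    · simp [hvP, hvQ, (hL _).1 (P j).2, Fintype.sum_sum_type, Matrix.one_apply]
    · simp [hvP, hvQ, (hL' _).1 (Q j).2, Fintype.sum_sum_type, Matrix.one_apply]
  refine ⟨v, B, ?_, hmA⟩
  -- As J is 1 on L and -1 on L', the trace of AJ is tr B + tr Bᵀ = 2 tr B.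
  rw [LinearMap.trace_eq_matrix_trace ℝ v, LinearMap.toMatrix_mul, hmA, hmJ,
    Matrix.fromBlocks_multiply] at htAJ
  simp [Matrix.trace, Fintype.sum_sum_type] at htAJ ⊢
  linarith

end ParacomplexStructure

/-! ### Jordan matrices, and similarity over ℂ and ℝ. -/

section JordanMatrices

open Module Matrix

theorem exists_isJordanFormOf (A : Matrix (Fin 3) (Fin 3) ℝ) : ∃ J, IsJordanFormOf J A := by
  let T : End ℂ (Fin 3 → ℂ) := Matrix.toLin' (A.map fun x : ℝ => (x : ℂ))
  obtain ⟨β, x, y, z, h⟩ := exists_jordan_basis (by simp) T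
  obtain ⟨J, hJ, hm⟩ : ∃ J : Matrix (Fin 3) (Fin 3) ℂ, IsJordan J ∧ LinearMap.toMatrix β β T = J := by
    rcases h with ⟨h0, h1, h2⟩ | ⟨h0, h1, h2⟩ | ⟨h0, h1, h2⟩
    · refine ⟨!![x, 0, 0; 0, y, 0; 0, 0, z], ⟨fun i j => ?_, fun i j => ?_⟩,
        toMatrix_eq_of_forall fun j => ?_⟩
      · fin_cases i <;> fin_cases j <;> simp
      · fin_cases i <;> fin_cases j <;> simp
      · fin_cases j <;> simp [Fin.sum_univ_three, h0, h1, h2]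
    · refine ⟨!![x, 1, 0; 0, x, 0; 0, 0, z], ⟨fun i j => ?_, fun i j => ?_⟩,
        toMatrix_eq_of_forall fun j => ?_⟩
      · fin_cases i <;> fin_cases j <;> simp
      · fin_cases i <;> fin_cases j <;> simp
      · fin_cases j <;> simp [Fin.sum_univ_three, h0, h1, h2, add_comm]
    · refine ⟨!![x, 1, 0; 0, x, 1; 0, 0, x], ⟨fun i j => ?_, fun i j => ?_⟩,
        toMatrix_eq_of_forall fun j => ?_⟩
      · fin_cases i <;> fin_cases j <;> simp
      · fin_cases i <;> fin_cases j <;> simp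
      · fin_cases j <;> simp [Fin.sum_univ_three, h0, h1, h2, add_comm]
  refine ⟨J, hJ, (Pi.basisFun ℂ (Fin 3)).toMatrix β, ?_, ?_⟩
  · exact @isUnit_of_invertible _ _ _ ((Pi.basisFun ℂ (Fin 3)).invertibleToMatrix β)
  · have hT : LinearMap.toMatrix (Pi.basisFun ℂ (Fin 3)) (Pi.basisFun ℂ (Fin 3)) T =
        A.map fun x : ℝ => (x : ℂ) := by
      rw [LinearMap.toMatrix_eq_toMatrix', LinearMap.toMatrix'_toLin']
    rw [← hm, ← hT, basis_toMatrix_mul_linearMap_toMatrix, linearMap_toMatrix_mul_basis_toMatrix]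

/-- Reversing the basis of each Jordan block transposes it; alternating signs restore the entries 1
above the diagonal after negation. The four cases are the block patterns of a 3 × 3 matrix. -/
theorem IsJordan.exists_transpose {J : Matrix (Fin 3) (Fin 3) ℂ} (hJ : IsJordan J) :
    ∃ R : Matrix (Fin 3) (Fin 3) ℂ, IsUnit R ∧ -J.transpose * R = R * negDiag J := by
  obtain ⟨h0, h1⟩ := hJ
  have e : J = !![J 0 0, J 0 1, 0; 0, J 1 1, J 1 2; 0, 0, J 2 2] := by
    have := h0 0 2 (by decide) (by decide)
    have := h0 1 0 (by decide) (by decide)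
    have := h0 2 0 (by decide) (by decide)
    have := h0 2 1 (by decide) (by decide)
    ext i j
    fin_cases i <;> fin_cases j <;> simp [*]
  have hn : negDiag J = !![-J 0 0, J 0 1, 0; 0, -J 1 1, J 1 2; 0, 0, -J 2 2] := by
    rw [e]
    ext i j
    fin_cases i <;> fin_cases j <;> simp [negDiag]
  rw [hn]
  have h01 := h1 0 1 rfl
  have h12 := h1 1 2 rfl
  generalize J 0 0 = a at *
  generalize J 0 1 = s at *
  generalize J 1 1 = b at *
  generalize J 1 2 = t at *
  generalize J 2 2 = c at *
  subst e
  rcases h01 with rfl | ⟨rfl, rfl⟩ <;> rcases h12 with rfl | ⟨rfl, rfl⟩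
  · refine ⟨1, isUnit_one, ?_⟩
    ext i j
    fin_cases i <;> fin_cases j <;> simp
  · refine ⟨!![1, 0, 0; 0, 0, -1; 0, 1, 0],
      (Matrix.isUnit_iff_isUnit_det _).2 (by simp [Matrix.det_fin_three]), ?_⟩
    ext i j
    fin_cases i <;> fin_cases j <;> simp [Matrix.mul_apply, Fin.sum_univ_three]
  · refine ⟨!![0, -1, 0; 1, 0, 0; 0, 0, 1],
      (Matrix.isUnit_iff_isUnit_det _).2 (by simp [Matrix.det_fin_three]), ?_⟩
    ext i j
    fin_cases i <;> fin_cases j <;> simp [Matrix.mul_apply, Fin.sum_univ_three]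
  · refine ⟨!![0, 0, 1; 0, -1, 0; 1, 0, 0],
      (Matrix.isUnit_iff_isUnit_det _).2 (by simp [Matrix.det_fin_three]), ?_⟩
    ext i j
    fin_cases i <;> fin_cases j <;> simp [Matrix.mul_apply, Fin.sum_univ_three]

theorem IsJordan.negDiag {n : ℕ} {J : Matrix (Fin n) (Fin n) ℂ} (hJ : IsJordan J) :
    IsJordan (negDiag J) := by
  refine ⟨fun i j h1 h2 => ?_, fun i j h => ?_⟩
  · simpa [ParallelG2.negDiag, Ne.symm h1] using hJ.1 i j h1 h2
  · have hne : i ≠ j := fun h' => by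
      rw [h'] at h
      omega
    simpa [ParallelG2.negDiag, hne] using hJ.2 i j h

theorem IsJordan.diagPair {J₁ J₂ : Matrix (Fin 3) (Fin 3) ℂ} (h₁ : IsJordan J₁)
    (h₂ : IsJordan J₂) : IsJordan (diagPair J₁ J₂) := by
  constructor
  · intro i j
    obtain ⟨i, rfl⟩ := (finSumFinEquiv (m := 3) (n := 3)).surjective i
    obtain ⟨j, rfl⟩ := (finSumFinEquiv (m := 3) (n := 3)).surjective j
    rcases i with i | i <;> rcases j with j | j <;> intro hij hij' <;>
      simp [ParallelG2.diagPair] at hij ⊢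
    · exact h₁.1 i j hij hij'
    · exact h₂.1 i j hij fun h => hij' (by change 3 + (j : ℕ) = 3 + i + 1; omega)
  · intro i j
    obtain ⟨i, rfl⟩ := (finSumFinEquiv (m := 3) (n := 3)).surjective i
    obtain ⟨j, rfl⟩ := (finSumFinEquiv (m := 3) (n := 3)).surjective j
    rcases i with i | i <;> rcases j with j | j <;> intro hij
    · simpa [ParallelG2.diagPair] using h₁.2 i j hij
    · simp [ParallelG2.diagPair]
    · simp [ParallelG2.diagPair]
    · have hij' : 3 + (j : ℕ) = 3 + i + 1 := hij
      simpa [ParallelG2.diagPair] using h₂.2 i j (by omega)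

/-- For a Jordan form `J` of `B`, the matrix `diag(B, -Bᵀ)` is similar to
`diag(J, negDiag J)`. -/
theorem IsJordanFormOf.exists_similar {B : Matrix (Fin 3) (Fin 3) ℝ} {J : Matrix (Fin 3) (Fin 3) ℂ}
    (h : IsJordanFormOf J B) : ∃ P : Matrix (Fin 3 ⊕ Fin 3) (Fin 3 ⊕ Fin 3) ℂ, IsUnit P ∧
      (fromBlocks B 0 0 (-B.transpose)).map (fun x : ℝ => (x : ℂ)) * P =
        P * fromBlocks J 0 0 (negDiag J) := by
  obtain ⟨hJ, P, hP, hBP⟩ := h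
  obtain ⟨R, hR, hJR⟩ := hJ.exists_transpose
  have hPt : IsUnit P.transpose := (Matrix.isUnit_transpose P).2 hP
  have hdet := (Matrix.isUnit_iff_isUnit_det _).1 hPt
  -- Transposing BP = PJ shows that the inverse transpose of P brings Bᵀ to Jᵀ; R then passes from
  -- -Jᵀ to `negDiag J`.
  have hQ : (-B.transpose).map (fun x : ℝ => (x : ℂ)) * (P.transpose⁻¹ * R) =
      (P.transpose⁻¹ * R) * negDiag J := by
    have h1 := congrArg Matrix.transpose hBP
    rw [transpose_mul, transpose_mul, ← transpose_map] at h1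
    have h2 : (-B.transpose).map (fun x : ℝ => (x : ℂ)) =
        -(B.transpose.map fun x : ℝ => (x : ℂ)) := by ext; simp
    have h3 : P.transpose⁻¹ * J.transpose = B.transpose.map (fun x : ℝ => (x : ℂ)) * P.transpose⁻¹ := by
      calc _ = P.transpose⁻¹ * (J.transpose * P.transpose) * P.transpose⁻¹ := by
            rw [Matrix.mul_assoc, Matrix.mul_assoc, Matrix.mul_nonsing_inv _ hdet, Matrix.mul_one]
        _ = _ := by
            rw [← h1, ← Matrix.mul_assoc, Matrix.nonsing_inv_mul _ hdet, Matrix.one_mul]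
    rw [h2, Matrix.mul_assoc, ← hJR, Matrix.neg_mul, Matrix.neg_mul, Matrix.mul_neg,
      ← Matrix.mul_assoc, ← Matrix.mul_assoc, h3]
  refine ⟨fromBlocks P 0 0 (P.transpose⁻¹ * R), ?_, ?_⟩
  · rw [Matrix.isUnit_iff_isUnit_det, Matrix.det_fromBlocks_zero₂₁]
    exact ((Matrix.isUnit_iff_isUnit_det _).1 hP).mul ((Matrix.isUnit_iff_isUnit_det _).1
      ((Matrix.isUnit_nonsing_inv_iff.2 hPt).mul hR))
  · rw [fromBlocks_map, fromBlocks_multiply, fromBlocks_multiply, hBP, hQ]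
    simp [Matrix.map_zero, Complex.ofReal_zero]

/-- Real matrices that are similar over `ℂ` are similar over `ℝ`. -/
theorem exists_real_similar {n : Type*} [Fintype n] [DecidableEq n] {X Y : Matrix n n ℝ}
    {P : Matrix n n ℂ} (hP : IsUnit P)
    (h : X.map (fun x : ℝ => (x : ℂ)) * P = P * Y.map (fun x : ℝ => (x : ℂ))) :
    ∃ Q : Matrix n n ℝ, IsUnit Q ∧ X * Q = Q * Y := by
  let P₁ : Matrix n n ℝ := P.map Complex.re
  let P₂ : Matrix n n ℝ := P.map Complex.im
  have h1 : X * P₁ = P₁ * Y := by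
    ext i j
    have := congrArg Complex.re (congrFun (congrFun h i) j)
    simpa [Matrix.mul_apply, P₁] using this
  have h2 : X * P₂ = P₂ * Y := by
    ext i j
    have := congrArg Complex.im (congrFun (congrFun h i) j)
    simpa [Matrix.mul_apply, P₂] using this
  let c := algebraMap ℝ (Polynomial ℝ)
  -- The real and imaginary parts P₁, P₂ both intertwine X and Y, hence so does P₁ + tP₂. Its
  -- determinant is a polynomial in t that is non-zero at t = i, where it is det P, so it is
  -- non-zero at some real t.
  let p : Polynomial ℝ := (P₁.map c + (Polynomial.X : Polynomial ℝ) • P₂.map c).det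
  have hp : ∀ (S : Type) [CommRing S] [Algebra ℝ S] (s : S), p.aeval s =
      (P₁.map (algebraMap ℝ S) + s • P₂.map (algebraMap ℝ S)).det := fun S _ _ s => by
    rw [show p = _ from rfl, AlgHom.map_det]
    congr 1
    ext i j
    simp [c, mul_comm s]
  have hp0 : p ≠ 0 := by
    intro h0
    have h3 := hp ℂ Complex.I
    have h4 : P₁.map (algebraMap ℝ ℂ) + Complex.I • P₂.map (algebraMap ℝ ℂ) = P := by
      ext i j
      simp [P₁, P₂, mul_comm Complex.I, Complex.re_add_im]
    rw [h0, map_zero, h4] at h3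
    exact ((Matrix.isUnit_iff_isUnit_det _).1 hP).ne_zero h3.symm
  obtain ⟨t, ht⟩ := Polynomial.exists_eval_ne_zero_of_natDegree_lt_card p hp0
    ((Cardinal.natCast_lt_aleph0).trans_le (Cardinal.aleph0_le_mk ℝ))
  refine ⟨P₁ + t • P₂, (Matrix.isUnit_iff_isUnit_det _).2 (isUnit_iff_ne_zero.2 ?_), ?_⟩
  · have h5 := hp ℝ t
    rw [Polynomial.coe_aeval_eq_eval] at h5
    rw [h5] at ht
    simpa using ht
  · rw [Matrix.mul_add, Matrix.add_mul, h1, Matrix.mul_smul, Matrix.smul_mul, h2]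

theorem exists_basis_toMatrix_eq {R M ι : Type*} [CommRing R] [AddCommGroup M] [Module R M]
    [Fintype ι] [DecidableEq ι] (v : Basis ι R M) {T : End R M} {P C : Matrix ι ι R}
    (hP : IsUnit P) (h : LinearMap.toMatrix v v T * P = P * C) :
    ∃ w : Basis ι R M, LinearMap.toMatrix w w T = C := by
  have hdet := (Matrix.isUnit_iff_isUnit_det _).1 hP
  let e : M ≃ₗ[R] M := Matrix.toLinOfInv v v (Matrix.mul_nonsing_inv P hdet)
    (Matrix.nonsing_inv_mul P hdet)
  let w := v.map e
  have hw : v.toMatrix w = P := by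
    ext i j
    simp [w, e, Basis.toMatrix_apply, Matrix.toLin_self, Basis.repr_sum_self, -map_sum]
  refine ⟨w, ?_⟩
  rw [← basis_toMatrix_mul_linearMap_toMatrix_mul_basis_toMatrix w v w v, Matrix.mul_assoc, hw, h, ← hw,
    ← Matrix.mul_assoc, Basis.toMatrix_mul_toMatrix_flip, Matrix.one_mul]

end JordanMatrices
-- The signature of a hyperplane and its normal vector.
section Signature

open Module QuadraticMap

variable {V : Type*} [AddCommGroup V] [Module ℝ V]

theorem mem_radical_toQuadraticMap {B : LinearMap.BilinForm ℝ V} (hs : ∀ x y, B x y = B y x)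
    {x : V} : x ∈ B.toQuadraticMap.radical ↔ ∀ y, B x y = 0 := by
  rw [QuadraticMap.mem_radical_iff']
  simp only [LinearMap.BilinMap.toQuadraticMap_apply, map_add, LinearMap.add_apply]
  constructor
  · rintro ⟨h1, h2⟩ y
    have := h2 y
    rw [hs y x] at this
    linarith
  · intro h
    simp [h, hs _ x]

theorem sig_inducedMetric_one {φ : V [⋀^Fin 3]→ₗ[ℝ] ℝ} (hφ : IsG2Structure 1 φ) :
    sigPos (inducedMetric 1 φ).toQuadraticMap = 3 ∧
      sigNeg (inducedMetric 1 φ).toQuadraticMap = 4 := by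
  obtain ⟨f, hf⟩ := hφ
  have he : Equivalent (inducedMetric 1 φ).toQuadraticMap
      (weightedSumSquares ℝ fun i => (modelDiag 1 i : ℝ)) :=
    ⟨{ f with
        map_app' := fun v => by
          simp [weightedSumSquares_apply, inducedMetric_apply hf, modelMetric_apply, mul_assoc] }⟩
  rw [QuadraticForm.sigPos_of_equiv_weightedSumSquares he,
    QuadraticForm.sigNeg_of_equiv_weightedSumSquares he]
  have h1 : {i | (0 : ℝ) < (modelDiag 1 i : ℝ)} = (({4, 5, 6} : Finset (Fin 7)) : Set (Fin 7)) := by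
    ext i
    fin_cases i <;> simp [modelDiag]
  have h2 : {i | (modelDiag 1 i : ℝ) < 0} = (({0, 1, 2, 3} : Finset (Fin 7)) : Set (Fin 7)) := by
    ext i
    fin_cases i <;> simp [modelDiag]
  rw [h1, h2, Set.ncard_coe_finset, Set.ncard_coe_finset]
  exact ⟨rfl, rfl⟩

variable [FiniteDimensional ℝ V]

theorem sigPos_add_sigNeg_eq_iff {B : LinearMap.BilinForm ℝ V} (hs : ∀ x y, B x y = B y x) :
    sigPos B.toQuadraticMap + sigNeg B.toQuadraticMap = finrank ℝ V ↔ B.Nondegenerate := by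
  have h := QuadraticForm.sigPos_add_sigNeg_add_radical (Q := B.toQuadraticMap)
  have h1 : finrank ℝ B.toQuadraticMap.radical = 0 ↔ B.Nondegenerate := by
    rw [Submodule.finrank_eq_zero, Submodule.eq_bot_iff]
    simp only [mem_radical_toQuadraticMap hs]
    exact ⟨fun h => ⟨h, fun x hx => h x fun y => (hs x y).trans (hx y)⟩, fun h => h.1⟩
  rw [← h1]
  omega

/-- Adjoin n to a positive definite subspace of W of maximal dimension. -/
theorem sigPos_restrict_add_one_le {B : LinearMap.BilinForm ℝ V} (hs : ∀ x y, B x y = B y x)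
    {W : Submodule ℝ V} {n : V} (hn : ∀ w ∈ W, B n w = 0) (hnn : 0 < B n n) :
    sigPos (B.restrict W).toQuadraticMap + 1 ≤ sigPos B.toQuadraticMap := by
  obtain ⟨P, hP, hpos⟩ := exists_finrank_eq_sigPos_and_posDef (B.restrict W).toQuadraticMap
  have hpos' : ∀ x ∈ P.map W.subtype, x ≠ 0 → 0 < B x x := by
    rintro _ ⟨x, hx, rfl⟩ hx0
    exact hpos ⟨x, hx⟩ fun h => hx0 (congrArg (fun y : P => ((y : W) : V)) h)
  have ho : ∀ x ∈ P.map W.subtype, B n x = 0 := by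
    rintro _ ⟨x, -, rfl⟩
    exact hn _ x.2
  have hnP : n ∉ P.map W.subtype := fun h => hnn.ne' (ho n h)
  have hd := Submodule.finrank_sup_span_singleton hnP
  rw [Submodule.finrank_map_subtype_eq, hP] at hd
  rw [← hd]
  refine le_sigPos_of_posDef _ ?_
  rintro ⟨x, hx⟩ hx0
  obtain ⟨p, hp, y, hy, rfl⟩ := Submodule.mem_sup.1 hx
  obtain ⟨c, rfl⟩ := Submodule.mem_span_singleton.1 hy
  change 0 < B (p + c • n) (p + c • n)
  have h1 := ho p hp
  have h2 := (hs p n).trans h1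
  simp only [map_add, map_smul, LinearMap.add_apply, LinearMap.smul_apply, h1, h2, smul_eq_mul]
  by_cases hp0 : p = 0
  · have hc : c ≠ 0 := by
      rintro rfl
      exact hx0 (Subtype.ext (by simp [hp0]))
    have : 0 < c * c * B n n := mul_pos (mul_self_pos.2 hc) hnn
    rw [hp0]
    simp
    linarith
  · have h3 := hpos' p hp hp0
    have : 0 ≤ c * c * B n n := mul_nonneg (mul_self_nonneg c) hnn.le
    linarith

theorem sigPos_restrict_le (B : LinearMap.BilinForm ℝ V) (W : Submodule ℝ V) :
    sigPos (B.restrict W).toQuadraticMap ≤ sigPos B.toQuadraticMap := by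
  obtain ⟨P, hP, hpos⟩ := exists_finrank_eq_sigPos_and_posDef (B.restrict W).toQuadraticMap
  rw [← hP, ← Submodule.finrank_map_subtype_eq]
  refine le_sigPos_of_posDef _ ?_
  rintro ⟨_, x, hx, rfl⟩ hx0
  exact hpos ⟨x, hx⟩ fun h => hx0 (Subtype.ext (congrArg (fun y : P => ((y : W) : V)) h))

/-- The signature of a non-degenerate hyperplane is determined by its normal vector. -/
theorem hasSignatureOn_of_normal {φ : V [⋀^Fin 3]→ₗ[ℝ] ℝ} (hφ : IsG2Structure 1 φ)
    {W : Submodule ℝ V} (hW : finrank ℝ W = 6) {n : V} (hn : ∀ w ∈ W, inducedMetric 1 φ n w = 0)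
    (hnd : ((inducedMetric 1 φ).restrict W).Nondegenerate) :
    (0 < inducedMetric 1 φ n n → HasSignatureOn (inducedMetric 1 φ) W 2 4) ∧
      (inducedMetric 1 φ n n < 0 → HasSignatureOn (inducedMetric 1 φ) W 3 3) := by
  obtain ⟨hs, hg⟩ := inducedMetric_symm_nondegenerate hφ
  obtain ⟨h3, h4⟩ := sig_inducedMetric_one hφ
  set g := inducedMetric 1 φ
  have h6 := (sigPos_add_sigNeg_eq_iff fun x y : W => hs x y).2 hnd
  rw [hW] at h6
  -- Bounds on negative indices are bounds on positive indices of -g.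
  have hn1 : ∀ U : Submodule ℝ V,
      sigNeg (g.restrict U).toQuadraticMap = sigPos ((-g).restrict U).toQuadraticMap :=
    fun _ => rfl
  have hn2 : sigNeg g.toQuadraticMap = sigPos (-g).toQuadraticMap := rfl
  unfold HasSignatureOn
  constructor
  · intro hpos
    -- The indices of W are at most 2 and 4 and add up to 6.
    have h1 := sigPos_restrict_add_one_le hs hn hpos
    have h2 := sigPos_restrict_le (-g) W
    rw [← hn2, ← hn1] at h2
    omega
  · intro hneg
    have h1 := sigPos_restrict_add_one_le (B := -g) (W := W) (n := n)
      (fun x y => by simp [hs x y]) (fun w hw => by simp [hn w hw]) (by simpa using hneg)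
    have h2 := sigPos_restrict_le g W
    rw [← hn2, ← hn1] at h1
    omega

end Signature
-- Parallel structures from infinitesimal automorphisms of the model.
section Construction

open Module

variable {𝔤 : Type*} [LieRing 𝔤] [LieAlgebra ℝ 𝔤] [FiniteDimensional ℝ 𝔤]

/-- The action of `f₇` on `ℝ f₇ ⊕ 𝔲` in coordinates, if it acts by the matrix `C` on `𝔲`. -/
def extendAction (C : Matrix (Fin 6) (Fin 6) ℝ) (ξ : Fin 7 → ℝ) : Fin 7 → ℝ :=
  Fin.cons 0 (C.mulVec (Fin.tail ξ))

theorem exists_coordinates (hdim : finrank ℝ 𝔤 = 7) {𝔲 : LieIdeal ℝ 𝔤}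
    (hu : finrank ℝ 𝔲 = 6) {f₇ : 𝔤} (hf₇ : f₇ ∉ 𝔲) (v : Basis (Fin 6) ℝ 𝔲) :
    ∃ e : 𝔤 ≃ₗ[ℝ] (Fin 7 → ℝ), e f₇ = Pi.single 0 1 ∧ (∀ X, X ∈ 𝔲 ↔ e X 0 = 0) ∧
      ∀ X, e ⁅f₇, X⁆ =
        extendAction (LinearMap.toMatrix v v (LieModule.toEnd ℝ 𝔤 𝔲 f₇)) (e X) := by
  let b : Basis (Fin 7) ℝ 𝔤 := Basis.mkFinCons (N := 𝔲.toSubmodule) f₇ v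
    (fun c x hx h => by
      by_contra hc
      refine hf₇ ?_
      have h1 : f₇ = -(c⁻¹ • x) := by
        rw [eq_neg_iff_add_eq_zero, ← smul_right_injective 𝔤 hc |>.eq_iff]
        simp [smul_smul, hc, h]
      rw [h1]
      exact neg_mem (𝔲.smul_mem _ hx))
    (fun z => by
      obtain ⟨c, hc⟩ := exists_sub_smul_mem hdim hu hf₇ z
      exact ⟨-c, by simpa [sub_eq_add_neg] using hc⟩)
  have hb0 : b 0 = f₇ := by simp [b]
  have hbs : ∀ i : Fin 6, b i.succ = v i := fun i => by simp [b]
  have hsymm : ∀ ξ, b.equivFun.symm ξ = ξ 0 • f₇ + (v.equivFun.symm (Fin.tail ξ) : 𝔤) := fun ξ => by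
    rw [Basis.equivFun_symm_apply, Basis.equivFun_symm_apply, Fin.sum_univ_succ, hb0]
    simp only [hbs, Fin.tail]
    congr 1
  have hdecomp : ∀ X, X = b.equivFun X 0 • f₇ + (v.equivFun.symm (Fin.tail (b.equivFun X)) : 𝔤) :=
    fun X => by rw [← hsymm, LinearEquiv.symm_apply_apply]
  refine ⟨b.equivFun, ?_, fun X => ⟨fun hX => ?_, fun hX => ?_⟩, fun X => ?_⟩
  · rw [← hb0]
    ext i
    simp [Pi.single_apply, eq_comm]
  · by_contra hc
    have h1 : b.equivFun X 0 • f₇ ∈ 𝔲 := by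
      have h2 : b.equivFun X 0 • f₇ = X - v.equivFun.symm (Fin.tail (b.equivFun X)) :=
        eq_sub_of_add_eq (hdecomp X).symm
      rw [h2]
      exact sub_mem hX (SetLike.coe_mem _)
    have h3 := 𝔲.smul_mem (b.equivFun X 0)⁻¹ h1
    rw [smul_smul, inv_mul_cancel₀ hc, one_smul] at h3
    exact hf₇ h3
  · rw [hdecomp X, hX, zero_smul, zero_add]
    exact SetLike.coe_mem _
  · apply b.equivFun.symm.injective
    rw [LinearEquiv.symm_apply_apply, hsymm]
    conv_lhs => rw [hdecomp X]
    simp only [extendAction, Fin.cons_zero, zero_smul, zero_add, Fin.tail_cons, lie_add, lie_smul,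
      lie_self, smul_zero]
    change ((LieModule.toEnd ℝ 𝔤 𝔲 f₇ (v.equivFun.symm (Fin.tail (b.equivFun X))) : 𝔲) : 𝔤) = _
    congr 1
    apply v.equivFun.injective
    rw [LinearEquiv.apply_symm_apply]
    have := LinearMap.toMatrix_mulVec_repr v v (LieModule.toEnd ℝ 𝔤 𝔲 f₇)
      (v.equivFun.symm (Fin.tail (b.equivFun X)))
    rw [← Basis.equivFun_apply, ← Basis.equivFun_apply, LinearEquiv.apply_symm_apply] at this
    exact this.symm

/-- A linear isomorphism to `ℝ⁷` that carries `ad f₇` to an infinitesimal automorphism of the model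
three-form defines a parallel structure. -/
theorem exists_parallel (hdim : finrank ℝ 𝔤 = 7) {𝔲 : LieIdeal ℝ 𝔤} (hab : IsLieAbelian 𝔲)
    (hu : finrank ℝ 𝔲 = 6) {f₇ : 𝔤} (hf₇ : f₇ ∉ 𝔲) (v : Basis (Fin 6) ℝ 𝔲)
    {C : Matrix (Fin 6) (Fin 6) ℝ} (hC : LinearMap.toMatrix v v (LieModule.toEnd ℝ 𝔤 𝔲 f₇) = C)
    (ε : ℤˣ) (F : (Fin 7 → ℝ) ≃ₗ[ℝ] (Fin 7 → ℝ))
    (hm : ∀ ξ η, modelMetric ε (F (extendAction C ξ)) (F η)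
      + modelMetric ε (F ξ) (F (extendAction C η)) = 0)
    (hF : ∀ ξ η ζ, modelForm ε ![F (extendAction C ξ), F η, F ζ]
      + modelForm ε ![F ξ, F (extendAction C η), F ζ]
      + modelForm ε ![F ξ, F η, F (extendAction C ζ)] = 0)
    (hn : ∀ ξ, ξ 0 = 0 → modelMetric ε (F (Pi.single 0 1)) (F ξ) = 0) :
    ∃ φ : 𝔤 [⋀^Fin 3]→ₗ[ℝ] ℝ, IsParallelG2Structure ε φ ∧
      (∀ u ∈ 𝔲, inducedMetric ε φ f₇ u = 0) ∧
      inducedMetric ε φ f₇ f₇ = modelMetric ε (F (Pi.single 0 1)) (F (Pi.single 0 1)) := by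
  subst hC
  obtain ⟨e, he0, heu, hea⟩ := exists_coordinates hdim hu hf₇ v
  let f := e.trans F
  let φ : 𝔤 [⋀^Fin 3]→ₗ[ℝ] ℝ := (modelForm ε).compLinearMap (f : 𝔤 →ₗ[ℝ] (Fin 7 → ℝ))
  have hf : IsAdapted ε φ f := rfl
  have hG : IsG2Structure ε φ := ⟨f, hf⟩
  obtain ⟨hs, hg⟩ := inducedMetric_symm_nondegenerate hG
  -- The candidate connection: zero along 𝔲 and ad f₇ along f₇. It is torsion-free since 𝔲 is
  -- Abelian, and metric since ad f₇ is skew, so uniqueness identifies it.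
  let D : 𝔤 →ₗ[ℝ] 𝔤 →ₗ[ℝ] 𝔤 :=
    (LinearMap.toSpanSingleton ℝ _ (LieAlgebra.ad ℝ 𝔤 f₇ : 𝔤 →ₗ[ℝ] 𝔤)) ∘ₗ
      LinearMap.proj 0 ∘ₗ (e : 𝔤 →ₗ[ℝ] (Fin 7 → ℝ))
  have hD : ∀ X Y, D X Y = e X 0 • ⁅f₇, Y⁆ := fun X Y => by simp [D]
  have hDL : D = leviCivita (inducedMetric ε φ) := by
    rw [eq_leviCivita_iff hg hs]
    refine ⟨fun X Y => ?_, fun X Y Z => ?_⟩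
    · have hmem : ∀ X, X - e X 0 • f₇ ∈ 𝔲 := fun X => by
        rw [heu]
        simp [he0]
      have h := lie_eq_zero_of_mem hab (hmem X) (hmem Y)
      simp only [sub_lie, lie_sub, smul_lie, lie_smul, lie_self, smul_zero, sub_zero] at h
      rw [← lie_skew X f₇] at h
      rw [hD, hD]
      refine sub_eq_zero.1 (Eq.trans ?_ ((congrArg Neg.neg h).trans neg_zero))
      module
    · rw [hD, hD, map_smul, map_smul, LinearMap.smul_apply, ← smul_add,
        inducedMetric_apply hf, inducedMetric_apply hf]
      have := hm (e Y) (e Z)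
      rw [← hea, ← hea] at this
      change e X 0 • (modelMetric ε (F (e _)) (F (e _)) + modelMetric ε (F (e _)) (F (e _))) = 0
      rw [this, smul_zero]
  refine ⟨φ, ⟨hG, fun X Y => ?_⟩, fun u huu => ?_, ?_⟩
  · rw [← hDL]
    have hY : Y = ![Y 0, Y 1, Y 2] := by ext i; fin_cases i <;> rfl
    have h := hF (e (Y 0)) (e (Y 1)) (e (Y 2))
    rw [← hea, ← hea, ← hea] at h
    have h' : φ ![⁅f₇, Y 0⁆, Y 1, Y 2] + φ ![Y 0, ⁅f₇, Y 1⁆, Y 2] + φ ![Y 0, Y 1, ⁅f₇, Y 2⁆] = 0 := by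
      rw [hf.apply, hf.apply, hf.apply]
      exact h
    rw [covDeriv, Fin.sum_univ_three]
    generalize Y 0 = a at *
    generalize Y 1 = b at *
    generalize Y 2 = c at *
    subst hY
    rw [update_zero, update_one, update_two]
    simp only [hD]
    rw [(form_smul φ a b c _ _).1, (form_smul φ a b c _ _).2.1, (form_smul φ a b c _ _).2.2]
    linear_combination (-e X 0) * h'
  · rw [inducedMetric_apply hf]
    change modelMetric ε (F (e f₇)) (F (e u)) = 0
    rw [he0]
    exact hn _ ((heu u).1 huu)
  · rw [inducedMetric_apply hf]
    change modelMetric ε (F (e f₇)) (F (e f₇)) = _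
    rw [he0]

/-- A vector of 𝔲 orthogonal to 𝔲 is also orthogonal to n, hence to everything. -/
theorem restrict_nondegenerate_of_normal (hdim : finrank ℝ 𝔤 = 7) {𝔲 : LieIdeal ℝ 𝔤}
    (hu : finrank ℝ 𝔲 = 6) {n : 𝔤} (hn : n ∉ 𝔲) {g : LinearMap.BilinForm ℝ 𝔤}
    (hs : ∀ X Y, g X Y = g Y X) (hg : g.Nondegenerate) (ho : ∀ u ∈ 𝔲, g n u = 0) :
    (g.restrict 𝔲.toSubmodule).Nondegenerate := by
  have h : ∀ u : 𝔲.toSubmodule, (∀ w, g.restrict 𝔲.toSubmodule u w = 0) → u = 0 := by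
    intro u hw
    refine Subtype.ext (hg.1 _ fun X => ?_)
    obtain ⟨c, hc⟩ := exists_sub_smul_mem hdim hu hn X
    have h1 : g u (X - c • n) = 0 := hw ⟨_, hc⟩
    rw [map_sub, map_smul, hs u n, ho u u.2, smul_zero, sub_zero] at h1
    exact h1
  exact ⟨h, fun u hw => h u fun w => (hs u w).trans (hw w)⟩

end Construction
-- Coordinates adapted to the normal forms.
section ExplicitForms

open Module

/-- The bidiagonal shape with scalars s, t covers all four families of complex type. -/
theorem ofBlocks_mulVec (a b c d e f s t : ℝ) (x : Fin 6 → ℝ) :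
    (ofBlocks !![M a b, s • 1, 0; 0, M c d, t • 1; 0, 0, M e f]).mulVec x =
      ![a * x 0 + b * x 1 + s * x 2, -b * x 0 + a * x 1 + s * x 3,
        c * x 2 + d * x 3 + t * x 4, -d * x 2 + c * x 3 + t * x 5,
        e * x 4 + f * x 5, -f * x 4 + e * x 5] := by
  have h : ofBlocks !![M a b, s • 1, 0; 0, M c d, t • 1; 0, 0, M e f] =
      !![a, b, s, 0, 0, 0; -b, a, 0, s, 0, 0; 0, 0, c, d, t, 0; 0, 0, -d, c, 0, t;
        0, 0, 0, 0, e, f; 0, 0, 0, 0, -f, e] := by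
    ext i j
    fin_cases i <;> fin_cases j <;> first | rfl | exact mul_one _ | exact mul_zero _
  rw [h]
  ext i
  fin_cases i <;> simp [Matrix.mulVec, dotProduct, Fin.sum_univ_six]

theorem extendAction_ofBlocks (a b c d e f s t : ℝ) (ξ : Fin 7 → ℝ) :
    extendAction (ofBlocks !![M a b, s • 1, 0; 0, M c d, t • 1; 0, 0, M e f]) ξ =
      ![0, a * ξ 1 + b * ξ 2 + s * ξ 3, -b * ξ 1 + a * ξ 2 + s * ξ 4,
        c * ξ 3 + d * ξ 4 + t * ξ 5, -d * ξ 3 + c * ξ 4 + t * ξ 6,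
        e * ξ 5 + f * ξ 6, -f * ξ 5 + e * ξ 6] := by
  rw [extendAction, ofBlocks_mulVec]
  rfl

/-- The coordinates `f₇ ↦ e₇`, `v_i ↦ e_i`. -/
def standardFrame : (Fin 7 → ℝ) ≃ₗ[ℝ] (Fin 7 → ℝ) where
  toFun ξ := ![ξ 1, ξ 2, ξ 3, ξ 4, ξ 5, ξ 6, ξ 0]
  invFun η := ![η 6, η 0, η 1, η 2, η 3, η 4, η 5]
  map_add' ξ η := by ext i; fin_cases i <;> rfl
  map_smul' t ξ := by ext i; fin_cases i <;> rfl
  left_inv ξ := by ext i; fin_cases i <;> rfl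
  right_inv η := by ext i; fin_cases i <;> rfl

/-- The coordinates `f₇ ↦ e₇` and two complex null lines that are dual to each other, followed by a
negative complex line. -/
noncomputable def hyperbolicFrame : (Fin 7 → ℝ) ≃ₗ[ℝ] (Fin 7 → ℝ) where
  toFun ξ := ![ξ 1 + ξ 3, ξ 2 + ξ 4, ξ 5, ξ 6, ξ 1 - ξ 3, ξ 2 - ξ 4, ξ 0]
  invFun η := ![η 6, (η 0 + η 4) / 2, (η 1 + η 5) / 2, (η 0 - η 4) / 2, (η 1 - η 5) / 2, η 2, η 3]
  map_add' ξ η := by ext i; fin_cases i <;> simp <;> ring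
  map_smul' t ξ := by ext i; fin_cases i <;> simp <;> ring
  left_inv ξ := by ext i; fin_cases i <;> simp
  right_inv η := by ext i; fin_cases i <;> simp <;> ring

/-- As `hyperbolicFrame`, with the second null line rotated by `J`. -/
noncomputable def twistedFrame : (Fin 7 → ℝ) ≃ₗ[ℝ] (Fin 7 → ℝ) where
  toFun ξ := ![ξ 1 - ξ 4, ξ 2 + ξ 3, ξ 5, ξ 6, ξ 1 + ξ 4, ξ 2 - ξ 3, ξ 0]
  invFun η := ![η 6, (η 0 + η 4) / 2, (η 1 + η 5) / 2, (η 1 - η 5) / 2, (η 4 - η 0) / 2, η 2, η 3]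
  map_add' ξ η := by ext i; fin_cases i <;> simp <;> ring
  map_smul' t ξ := by ext i; fin_cases i <;> simp <;> ring
  left_inv ξ := by ext i; fin_cases i <;> simp
  right_inv η := by ext i; fin_cases i <;> simp <;> ring

/-- The coordinates `f₇ ↦ e₇` and a complex null line, a negative line and a null line dual to the
first. -/
noncomputable def nullFrame : (Fin 7 → ℝ) ≃ₗ[ℝ] (Fin 7 → ℝ) where
  toFun ξ := ![ξ 1 - ξ 5 / 2, ξ 2 - ξ 6 / 2, ξ 3, ξ 4, ξ 1 + ξ 5 / 2, ξ 2 + ξ 6 / 2, ξ 0]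
  invFun η := ![η 6, (η 0 + η 4) / 2, (η 1 + η 5) / 2, η 2, η 3, η 4 - η 0, η 5 - η 1]
  map_add' ξ η := by ext i; fin_cases i <;> simp <;> ring
  map_smul' t ξ := by ext i; fin_cases i <;> simp <;> ring
  left_inv ξ := by ext i; fin_cases i <;> simp
  right_inv η := by ext i; fin_cases i <;> simp <;> ring

/-- The coordinates `f₇ ↦ e₁` and two dual real null subspaces of dimension three. -/
noncomputable def paraFrame : (Fin 7 → ℝ) ≃ₗ[ℝ] (Fin 7 → ℝ) where
  toFun ξ := ![ξ 0, ξ 1 + ξ 4, ξ 2 + ξ 5, ξ 3 + ξ 6, ξ 2 - ξ 5, -ξ 3 + ξ 6, -ξ 1 + ξ 4]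
  invFun η := ![η 0, (η 1 - η 6) / 2, (η 2 + η 4) / 2, (η 3 - η 5) / 2, (η 1 + η 6) / 2,
    (η 2 - η 4) / 2, (η 3 + η 5) / 2]
  map_add' ξ η := by ext i; fin_cases i <;> simp <;> ring
  map_smul' t ξ := by ext i; fin_cases i <;> simp <;> ring
  left_inv ξ := by ext i; fin_cases i <;> simp <;> ring
  right_inv η := by ext i; fin_cases i <;> simp <;> ring

theorem standardFrame_apply (ξ : Fin 7 → ℝ) :
    standardFrame ξ = ![ξ 1, ξ 2, ξ 3, ξ 4, ξ 5, ξ 6, ξ 0] := rfl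

theorem hyperbolicFrame_apply (ξ : Fin 7 → ℝ) :
    hyperbolicFrame ξ = ![ξ 1 + ξ 3, ξ 2 + ξ 4, ξ 5, ξ 6, ξ 1 - ξ 3, ξ 2 - ξ 4, ξ 0] := rfl

theorem twistedFrame_apply (ξ : Fin 7 → ℝ) :
    twistedFrame ξ = ![ξ 1 - ξ 4, ξ 2 + ξ 3, ξ 5, ξ 6, ξ 1 + ξ 4, ξ 2 - ξ 3, ξ 0] := rfl

theorem nullFrame_apply (ξ : Fin 7 → ℝ) :
    nullFrame ξ = ![ξ 1 - ξ 5 / 2, ξ 2 - ξ 6 / 2, ξ 3, ξ 4, ξ 1 + ξ 5 / 2, ξ 2 + ξ 6 / 2, ξ 0] :=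
  rfl

theorem paraFrame_apply (ξ : Fin 7 → ℝ) :
    paraFrame ξ = ![ξ 0, ξ 1 + ξ 4, ξ 2 + ξ 5, ξ 3 + ξ 6, ξ 2 - ξ 5, -ξ 3 + ξ 6, -ξ 1 + ξ 4] :=
  rfl

theorem extendAction_fromBlocks (B : Matrix (Fin 3) (Fin 3) ℝ) (ξ : Fin 7 → ℝ) :
    extendAction (Matrix.reindex finSumFinEquiv finSumFinEquiv
      (Matrix.fromBlocks B 0 0 (-B.transpose))) ξ =
      ![0, B 0 0 * ξ 1 + B 0 1 * ξ 2 + B 0 2 * ξ 3, B 1 0 * ξ 1 + B 1 1 * ξ 2 + B 1 2 * ξ 3,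
        B 2 0 * ξ 1 + B 2 1 * ξ 2 + B 2 2 * ξ 3, -(B 0 0 * ξ 4 + B 1 0 * ξ 5 + B 2 0 * ξ 6),
        -(B 0 1 * ξ 4 + B 1 1 * ξ 5 + B 2 1 * ξ 6), -(B 0 2 * ξ 4 + B 1 2 * ξ 5 + B 2 2 * ξ 6)] := by
  have h : ∀ x : Fin 6 → ℝ, (Matrix.reindex finSumFinEquiv finSumFinEquiv
      (Matrix.fromBlocks B 0 0 (-B.transpose))).mulVec x =
      ![B 0 0 * x 0 + B 0 1 * x 1 + B 0 2 * x 2, B 1 0 * x 0 + B 1 1 * x 1 + B 1 2 * x 2,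
        B 2 0 * x 0 + B 2 1 * x 1 + B 2 2 * x 2, -(B 0 0 * x 3 + B 1 0 * x 4 + B 2 0 * x 5),
        -(B 0 1 * x 3 + B 1 1 * x 4 + B 2 1 * x 5), -(B 0 2 * x 3 + B 1 2 * x 4 + B 2 2 * x 5)] := by
    intro x
    have h1 : Matrix.reindex finSumFinEquiv finSumFinEquiv
        (Matrix.fromBlocks B 0 0 (-B.transpose)) =
        !![B 0 0, B 0 1, B 0 2, 0, 0, 0; B 1 0, B 1 1, B 1 2, 0, 0, 0;
          B 2 0, B 2 1, B 2 2, 0, 0, 0; 0, 0, 0, -B 0 0, -B 1 0, -B 2 0;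
          0, 0, 0, -B 0 1, -B 1 1, -B 2 1; 0, 0, 0, -B 0 2, -B 1 2, -B 2 2] := by
      ext i j
      fin_cases i <;> fin_cases j <;> rfl
    rw [h1]
    ext i
    fin_cases i <;> simp [Matrix.mulVec, dotProduct, Fin.sum_univ_six] <;> ring
  rw [extendAction, h]
  rfl

end ExplicitForms
-- Realization of each normal form.
section Existence

open Module

variable {𝔤 : Type*} [LieRing 𝔤] [LieAlgebra ℝ 𝔤] [FiniteDimensional ℝ 𝔤]

theorem exists_parallel_hasSignatureOn (hdim : finrank ℝ 𝔤 = 7) {𝔲 : LieIdeal ℝ 𝔤}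
    (hab : IsLieAbelian 𝔲) (hu : finrank ℝ 𝔲 = 6) {f₇ : 𝔤} (hf₇ : f₇ ∉ 𝔲)
    (v : Basis (Fin 6) ℝ 𝔲) {C : Matrix (Fin 6) (Fin 6) ℝ}
    (hC : LinearMap.toMatrix v v (LieModule.toEnd ℝ 𝔤 𝔲 f₇) = C)
    (F : (Fin 7 → ℝ) ≃ₗ[ℝ] (Fin 7 → ℝ))
    (hm : ∀ ξ η, modelMetric 1 (F (extendAction C ξ)) (F η)
      + modelMetric 1 (F ξ) (F (extendAction C η)) = 0)
    (hF : ∀ ξ η ζ, modelForm 1 ![F (extendAction C ξ), F η, F ζ]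
      + modelForm 1 ![F ξ, F (extendAction C η), F ζ]
      + modelForm 1 ![F ξ, F η, F (extendAction C ζ)] = 0)
    (hn : ∀ ξ, ξ 0 = 0 → modelMetric 1 (F (Pi.single 0 1)) (F ξ) = 0) :
    ∃ φ : 𝔤 [⋀^Fin 3]→ₗ[ℝ] ℝ, IsParallelG2Structure 1 φ ∧
      (0 < modelMetric 1 (F (Pi.single 0 1)) (F (Pi.single 0 1)) →
        HasSignatureOn (inducedMetric 1 φ) 𝔲.toSubmodule 2 4) ∧
      (modelMetric 1 (F (Pi.single 0 1)) (F (Pi.single 0 1)) < 0 →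
        HasSignatureOn (inducedMetric 1 φ) 𝔲.toSubmodule 3 3) := by
  obtain ⟨φ, hφ, ho, hnn⟩ := exists_parallel hdim hab hu hf₇ v hC 1 F hm hF hn
  obtain ⟨hs, hg⟩ := inducedMetric_symm_nondegenerate hφ.1
  refine ⟨φ, hφ, ?_⟩
  rw [← hnn]
  exact hasSignatureOn_of_normal hφ.1 hu ho (restrict_nondegenerate_of_normal hdim hu hf₇ hs hg ho)

/-- The model form is ω ∧ e⁷ plus the real part of (e¹+ie²)∧(e³+ie⁴)∧(e⁵+ie⁶), where ω =
-ε(e¹²+e³⁴)+e⁵⁶. Rotations of the three planes preserve ω and the metric, and they preserve the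
complex volume form when the angles add up to zero. -/
theorem exists_parallel_standard (hdim : finrank ℝ 𝔤 = 7) {𝔲 : LieIdeal ℝ 𝔤}
    (hab : IsLieAbelian 𝔲) (hu : finrank ℝ 𝔲 = 6) {f₇ : 𝔤} (hf₇ : f₇ ∉ 𝔲)
    (v : Basis (Fin 6) ℝ 𝔲) {a b c : ℝ} (habc : a + b + c = 0)
    (hC : LinearMap.toMatrix v v (LieModule.toEnd ℝ 𝔤 𝔲 f₇) =
      ofBlocks !![M 0 a, 0, 0; 0, M 0 b, 0; 0, 0, M 0 c]) :
    (∃ φ : 𝔤 [⋀^Fin 3]→ₗ[ℝ] ℝ, IsParallelG2Structure (-1) φ) ∧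
    ∃ φ : 𝔤 [⋀^Fin 3]→ₗ[ℝ] ℝ, IsParallelG2Structure 1 φ ∧
      HasSignatureOn (inducedMetric 1 φ) 𝔲.toSubmodule 2 4 := by
  obtain rfl : c = -a - b := by linarith
  -- Zero blocks are written as 0 • 1 to fit the shape of `extendAction_ofBlocks`.
  have hC' := hC.trans (by rw [← zero_smul ℝ (1 : Matrix (Fin 2) (Fin 2) ℝ)] :
    _ = ofBlocks !![M 0 a, (0 : ℝ) • 1, 0; 0, M 0 b, (0 : ℝ) • 1; 0, 0, M 0 (-a - b)])
  have hm : ∀ ε : ℤˣ, ∀ ξ η, modelMetric ε (standardFrame (extendAction (ofBlocks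
      !![M 0 a, (0 : ℝ) • 1, 0; 0, M 0 b, (0 : ℝ) • 1; 0, 0, M 0 (-a - b)]) ξ)) (standardFrame η)
      + modelMetric ε (standardFrame ξ) (standardFrame (extendAction (ofBlocks
      !![M 0 a, (0 : ℝ) • 1, 0; 0, M 0 b, (0 : ℝ) • 1; 0, 0, M 0 (-a - b)]) η)) = 0 := by
    intro ε ξ η
    simp only [extendAction_ofBlocks, standardFrame_apply, modelMetric_apply_seven,
      Matrix.cons_val]
    ring
  have hF : ∀ ε : ℤˣ, ∀ ξ η ζ, modelForm ε ![standardFrame (extendAction (ofBlocks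
      !![M 0 a, (0 : ℝ) • 1, 0; 0, M 0 b, (0 : ℝ) • 1; 0, 0, M 0 (-a - b)]) ξ), standardFrame η,
        standardFrame ζ]
      + modelForm ε ![standardFrame ξ, standardFrame (extendAction (ofBlocks
      !![M 0 a, (0 : ℝ) • 1, 0; 0, M 0 b, (0 : ℝ) • 1; 0, 0, M 0 (-a - b)]) η), standardFrame ζ]
      + modelForm ε ![standardFrame ξ, standardFrame η, standardFrame (extendAction (ofBlocks
      !![M 0 a, (0 : ℝ) • 1, 0; 0, M 0 b, (0 : ℝ) • 1; 0, 0, M 0 (-a - b)]) ζ)] = 0 := by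
    intro ε ξ η ζ
    simp only [extendAction_ofBlocks, standardFrame_apply, modelForm_apply, coordForm_apply,
      Matrix.cons_val]
    ring
  have hn : ∀ ε : ℤˣ, ∀ ξ : Fin 7 → ℝ, ξ 0 = 0 →
      modelMetric ε (standardFrame (Pi.single 0 1)) (standardFrame ξ) = 0 := by
    intro ε ξ h
    simp [standardFrame_apply, modelMetric_apply_seven, h]
  obtain ⟨φ, hφ, -⟩ := exists_parallel hdim hab hu hf₇ v hC' (-1) _ (hm _) (hF _) (hn _)
  obtain ⟨ψ, hψ, h, -⟩ := exists_parallel_hasSignatureOn hdim hab hu hf₇ v hC' _ (hm _) (hF _)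
    (hn _)
  exact ⟨⟨φ, hφ⟩, ψ, hψ, h (by simp [standardFrame_apply, modelMetric_apply_seven])⟩

/-- The eigenvalues a - ib and -a - ib are exchanged by λ ↦ -conj λ, so their complex eigenlines can
be taken null and dual to each other. -/
theorem exists_parallel_hyperbolic (hdim : finrank ℝ 𝔤 = 7) {𝔲 : LieIdeal ℝ 𝔤}
    (hab : IsLieAbelian 𝔲) (hu : finrank ℝ 𝔲 = 6) {f₇ : 𝔤} (hf₇ : f₇ ∉ 𝔲)
    (v : Basis (Fin 6) ℝ 𝔲) {a b : ℝ}
    (hC : LinearMap.toMatrix v v (LieModule.toEnd ℝ 𝔤 𝔲 f₇) =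
      ofBlocks !![M a b, 0, 0; 0, M (-a) b, 0; 0, 0, M 0 (-2 * b)]) :
    ∃ φ : 𝔤 [⋀^Fin 3]→ₗ[ℝ] ℝ, IsParallelG2Structure 1 φ ∧
      HasSignatureOn (inducedMetric 1 φ) 𝔲.toSubmodule 2 4 := by
  have hC' := hC.trans (by rw [← zero_smul ℝ (1 : Matrix (Fin 2) (Fin 2) ℝ)] :
    _ = ofBlocks !![M a b, (0 : ℝ) • 1, 0; 0, M (-a) b, (0 : ℝ) • 1; 0, 0, M 0 (-2 * b)])
  obtain ⟨ψ, hψ, h, -⟩ := exists_parallel_hasSignatureOn hdim hab hu hf₇ v hC' hyperbolicFrame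
    (fun ξ η => by
      simp only [extendAction_ofBlocks, hyperbolicFrame_apply, modelMetric_apply_seven,
        Matrix.cons_val, Units.val_one, Int.cast_one]
      ring)
    (fun ξ η ζ => by
      simp only [extendAction_ofBlocks, hyperbolicFrame_apply, modelForm_apply, coordForm_apply,
        Matrix.cons_val, Units.val_one, Int.cast_one]
      ring)
    (fun ξ h => by simp [hyperbolicFrame_apply, modelMetric_apply_seven, h])
  exact ⟨ψ, hψ, h (by simp [hyperbolicFrame_apply, modelMetric_apply_seven])⟩

/-- For a chain v₃ ↦ v₁, where v₃ ↦ v₁ is the nilpotent part, skewness requires g(v₁, v₃) = 0, so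
the Hermitian pairing of the two null lines must be imaginary instead of real. Hence the rotation by
J in `twistedFrame`. -/
theorem exists_parallel_twisted (hdim : finrank ℝ 𝔤 = 7) {𝔲 : LieIdeal ℝ 𝔤}
    (hab : IsLieAbelian 𝔲) (hu : finrank ℝ 𝔲 = 6) {f₇ : 𝔤} (hf₇ : f₇ ∉ 𝔲)
    (v : Basis (Fin 6) ℝ 𝔲) {e : ℝ}
    (hC : LinearMap.toMatrix v v (LieModule.toEnd ℝ 𝔤 𝔲 f₇) =
      ofBlocks !![M 0 e, 1, 0; 0, M 0 e, 0; 0, 0, M 0 (-2 * e)]) :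
    ∃ φ : 𝔤 [⋀^Fin 3]→ₗ[ℝ] ℝ, IsParallelG2Structure 1 φ ∧
      HasSignatureOn (inducedMetric 1 φ) 𝔲.toSubmodule 2 4 := by
  have hC' := hC.trans (by
      rw [one_smul, zero_smul] :
    _ = ofBlocks !![M 0 e, (1 : ℝ) • 1, 0; 0, M 0 e, (0 : ℝ) • 1; 0, 0, M 0 (-2 * e)])
  obtain ⟨ψ, hψ, h, -⟩ := exists_parallel_hasSignatureOn hdim hab hu hf₇ v hC' twistedFrame
    (fun ξ η => by
      simp only [extendAction_ofBlocks, twistedFrame_apply, modelMetric_apply_seven,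
        Matrix.cons_val, Units.val_one, Int.cast_one]
      ring)
    (fun ξ η ζ => by
      simp only [extendAction_ofBlocks, twistedFrame_apply, modelForm_apply, coordForm_apply,
        Matrix.cons_val, Units.val_one, Int.cast_one]
      ring)
    (fun ξ h => by simp [twistedFrame_apply, modelMetric_apply_seven, h])
  exact ⟨ψ, hψ, h (by simp [twistedFrame_apply, modelMetric_apply_seven])⟩

/-- For v₅ ↦ v₃ ↦ v₁ skewness requires g(v₃, v₃) = -g(v₅, v₁). The factors 1/2 in `nullFrame` make
these values -1 and 1. -/
theorem exists_parallel_nilpotent (hdim : finrank ℝ 𝔤 = 7) {𝔲 : LieIdeal ℝ 𝔤}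
    (hab : IsLieAbelian 𝔲) (hu : finrank ℝ 𝔲 = 6) {f₇ : 𝔤} (hf₇ : f₇ ∉ 𝔲)
    (v : Basis (Fin 6) ℝ 𝔲)
    (hC : LinearMap.toMatrix v v (LieModule.toEnd ℝ 𝔤 𝔲 f₇) =
      ofBlocks !![0, 1, 0; 0, 0, 1; 0, 0, 0]) :
    ∃ φ : 𝔤 [⋀^Fin 3]→ₗ[ℝ] ℝ, IsParallelG2Structure 1 φ ∧
      HasSignatureOn (inducedMetric 1 φ) 𝔲.toSubmodule 2 4 := by
  have hM : M 0 0 = 0 := by ext i j; fin_cases i <;> fin_cases j <;> simp [M]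
  have hC' := hC.trans (by rw [one_smul, hM] :
    _ = ofBlocks !![M 0 0, (1 : ℝ) • 1, 0; 0, M 0 0, (1 : ℝ) • 1; 0, 0, M 0 0])
  obtain ⟨ψ, hψ, h, -⟩ := exists_parallel_hasSignatureOn hdim hab hu hf₇ v hC' nullFrame
    (fun ξ η => by
      simp only [extendAction_ofBlocks, nullFrame_apply, modelMetric_apply_seven,
        Matrix.cons_val, Units.val_one, Int.cast_one]
      ring)
    (fun ξ η ζ => by
      simp only [extendAction_ofBlocks, nullFrame_apply, modelForm_apply, coordForm_apply,
        Matrix.cons_val, Units.val_one, Int.cast_one]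
      ring)
    (fun ξ h => by simp [nullFrame_apply, modelMetric_apply_seven, h])
  exact ⟨ψ, hψ, h (by simp [nullFrame_apply, modelMetric_apply_seven])⟩

/-- diag(B, -Bᵀ) preserves the pairing of two dual null 3-spaces, and for tr B = 0 also their volume
forms. Here f₇ goes to e₁, whose square is -1. -/
theorem exists_parallel_para (hdim : finrank ℝ 𝔤 = 7) {𝔲 : LieIdeal ℝ 𝔤}
    (hab : IsLieAbelian 𝔲) (hu : finrank ℝ 𝔲 = 6) {f₇ : 𝔤} (hf₇ : f₇ ∉ 𝔲)
    (v : Basis (Fin 6) ℝ 𝔲) {B : Matrix (Fin 3) (Fin 3) ℝ} (hB : B.trace = 0)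
    (hC : LinearMap.toMatrix v v (LieModule.toEnd ℝ 𝔤 𝔲 f₇) =
      Matrix.reindex finSumFinEquiv finSumFinEquiv (Matrix.fromBlocks B 0 0 (-B.transpose))) :
    ∃ φ : 𝔤 [⋀^Fin 3]→ₗ[ℝ] ℝ, IsParallelG2Structure 1 φ ∧
      HasSignatureOn (inducedMetric 1 φ) 𝔲.toSubmodule 3 3 := by
  have hB2 : B 2 2 = -B 0 0 - B 1 1 := by
    rw [Matrix.trace_fin_three] at hB
    linarith
  obtain ⟨ψ, hψ, -, h⟩ := exists_parallel_hasSignatureOn hdim hab hu hf₇ v hC paraFrame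
    (fun ξ η => by
      simp only [extendAction_fromBlocks, paraFrame_apply, modelMetric_apply_seven,
        Matrix.cons_val, Units.val_one, Int.cast_one]
      ring)
    (fun ξ η ζ => by
      simp only [extendAction_fromBlocks, paraFrame_apply, modelForm_apply, coordForm_apply,
        Matrix.cons_val, Units.val_one, Int.cast_one, hB2]
      ring)
    (fun ξ h => by simp [paraFrame_apply, modelMetric_apply_seven, h])
  exact ⟨ψ, hψ, h (by simp [paraFrame_apply, modelMetric_apply_seven])⟩

end Existence
-- The three equivalences.
section NormalForms

open Module

theorem inducedMetric_neg_one_pos {V : Type*} [AddCommGroup V] [Module ℝ V]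
    {φ : V [⋀^Fin 3]→ₗ[ℝ] ℝ} (hφ : IsG2Structure (-1) φ) {X : V} (hX : X ≠ 0) :
    0 < inducedMetric (-1) φ X X := by
  obtain ⟨f, hf⟩ := hφ
  rw [inducedMetric_apply hf, modelMetric_apply]
  have h : f X ≠ 0 := f.map_ne_zero_iff.2 hX
  obtain ⟨i, hi⟩ := Function.ne_iff.1 h
  have h1 : ∀ j, (modelDiag (-1) j : ℝ) = 1 := fun j => by
    fin_cases j <;> simp [modelDiag]
  simp only [h1, one_mul]
  exact Finset.sum_pos' (fun j _ => mul_self_nonneg _)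
    ⟨i, Finset.mem_univ i, mul_self_pos.2 hi⟩

theorem inducedMetric_neg_one_restrict_nondegenerate {V : Type*} [AddCommGroup V]
    [Module ℝ V] {φ : V [⋀^Fin 3]→ₗ[ℝ] ℝ} (hφ : IsG2Structure (-1) φ) (W : Submodule ℝ V) :
    ((inducedMetric (-1) φ).restrict W).Nondegenerate := by
  have h : ∀ u : W, (inducedMetric (-1) φ).restrict W u u = 0 → u = 0 := fun u hu => by
    by_contra hne
    exact (inducedMetric_neg_one_pos hφ (X := u) (by simpa using hne)).ne' hu
  exact ⟨fun u hu => h u (hu u), fun u hu => h u (hu u)⟩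

variable {𝔤 : Type*} [LieRing 𝔤] [LieAlgebra ℝ 𝔤] [FiniteDimensional ℝ 𝔤]
  {𝔲 : LieIdeal ℝ 𝔤} {φ : 𝔤 [⋀^Fin 3]→ₗ[ℝ] ℝ} {ε : ℤˣ}

/-- The operator on `𝔲` induced by the cross product with a unit normal vector. -/
theorem IsParallelG2Structure.exists_unit_operator (hdim : finrank ℝ 𝔤 = 7)
    (hab : IsLieAbelian 𝔲) (hu : finrank ℝ 𝔲 = 6) {f₇ : 𝔤} (hf₇ : f₇ ∉ 𝔲)
    (hφ : IsParallelG2Structure ε φ)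
    (hgu : ((inducedMetric ε φ).restrict 𝔲.toSubmodule).Nondegenerate) :
    ∃ (n : 𝔤) (J : 𝔲 →ₗ[ℝ] 𝔲), (∀ u ∈ 𝔲, inducedMetric ε φ n u = 0) ∧
      (0 < inducedMetric ε φ n n ∧ J * J = -1 ∨ inducedMetric ε φ n n < 0 ∧ J * J = 1) ∧
      (∀ u v : 𝔲, inducedMetric ε φ (J u) v + inducedMetric ε φ u (J v) = 0) ∧
      (∀ u v : 𝔲, inducedMetric ε φ (LieModule.toEnd ℝ 𝔤 𝔲 f₇ u) v
        + inducedMetric ε φ u (LieModule.toEnd ℝ 𝔤 𝔲 f₇ v) = 0) ∧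
      LieModule.toEnd ℝ 𝔤 𝔲 f₇ * J = J * LieModule.toEnd ℝ 𝔤 𝔲 f₇ ∧
      LinearMap.trace ℝ 𝔲 (LieModule.toEnd ℝ 𝔤 𝔲 f₇ * J) = 0 ∧
      LinearMap.trace ℝ 𝔲 (LieModule.toEnd ℝ 𝔤 𝔲 f₇) = 0 := by
  obtain ⟨-, hg⟩ := inducedMetric_symm_nondegenerate hφ.1
  obtain ⟨n, hfn, hn, ho, hnn⟩ := exists_normal hdim hu hf₇ hg hgu
  obtain ⟨J, hJ, hgJ, hgA, hA, htAJ, htA⟩ := hφ.exists_operator hdim hab hu hfn hn ho hnn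
  set g := inducedMetric ε φ
  -- This scaling turns J² = -g(n,n) into ∓1. Only J is rescaled, n is kept.
  set c := (√|g n n|)⁻¹
  have hc : c * c * |g n n| = 1 := by
    have h := Real.mul_self_sqrt (abs_nonneg (g n n))
    have h' : √|g n n| ≠ 0 := (Real.sqrt_pos.2 (abs_pos.2 hnn)).ne'
    rw [← h]
    simp only [c]
    field_simp
  refine ⟨n, c • J, ho, ?_, fun u v => ?_, hgA, ?_, ?_, htA⟩
  · rw [smul_mul_smul_comm, hJ, smul_smul]
    rcases lt_or_gt_of_ne hnn with h | h
    · rw [abs_of_neg h] at hc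
      exact Or.inr ⟨h, by rw [hc, one_smul]⟩
    · rw [abs_of_pos h] at hc
      exact Or.inl ⟨h, by rw [mul_neg, hc, neg_smul, one_smul]⟩
  · change g ((c • J u : 𝔲) : 𝔤) v + g u ((c • J v : 𝔲) : 𝔤) = 0
    simp only [LieSubmodule.coe_smul, map_smul, LinearMap.smul_apply]
    rw [← smul_add, hgJ, smul_zero]
  · rw [mul_smul_comm, hA, smul_mul_assoc]
  · rw [mul_smul_comm, map_smul, htAJ, smul_zero]

theorem HasSignatureOn.restrict_nondegenerate {W : Submodule ℝ 𝔤}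
    {g : LinearMap.BilinForm ℝ 𝔤} (hs : ∀ x y, g x y = g y x) {p q : ℕ}
    (h : HasSignatureOn g W p q) (hW : finrank ℝ W = p + q) : (g.restrict W).Nondegenerate :=
  (sigPos_add_sigNeg_eq_iff fun x y : W => hs x y).1 (by rw [h.1, h.2, hW])

theorem exists_parallelG2Structure_iff (hdim : finrank ℝ 𝔤 = 7) (hab : IsLieAbelian 𝔲)
    (hu : finrank ℝ 𝔲 = 6) {f₇ : 𝔤} (hf₇ : f₇ ∉ 𝔲) :
    (∃ φ : 𝔤 [⋀^Fin 3]→ₗ[ℝ] ℝ, IsParallelG2Structure (-1) φ) ↔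
      ∃ (a b : ℝ) (v : Basis (Fin 6) ℝ 𝔲),
        LinearMap.toMatrix v v (LieModule.toEnd ℝ 𝔤 𝔲 f₇) =
          ofBlocks !![M 0 a, 0, 0; 0, M 0 b, 0; 0, 0, M 0 (-a - b)] := by
  constructor
  · rintro ⟨φ, hφ⟩
    have hpos : ∀ u : 𝔲, u ≠ 0 →
        0 < (inducedMetric (-1) φ).restrict 𝔲.toSubmodule u u :=
      fun u h => inducedMetric_neg_one_pos hφ.1 (by simpa using h)
    obtain ⟨hs, -⟩ := inducedMetric_symm_nondegenerate hφ.1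
    obtain ⟨n, J, -, hJ, hgJ, hgA, hA, htAJ, -⟩ := hφ.exists_unit_operator hdim hab hu hf₇
      (inducedMetric_neg_one_restrict_nondegenerate hφ.1 _)
    have hJ1 : J * J = -1 := by
      rcases hJ with ⟨-, h⟩ | ⟨h, -⟩
      · exact h
      · have hn : n ≠ 0 := by
          rintro rfl
          simp at h
        exact absurd (inducedMetric_neg_one_pos hφ.1 hn) h.le.not_gt
    exact exists_normalForm_of_skew_of_posDef hu hJ1 hA htAJ hpos (fun u v => hs u v) hgJ hgA
  · rintro ⟨a, b, v, h⟩
    exact (exists_parallel_standard hdim hab hu hf₇ v (by ring) h).1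

theorem exists_parallel_two_four_iff (hdim : finrank ℝ 𝔤 = 7) (hab : IsLieAbelian 𝔲)
    (hu : finrank ℝ 𝔲 = 6) {f₇ : 𝔤} (hf₇ : f₇ ∉ 𝔲) :
    (∃ φ : 𝔤 [⋀^Fin 3]→ₗ[ℝ] ℝ, IsParallelG2Structure 1 φ ∧
        HasSignatureOn (inducedMetric 1 φ) 𝔲.toSubmodule 2 4) ↔
      ∃ v : Basis (Fin 6) ℝ 𝔲,
        (∃ a b : ℝ, a ≠ 0 ∧ LinearMap.toMatrix v v (LieModule.toEnd ℝ 𝔤 𝔲 f₇) =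
          ofBlocks !![M a b, 0, 0; 0, M (-a) b, 0; 0, 0, M 0 (-2 * b)]) ∨
        (∃ c d : ℝ, LinearMap.toMatrix v v (LieModule.toEnd ℝ 𝔤 𝔲 f₇) =
          ofBlocks !![M 0 c, 0, 0; 0, M 0 d, 0; 0, 0, M 0 (-(c + d))]) ∨
        (∃ e : ℝ, LinearMap.toMatrix v v (LieModule.toEnd ℝ 𝔤 𝔲 f₇) =
          ofBlocks !![M 0 e, 1, 0; 0, M 0 e, 0; 0, 0, M 0 (-2 * e)]) ∨
        LinearMap.toMatrix v v (LieModule.toEnd ℝ 𝔤 𝔲 f₇) =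
          ofBlocks !![0, 1, 0; 0, 0, 1; 0, 0, 0] := by
  constructor
  · rintro ⟨φ, hφ, hsig⟩
    obtain ⟨hs, -⟩ := inducedMetric_symm_nondegenerate hφ.1
    have hgu := hsig.restrict_nondegenerate hs hu
    obtain ⟨n, J, ho, hJ, hgJ, hgA, hA, htAJ, htA⟩ := hφ.exists_unit_operator hdim hab hu hf₇ hgu
    have hJ1 : J * J = -1 := by
      rcases hJ with ⟨-, h⟩ | ⟨h, -⟩
      · exact h
      -- A negative normal vector would give 𝔲 signature (3,3).
      · have h1 := ((hasSignatureOn_of_normal hφ.1 hu ho hgu).2 h).1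
        rw [hsig.1] at h1
        omega
    exact exists_normalForm_of_skew hu hJ1 hA htA htAJ hgu hgJ hgA
  · rintro ⟨v, ⟨a, b, -, h⟩ | ⟨c, d, h⟩ | ⟨e, h⟩ | h⟩
    · exact exists_parallel_hyperbolic hdim hab hu hf₇ v h
    · exact (exists_parallel_standard hdim hab hu hf₇ v (by ring) h).2
    · exact exists_parallel_twisted hdim hab hu hf₇ v h
    · exact exists_parallel_nilpotent hdim hab hu hf₇ v h

theorem isUnit_reindex {m n R : Type*} [Fintype m] [Fintype n]
    [DecidableEq m] [DecidableEq n] [CommRing R] {P : Matrix m m R} (hP : IsUnit P) (e : m ≃ n) :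
    IsUnit (Matrix.reindex e e P) :=
  hP.map (Matrix.reindexRingEquiv R e)

theorem reindex_mul_eq {m n R : Type*} [Fintype m] [Fintype n] [DecidableEq m] [DecidableEq n]
    [CommRing R] (e : m ≃ n) {X P Y : Matrix m m R} (h : X * P = P * Y) :
    Matrix.reindex e e X * Matrix.reindex e e P = Matrix.reindex e e P * Matrix.reindex e e Y := by
  have := congrArg (Matrix.reindexRingEquiv R e) h
  rwa [map_mul, map_mul] at this

theorem IsJordanFormOf.trace_eq {n : ℕ} {J : Matrix (Fin n) (Fin n) ℂ}
    {A : Matrix (Fin n) (Fin n) ℝ} (h : IsJordanFormOf J A) : J.trace = (A.trace : ℂ) := by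
  obtain ⟨-, P, hP, hAP⟩ := h
  have hdet := (Matrix.isUnit_iff_isUnit_det _).1 hP
  have hJ : J = P⁻¹ * (A.map (fun x : ℝ => (x : ℂ)) * P) := by
    rw [hAP, ← mul_assoc, Matrix.nonsing_inv_mul P hdet, one_mul]
  rw [hJ, Matrix.trace_mul_comm, mul_assoc, Matrix.mul_nonsing_inv P hdet, mul_one]
  simp [Matrix.trace]

/-- Both directions pass through the real matrix diag(B, -Bᵀ), which has Jordan form diag(J₁,
`negDiag J₁`) when J₁ is a Jordan form of B. -/
theorem exists_parallel_three_three_iff (hdim : finrank ℝ 𝔤 = 7) (hab : IsLieAbelian 𝔲)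
    (hu : finrank ℝ 𝔲 = 6) {f₇ : 𝔤} (hf₇ : f₇ ∉ 𝔲) :
    (∃ φ : 𝔤 [⋀^Fin 3]→ₗ[ℝ] ℝ, IsParallelG2Structure 1 φ ∧
        HasSignatureOn (inducedMetric 1 φ) 𝔲.toSubmodule 3 3) ↔
      ∃ (v : Basis (Fin 6) ℝ 𝔲) (J₁ : Matrix (Fin 3) (Fin 3) ℂ),
        (∃ A : Matrix (Fin 3) (Fin 3) ℝ, IsJordanFormOf J₁ A) ∧ J₁.trace = 0 ∧
        IsJordanFormOf (diagPair J₁ (negDiag J₁))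
          (LinearMap.toMatrix v v (LieModule.toEnd ℝ 𝔤 𝔲 f₇)) := by
  constructor
  · rintro ⟨φ, hφ, hsig⟩
    obtain ⟨hs, -⟩ := inducedMetric_symm_nondegenerate hφ.1
    have hgu := hsig.restrict_nondegenerate hs hu
    obtain ⟨n, J, ho, hJ, hgJ, hgA, hA, htAJ, -⟩ := hφ.exists_unit_operator hdim hab hu hf₇ hgu
    have hJ1 : J * J = 1 := by
      rcases hJ with ⟨h, -⟩ | ⟨-, h⟩
      · have h1 := ((hasSignatureOn_of_normal hφ.1 hu ho hgu).1 h).1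
        rw [hsig.1] at h1
        omega
      · exact h
    obtain ⟨v, B, hB, hv⟩ := exists_dual_frame hu hJ1 hA htAJ hgu (fun u v => hs u v) hgJ hgA
    obtain ⟨J₁, hJ₁⟩ := exists_isJordanFormOf B
    obtain ⟨P, hP, hBP⟩ := hJ₁.exists_similar
    refine ⟨v.reindex finSumFinEquiv, J₁, ⟨B, hJ₁⟩, by rw [hJ₁.trace_eq, hB, Complex.ofReal_zero],
      hJ₁.1.diagPair hJ₁.1.negDiag, _, isUnit_reindex hP finSumFinEquiv, ?_⟩
    have hm : LinearMap.toMatrix (v.reindex finSumFinEquiv) (v.reindex finSumFinEquiv)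
        (LieModule.toEnd ℝ 𝔤 𝔲 f₇) = Matrix.reindex finSumFinEquiv finSumFinEquiv
          (Matrix.fromBlocks B 0 0 (-B.transpose)) := by
      rw [← hv]
      ext i j
      simp [LinearMap.toMatrix_apply]
    rw [hm]
    exact reindex_mul_eq finSumFinEquiv hBP
  · rintro ⟨v, J₁, ⟨A, hA⟩, ht, -, P, hP, hvP⟩
    obtain ⟨R, hR, hAR⟩ := hA.exists_similar
    have hAR' := reindex_mul_eq (finSumFinEquiv (m := 3) (n := 3)) hAR
    have hR' := isUnit_reindex hR (finSumFinEquiv (m := 3) (n := 3))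
    have hdet := (Matrix.isUnit_iff_isUnit_det _).1 hR'
    set R' := Matrix.reindex finSumFinEquiv finSumFinEquiv R
    -- Over ℂ, ad f₇ on 𝔲 and diag(A, -Aᵀ) are both similar to the given Jordan matrix; both are
    -- real, so they are similar over ℝ.
    obtain ⟨Q, hQ, hvQ⟩ := exists_real_similar (hP.mul (R'.isUnit_nonsing_inv_iff.2 hR'))
      (X := LinearMap.toMatrix v v (LieModule.toEnd ℝ 𝔤 𝔲 f₇))
      (Y := Matrix.reindex finSumFinEquiv finSumFinEquiv
        (Matrix.fromBlocks A 0 0 (-A.transpose))) (by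
        have h : R'⁻¹ * (Matrix.reindex finSumFinEquiv finSumFinEquiv
            (Matrix.fromBlocks A 0 0 (-A.transpose))).map (fun x : ℝ => (x : ℂ)) =
            diagPair J₁ (negDiag J₁) * R'⁻¹ := by
          calc _ = R'⁻¹ * ((Matrix.reindex finSumFinEquiv finSumFinEquiv
              (Matrix.fromBlocks A 0 0 (-A.transpose))).map (fun x : ℝ => (x : ℂ)) * R') * R'⁻¹ := by
                rw [mul_assoc, mul_assoc, Matrix.mul_nonsing_inv R' hdet, mul_one]
            _ = R'⁻¹ * (R' * diagPair J₁ (negDiag J₁)) * R'⁻¹ := congrArg (R'⁻¹ * · * R'⁻¹) hAR'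
            _ = _ := by rw [← mul_assoc R'⁻¹, Matrix.nonsing_inv_mul R' hdet, one_mul]
        rw [← mul_assoc, hvP, mul_assoc, mul_assoc, h])
    obtain ⟨w, hw⟩ := exists_basis_toMatrix_eq v hQ hvQ
    refine exists_parallel_para hdim hab hu hf₇ w ?_ hw
    rwa [hA.trace_eq, Complex.ofReal_eq_zero] at ht

end NormalForms
end ParallelG2

theorem mainTheorem2 {𝔤 : Type*} [LieRing 𝔤] [LieAlgebra ℝ 𝔤] [FiniteDimensional ℝ 𝔤]
    (hdim : Module.finrank ℝ 𝔤 = 7) (𝔲 : LieIdeal ℝ 𝔤) (hab : IsLieAbelian 𝔲)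
    (hu : Module.finrank ℝ 𝔲 = 6) (f₇ : 𝔤) (hf₇ : f₇ ∉ 𝔲) :
    -- parallel `G₂`-structures
    ((∃ φ : 𝔤 [⋀^Fin 3]→ₗ[ℝ] ℝ, IsParallelG2Structure (-1) φ) ↔
      ∃ (a b : ℝ) (v : Module.Basis (Fin 6) ℝ 𝔲),
        LinearMap.toMatrix v v (LieModule.toEnd ℝ 𝔤 𝔲 f₇) =
          ofBlocks !![M 0 a, 0, 0; 0, M 0 b, 0; 0, 0, M 0 (-a - b)]) ∧
    -- parallel `G₂*`-structures, `𝔲` of signature `(2, 4)`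
    ((∃ φ : 𝔤 [⋀^Fin 3]→ₗ[ℝ] ℝ, IsParallelG2Structure 1 φ ∧
        HasSignatureOn (inducedMetric 1 φ) 𝔲.toSubmodule 2 4) ↔
      ∃ v : Module.Basis (Fin 6) ℝ 𝔲,
        (∃ a b : ℝ, a ≠ 0 ∧ LinearMap.toMatrix v v (LieModule.toEnd ℝ 𝔤 𝔲 f₇) =
          ofBlocks !![M a b, 0, 0; 0, M (-a) b, 0; 0, 0, M 0 (-2 * b)]) ∨
        (∃ c d : ℝ, LinearMap.toMatrix v v (LieModule.toEnd ℝ 𝔤 𝔲 f₇) =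
          ofBlocks !![M 0 c, 0, 0; 0, M 0 d, 0; 0, 0, M 0 (-(c + d))]) ∨
        (∃ e : ℝ, LinearMap.toMatrix v v (LieModule.toEnd ℝ 𝔤 𝔲 f₇) =
          ofBlocks !![M 0 e, 1, 0; 0, M 0 e, 0; 0, 0, M 0 (-2 * e)]) ∨
        LinearMap.toMatrix v v (LieModule.toEnd ℝ 𝔤 𝔲 f₇) =
          ofBlocks !![0, 1, 0; 0, 0, 1; 0, 0, 0]) ∧
    -- parallel `G₂*`-structures, `𝔲` of signature `(3, 3)`
    ((∃ φ : 𝔤 [⋀^Fin 3]→ₗ[ℝ] ℝ, IsParallelG2Structure 1 φ ∧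
        HasSignatureOn (inducedMetric 1 φ) 𝔲.toSubmodule 3 3) ↔
      ∃ (v : Module.Basis (Fin 6) ℝ 𝔲) (J₁ : Matrix (Fin 3) (Fin 3) ℂ),
        (∃ A : Matrix (Fin 3) (Fin 3) ℝ, IsJordanFormOf J₁ A) ∧ J₁.trace = 0 ∧
        IsJordanFormOf (diagPair J₁ (negDiag J₁))
          (LinearMap.toMatrix v v (LieModule.toEnd ℝ 𝔤 𝔲 f₇))) ∧
    -- flatness
    (∀ φ : 𝔤 [⋀^Fin 3]→ₗ[ℝ] ℝ, IsParallelG2Structure (-1) φ → IsFlat (inducedMetric (-1) φ)) ∧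
    (∀ φ : 𝔤 [⋀^Fin 3]→ₗ[ℝ] ℝ, IsParallelG2Structure 1 φ →
      ((inducedMetric 1 φ).restrict 𝔲.toSubmodule).Nondegenerate →
      IsFlat (inducedMetric 1 φ)) := by
  exact ⟨exists_parallelG2Structure_iff hdim hab hu hf₇,
    exists_parallel_two_four_iff hdim hab hu hf₇,
    exists_parallel_three_three_iff hdim hab hu hf₇,
    fun φ hφ => hφ.isFlat hdim hab hu hf₇ (inducedMetric_neg_one_restrict_nondegenerate hφ.1 _),
    fun φ hφ hgu => hφ.isFlat hdim hab hu hf₇ hgu⟩
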